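/- Let $m>1$ be an integer, let $\ell$ be an odd integer, and put $\alpha=1+2^m\ell$, $s=2^{m-1}$. With $[x,y]=x^{-1}y^{-1}xy$ and $x^y=y^{-1}xy$, let $$H=\langle A,B\mid A^{[A,B]}=A^{\alpha},\ B^{[B,A]}=B^{\alpha},\ A^{2^{2m-1}}=B^{2^{2m-1}}=1\rangle ,\qquad K=H/Z(H).$$ For a group $T$ with upper central series $1=Z_0(T)\subseteq Z_1(T)\subseteq\cdots$, let $\mathrm{Aut}_i(T)$ denote the kernel of the canonical map $\mathrm{Aut}(T)\to\mathrm{Aut}(T/Z_i(T))$. Then $\mathrm{Inn}(H)\mathrm{Aut}_2(H)\subseteq \mathrm{Aut}_3(H)$, $\mathrm{Inn}(K)\mathrm{Aut}_1(K)\subseteq \mathrm{Aut}_2(K)$, there is an isomorphism $\mathrm{Aut}_2(K)/\mathrm{Inn}(K)\mathrm{Aut}_1(K)\cong(\mathbb Z/2\mathbb Z)^4$, and the canonical map $\mathrm{Aut}(H)\to\mathrm{Aut}(K)$ induces an injective homomorphism $$\widehat\Lambda:\ \mathrm{Aut}_3(H)/\mathrm{Inn}(H)\mathrm{Aut}_2(H)\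 \hookrightarrow\ \mathrm{Aut}_2(K)/\mathrm{Inn}(K)\mathrm{Aut}_1(K).$$ Moreover, $H$ has an automorphism $\nu$ with $A\mapsto B$, $B\mapsto A$, and an automorphism $\Gamma$ with $A\mapsto A^{1+s}$, $B\mapsto BA^{s}$; the automorphisms $\Gamma$ and $\Gamma^\nu=\nu^{-1}\Gamma\nu$ belong to $\mathrm{Aut}_3(H)$; the image of $\widehat\Lambda$ is the subgroup generated by the images under $\widehat\Lambda$ of the cosets of $\Gamma$ and $\Gamma^\nu$, and it is isomorphic to the Klein four-group. Consequently, $$\mathrm{Aut}_3(H)=\mathrm{Inn}(H)\,\mathrm{Aut}_2(H)\,\langle\Gamma,\Gamma^\nu\rangle ,\qquad |\mathrm{Aut}_3(H)|=2^{8m-4}.$$ -/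

import Mathlib

namespace MacdonaldAut

section General

variable (T : Type*) [Group T]

/-- The canonical homomorphism `Aut(T) → Aut(T/N)`, for a characteristic subgroup `N` of `T`. -/
def quotAut (N : Subgroup T) [hN : N.Characteristic] : MulAut T →* MulAut (T ⧸ N) where
  toFun φ := QuotientGroup.congr N N φ (Subgroup.characteristic_iff_map_eq.mp hN φ)
  map_one' := by
    ext x
    induction x using QuotientGroup.induction_on with
    | H x => rfl
  map_mul' φ ψ := by
    ext x
    induction x using QuotientGroup.induction_on with
    | H x => rfl

theorem quotAut_mk (N : Subgroup T) [N.Characteristic] (φ : MulAut T) (x : T) :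
    quotAut T N φ (QuotientGroup.mk x) = QuotientGroup.mk (φ x) := rfl

/-- `Aut_i(T)`: the kernel of the canonical map `Aut(T) → Aut(T/Z_i(T))`, where `Z_i(T)` is the
`i`-th term of the upper central series. -/
def autI (i : ℕ) : Subgroup (MulAut T) :=
  (quotAut T (Subgroup.upperCentralSeries T i)).ker

instance autI_normal (i : ℕ) : (autI T i).Normal :=
  inferInstanceAs ((quotAut T (Subgroup.upperCentralSeries T i)).ker).Normal

/-- `Inn(T)`. -/
def inn : Subgroup (MulAut T) := (MulAut.conj : T →* MulAut T).range

instance inn_normal : (inn T).Normal where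
  conj_mem := by
    rintro _ ⟨t, rfl⟩ φ
    refine ⟨φ t, ?_⟩
    ext x
    simp

/-- `Inn(T) Aut_i(T)`, a normal subgroup of `Aut(T)`. -/
def innAutI (i : ℕ) : Subgroup (MulAut T) := inn T ⊔ autI T i

instance innAutI_normal (i : ℕ) : (innAutI T i).Normal :=
  inferInstanceAs (inn T ⊔ autI T i).Normal

/-- As both factors are normal, `Inn(T) Aut_i(T)` is the set of products. -/
theorem mem_innAutI_iff (i : ℕ) (φ : MulAut T) :
    φ ∈ innAutI T i ↔ ∃ σ ∈ inn T, ∃ τ ∈ autI T i, σ * τ = φ := by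
  exact Subgroup.mem_sup_of_normal_left

theorem mem_autI_iff (i : ℕ) (φ : MulAut T) :
    φ ∈ autI T i ↔ ∀ x : T, x⁻¹ * φ x ∈ Subgroup.upperCentralSeries T i := by
  rw [autI, MonoidHom.mem_ker]
  constructor
  · intro h x
    have := DFunLike.congr_fun h (QuotientGroup.mk x)
    rw [quotAut_mk] at this
    exact QuotientGroup.eq.mp this.symm
  · intro h
    ext x
    induction x using QuotientGroup.induction_on with
    | H x => exact (QuotientGroup.eq.mpr (h x)).symm

/-- `Λ : Aut(T) → Aut(Y)`, where `Y = T/Z(T)`. -/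
def Lam : MulAut T →* MulAut (T ⧸ Subgroup.center T) := quotAut T (Subgroup.center T)

theorem Lam_mem_autI {i : ℕ} {φ : MulAut T} (h : φ ∈ autI T (i + 1)) :
    Lam T φ ∈ autI (T ⧸ Subgroup.center T) i := by
  rw [mem_autI_iff] at h ⊢
  intro y
  induction y using QuotientGroup.induction_on with
  | H x =>
    have := h x
    rw [← Subgroup.comap_upperCentralSeries_quotient_center] at this
    exact this

theorem Lam_mem_innAutI {i : ℕ} {φ : MulAut T} (h : φ ∈ innAutI T (i + 1)) :
    Lam T φ ∈ innAutI (T ⧸ Subgroup.center T) i := by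
  rw [mem_innAutI_iff] at h
  obtain ⟨_, ⟨t, rfl⟩, τ, hτ, rfl⟩ := h
  rw [map_mul]
  refine Subgroup.mul_mem_sup ⟨QuotientGroup.mk t, ?_⟩ (Lam_mem_autI T hτ)
  ext y
  induction y using QuotientGroup.induction_on with
  | H x => rfl

/-- The quotient `Aut_{i+1}(T) / Inn(T) Aut_i(T)`, meaningful when `Inn(T) ⊆ Aut_{i+1}(T)`. -/
abbrev OutI (i : ℕ) : Type _ := autI T (i + 1) ⧸ (innAutI T i).subgroupOf (autI T (i + 1))

/-- The homomorphism
`Aut_{i+2}(T) / Inn(T) Aut_{i+1}(T) → Aut_{i+1}(Y) / Inn(Y) Aut_i(Y)`, `Y = T/Z(T)`,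
induced by `Λ`. -/
def LamHat (i : ℕ) : OutI T (i + 1) →* OutI (T ⧸ Subgroup.center T) i :=
  QuotientGroup.map _ _
    (((Lam T).comp (autI T (i + 2)).subtype).codRestrict
      (autI (T ⧸ Subgroup.center T) (i + 1)) (fun φ => Lam_mem_autI T φ.2))
    (fun _ hφ => Lam_mem_innAutI T hφ)

end General

/-- The commutator `[x, y] = x⁻¹ y⁻¹ x y`. -/
def comm {G : Type*} [Group G] (x y : G) : G := x⁻¹ * y⁻¹ * x * y

/-- The conjugate `x ^ y = y⁻¹ x y`. -/
def cnj {G : Type*} [Group G] (x y : G) : G := y⁻¹ * x * y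

/-- The relators of `H`, in the free group on `A = of 0` and `B = of 1`, with `α = 1 + 2 ^ m ℓ`:
`A^[A,B] = A^α`, `B^[B,A] = B^α`, `A^(2^(2m-1)) = 1`, `B^(2^(2m-1)) = 1`. -/
def relsH (m : ℕ) (l : ℤ) : Set (FreeGroup (Fin 2)) :=
  let A : FreeGroup (Fin 2) := FreeGroup.of 0
  let B : FreeGroup (Fin 2) := FreeGroup.of 1
  let α : ℤ := 1 + 2 ^ m * l
  {cnj A (comm A B) * (A ^ α)⁻¹, cnj B (comm B A) * (B ^ α)⁻¹,
    A ^ (2 ^ (2 * m - 1)), B ^ (2 ^ (2 * m - 1))}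

/-- The group
`H = ⟨A, B | A^[A,B] = A^α, B^[B,A] = B^α, A^(2^(2m-1)) = B^(2^(2m-1)) = 1⟩`,
with `α = 1 + 2 ^ m ℓ`. -/
abbrev H (m : ℕ) (l : ℤ) : Type := PresentedGroup (relsH m l)

/-- The generator `A` of `H`. -/
def genA (m : ℕ) (l : ℤ) : H m l := PresentedGroup.of 0

/-- The generator `B` of `H`. -/
def genB (m : ℕ) (l : ℤ) : H m l := PresentedGroup.of 1

/-- `K = H/Z(H)`. -/
abbrev K (m : ℕ) (l : ℤ) : Type := H m l ⧸ Subgroup.center (H m l)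

end MacdonaldAut

open scoped Pointwise

/-! Put R = ℤ/2^(2m-1), σ = 2^(m-2), κ = σℓ in R. Then α = 1 + 4κ and 8κ² = 0, and this nilpotency
truncates every collection formula to low degree. With C = [A, B], collection writes each element of
H as A^i B^j C^k with i, j, k in R. Conversely, an explicit polynomial group law on R³ satisfies the
defining relations, so the form is unique (`coordEquiv`).

In coordinates the upper central series is linear: Z₁ is i = j = 4κk = 0, Z₂ is 2κi = 2κj = 4κk = 0,
Z₃ is 4κi = 4κj = 0, and Z₄ = H. Moreover 2κi and 2κj are homomorphisms on H.

An automorphism lies in Aut₃(H) exactly when it sends (A, B) to a pair (x, y) congruent to (A, B)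
modulo Z₃ (`Near`). Such a pair always generates H, because it does so modulo the commutator
subgroup and H is nilpotent. The decisive computation is `Coord.cnj_comm_eq`: x^[x,y] equals x^α
times the central element C^(2κ(j_x + j_y - 1)). The interchange of A and B gives the companion
statement for y, with error governed by 2κ(i_x + i_y - 1). Hence every near pair defines an
automorphism of K, but it defines one of H only if both errors vanish (`Near.isMacdonald_iff`).

The four displacements 2κ(i_x - 1), 2κj_x, 2κi_y, 2κ(j_y - 1) are homomorphisms from Aut₂(K) to the
2-torsion of R, which has order two. Their common kernel is Inn(K)Aut₁(K) and they take all values,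
so the quotient is (ℤ/2)⁴. For automorphisms of H the vanishing of the errors makes the third
displacement determined by the first and the fourth by the second. This leaves at most a four-group,
which Γ and its conjugate fill. The order of Aut₃(H) is obtained by counting the coordinates of
admissible pairs. -/

namespace MacdonaldAut

/-! ### The model of H on triples of exponents -/

section Model

/-- The scalar `2 ^ (m - 2) ℓ` modulo `2 ^ (2m - 1)`; for `m ≥ 2` one has `α = 1 + 4κ`. -/
def kap (m : ℕ) (l : ℤ) : ZMod (2 ^ (2 * m - 1)) := ((2 ^ (m - 2) * l : ℤ) : ZMod (2 ^ (2 * m - 1)))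

/-- The power of two in 8κ² is at least 3 + 2(m - 2) = 2m - 1. This is the relation modulo which
almost all polynomial identities below hold. -/
theorem eight_kap_sq (m : ℕ) (l : ℤ) : 8 * kap m l ^ 2 = 0 := by
  have h : ((2 ^ (2 * m - 1) : ℕ) : ZMod (2 ^ (2 * m - 1))) = 0 := ZMod.natCast_self _
  have hd : (2 ^ (2 * m - 1) : ℕ) ∣ 8 * (2 ^ (m - 2)) ^ 2 := by
    rw [← pow_mul, show 8 = 2 ^ 3 by norm_num, ← pow_add]
    exact pow_dvd_pow 2 (by omega)
  obtain ⟨c, hc⟩ := hd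
  have : ((8 * (2 ^ (m - 2)) ^ 2 : ℕ) : ZMod (2 ^ (2 * m - 1))) = 0 := by
    rw [hc, Nat.cast_mul, h, zero_mul]
  push_cast at this
  rw [kap]
  push_cast
  linear_combination (l : ZMod (2 ^ (2 * m - 1))) ^ 2 * this

theorem exists_half_mul_pred {n : ℕ} (x : ZMod n) : ∃ t : ZMod n, x * (x - 1) = 2 * t := by
  obtain ⟨a, rfl⟩ := ZMod.intCast_surjective x
  obtain ⟨t, ht⟩ := Int.even_mul_pred_self a
  exact ⟨t, by exact_mod_cast congrArg (Int.cast : ℤ → ZMod n) (ht.trans (two_mul t).symm)⟩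

/-- A product of consecutive residues is even, which supplies the factor 2 missing from 8κ². -/
theorem four_kap_sq_mul (m : ℕ) (l : ℤ) (x : ZMod (2 ^ (2 * m - 1))) :
    4 * kap m l ^ 2 * (x * (x - 1)) = 0 := by
  obtain ⟨t, ht⟩ := exists_half_mul_pred x
  linear_combination 4 * kap m l ^ 2 * ht + t * eight_kap_sq m l

theorem two_kap_sq_mul_mul (m : ℕ) (l : ℤ) (x y : ZMod (2 ^ (2 * m - 1))) :
    2 * kap m l ^ 2 * (x * (x - 1)) * (y * (y - 1)) = 0 := by
  obtain ⟨t, ht⟩ := exists_half_mul_pred y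
  linear_combination 2 * kap m l ^ 2 * (x * (x - 1)) * ht + t * four_kap_sq_mul m l x

/-- Normal forms `A ^ i B ^ j C ^ k` of the elements of `H`, where `C = [A, B]`. -/
@[ext]
structure Coord (m : ℕ) (l : ℤ) where
  /-- the exponent of `A` -/
  i : ZMod (2 ^ (2 * m - 1))
  /-- the exponent of `B` -/
  j : ZMod (2 ^ (2 * m - 1))
  /-- the exponent of `C` -/
  k : ZMod (2 ^ (2 * m - 1))

namespace Coord

variable {m : ℕ} {l : ℤ}

/-- The law is the outcome of collecting A^i B^j C^k · A^i' B^j' C^k' with 8κ² = 0. It is postulated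
here; associativity makes it a group law, and `IsMacdonald.nf_mul_A` and `IsMacdonald.nf_mul_B` tie
it to H. -/
instance : Mul (Coord m l) where
  mul x y :=
    ⟨x.i + y.i - 4 * kap m l * y.i * x.k + 2 * kap m l * y.i * (y.i - 1) * x.j,
      x.j + y.j - 2 * kap m l * y.i * x.j * (x.j - 1) + 4 * kap m l * y.j * (x.k - y.i * x.j),
      x.k + y.k - y.i * x.j + 4 * kap m l * y.i * x.k * x.j
        + kap m l * y.i * (y.i - 1) * x.j * (x.j - 1) - 2 * kap m l * y.i * (y.i - 1) * x.j ^ 2⟩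

instance : One (Coord m l) := ⟨⟨0, 0, 0⟩⟩

instance : Inv (Coord m l) where
  inv x :=
    ⟨-x.i - 2 * x.i * x.j * kap m l - 4 * x.i * x.k * kap m l - 2 * x.i ^ 2 * x.j * kap m l,
      -x.j + 2 * x.i * x.j * kap m l + 4 * x.j * x.k * kap m l + 2 * x.i * x.j ^ 2 * kap m l,
      -x.k - x.i * x.j + x.i * x.j * kap m l - x.i * x.j ^ 2 * kap m l + x.i ^ 2 * x.j * kap m l
      - 4 * x.i * x.j * x.k * kap m l ^ 2 - x.i ^ 2 * x.j ^ 2 * kap m l - 4 * x.i ^ 2 * x.j *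
      x.k * kap m l ^ 2⟩

theorem mul_i (x y : Coord m l) : (x * y).i =
    x.i + y.i - 4 * kap m l * y.i * x.k + 2 * kap m l * y.i * (y.i - 1) * x.j := rfl

theorem mul_j (x y : Coord m l) : (x * y).j =
    x.j + y.j - 2 * kap m l * y.i * x.j * (x.j - 1) + 4 * kap m l * y.j * (x.k - y.i * x.j) := rfl

theorem mul_k (x y : Coord m l) : (x * y).k =
    x.k + y.k - y.i * x.j + 4 * kap m l * y.i * x.k * x.j
      + kap m l * y.i * (y.i - 1) * x.j * (x.j - 1) - 2 * kap m l * y.i * (y.i - 1) * x.j ^ 2 := rfl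

@[simp] theorem one_i : (1 : Coord m l).i = 0 := rfl
@[simp] theorem one_j : (1 : Coord m l).j = 0 := rfl
@[simp] theorem one_k : (1 : Coord m l).k = 0 := rfl

/-- In each coordinate the two sides differ by an element of the ideal generated by 8κ² and the
parity relations. The long expressions are the cofactors. -/
protected theorem mul_assoc (x y z : Coord m l) : x * y * z = x * (y * z) := by
  have h8 := eight_kap_sq m l
  have par := four_kap_sq_mul m l
  have par2 := two_kap_sq_mul_mul m l
  ext
  · simp only [mul_i, mul_j, mul_k]
    generalize kap m l = κ at *
    linear_combination
      (-x.j * y.i * z.i + x.j * y.j * z.i - x.j * y.k * z.i - 2 * x.k * y.j * z.i - 2 * x.k *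
      y.k * z.i - 2 * x.j * x.k * y.i * z.i + 2 * x.j * y.i * y.j * z.i + 2 * x.j * y.i * y.k *
      z.i + x.j * y.i ^ 2 * z.i + 2 * x.j * y.k * z.i ^ 2 + 2 * x.k * y.j * z.i ^ 2 - 2 * x.j *
      y.i * y.j * z.i ^ 2 - x.j * y.j * z.i ^ 3 - 4 * x.j * y.j * y.k * z.i ^ 2 * κ - x.j * y.j
      ^ 2 * z.i ^ 2 * κ - 4 * x.j * y.k ^ 2 * z.i ^ 2 * κ + 4 * x.j * y.j * y.k * z.i ^ 3 * κ +
      2 * x.j * y.j ^ 2 * z.i ^ 3 * κ - x.j * y.j ^ 2 * z.i ^ 4 * κ) * h8 + (-y.i * z.i ^ 2 +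
      y.i ^ 2 * z.i) * par x.j + (3 * x.j * y.j) * par z.i
  · simp only [mul_i, mul_j, mul_k]
    generalize kap m l = κ at *
    linear_combination
      (-x.j * y.i * z.i + x.j * y.i * z.j + x.j * y.k * z.i - 2 * x.k * y.k * z.j + 2 * x.j *
      x.k * y.i * z.j - 2 * x.j * x.k * y.j * z.i - x.j * y.i * y.j * z.i + 2 * x.j * y.i * y.k
      * z.j - x.j * y.i * z.i * z.j - x.j * y.i ^ 2 * z.j - 2 * x.j * y.j * y.k * z.i - x.j *
      y.j * z.i * z.j + x.j * y.j * z.i ^ 2 - x.j * y.j ^ 2 * z.i - x.j ^ 2 * y.k * z.i - x.k *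
      y.j ^ 2 * z.i + x.j * y.i * y.j ^ 2 * z.i - x.j * y.j * z.i ^ 2 * z.j + 3 * x.j ^ 2 * y.i
      * y.j * z.i + x.j ^ 2 * y.i * z.i * z.j + x.j ^ 3 * y.i * z.i - 4 * x.j * x.k * y.i * y.j
      * z.i * κ - 4 * x.j * y.j * y.k * z.i * z.j * κ - 4 * x.j * y.j * y.k * z.i ^ 2 * κ - 2 *
      x.j * y.j ^ 2 * z.i ^ 2 * κ - 8 * x.j * y.k ^ 2 * z.i * z.j * κ - x.j ^ 2 * y.i ^ 2 * z.i
      * κ - 4 * x.k ^ 2 * y.j ^ 2 * z.i * κ + 8 * x.j * x.k * y.i * y.j ^ 2 * z.i * κ + 12 * x.j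
      * y.j * y.k * z.i ^ 2 * z.j * κ + 4 * x.j * y.j ^ 2 * y.k * z.i ^ 2 * κ + 4 * x.j * y.j ^
      2 * z.i ^ 2 * z.j * κ + 2 * x.j * y.j ^ 2 * z.i ^ 3 * κ + 2 * x.j * y.j ^ 3 * z.i ^ 2 * κ
      + 4 * x.j ^ 2 * x.k * y.i * y.j * z.i * κ + 4 * x.j ^ 2 * y.i ^ 2 * y.j * z.i * κ + 2 *
      x.j ^ 3 * y.i ^ 2 * z.i * κ - 4 * x.j * y.j ^ 2 * z.i ^ 3 * z.j * κ - 2 * x.j * y.j ^ 3 *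
      z.i ^ 3 * κ - 4 * x.j ^ 2 * y.i ^ 2 * y.j ^ 2 * z.i * κ - 4 * x.j ^ 3 * y.i ^ 2 * y.j *
      z.i * κ - x.j ^ 4 * y.i ^ 2 * z.i * κ) * h8 + (-3 * y.i * z.i + y.i * z.j - y.j * z.i -
      y.i ^ 2 * z.j + y.j * z.i ^ 2) * par x.j
  · simp only [mul_i, mul_j, mul_k]
    generalize kap m l = κ at *
    linear_combination
      (x.j * y.i * z.i - x.j * y.j * z.i + x.j * y.k * z.i + x.j * x.k * y.i * z.i + 2 * x.j *
      x.k * y.j * z.i + 2 * x.j * x.k * y.k * z.i - x.j * y.i * y.j * z.i - x.j * y.k * z.i ^ 2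
      + 2 * x.k * y.j * y.k * z.i + x.k * y.j ^ 2 * z.i + 2 * x.k ^ 2 * y.j * z.i - 2 * x.j *
      x.k * y.i * y.j * z.i - 2 * x.j * x.k * y.j * z.i ^ 2 - 2 * x.j * y.i * y.j * y.k * z.i -
      x.j * y.i * y.j ^ 2 * z.i + x.j * y.i ^ 2 * y.j * z.i + x.j * y.j * z.i ^ 3 + x.j ^ 2 *
      x.k * y.i * z.i - 2 * x.j ^ 2 * y.i * y.k * z.i - x.j ^ 2 * y.i ^ 2 * z.i - x.j ^ 2 * y.k
      * z.i ^ 2 - x.k * y.j ^ 2 * z.i ^ 2 + 4 * x.j * x.k * y.i * y.j * z.i * κ + x.j * y.i *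
      y.j ^ 2 * z.i ^ 2 + 2 * x.j * y.j * y.k * z.i ^ 2 * κ + x.j * y.j ^ 2 * z.i ^ 2 * κ + 2 *
      x.j * y.k ^ 2 * z.i ^ 2 * κ + 2 * x.j ^ 2 * y.i * y.j * z.i ^ 2 + 2 * x.k ^ 2 * y.j ^ 2 *
      z.i * κ - 2 * x.j * x.k * y.i * y.j * z.i ^ 2 * κ - 4 * x.j * x.k * y.i * y.j ^ 2 * z.i *
      κ - 2 * x.j * x.k * y.i ^ 2 * y.j * z.i * κ + 8 * x.j * x.k ^ 2 * y.i * y.j * z.i * κ - 2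
      * x.j * y.j * y.k * z.i ^ 3 * κ - x.j * y.j ^ 2 * z.i ^ 3 * κ + 4 * x.j ^ 2 * x.k * y.i ^
      2 * z.i * κ - 4 * x.j ^ 2 * y.i ^ 2 * y.j * z.i * κ - x.j ^ 2 * y.i ^ 3 * z.i * κ + 2 *
      x.j ^ 2 * y.j * y.k * z.i ^ 2 * κ + 2 * x.j ^ 2 * y.k ^ 2 * z.i ^ 2 * κ - 2 * x.k ^ 2 *
      y.j ^ 2 * z.i ^ 2 * κ + 4 * x.j * x.k * y.i * y.j ^ 2 * z.i ^ 2 * κ + x.j * y.j ^ 2 * z.i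
      ^ 4 * κ + 2 * x.j ^ 2 * x.k * y.i * y.j * z.i ^ 2 * κ - 10 * x.j ^ 2 * x.k * y.i ^ 2 * y.j
      * z.i * κ + 2 * x.j ^ 2 * y.i ^ 2 * y.j * z.i ^ 2 * κ + 2 * x.j ^ 2 * y.i ^ 2 * y.j ^ 2 *
      z.i * κ + 2 * x.j ^ 2 * y.i ^ 3 * y.j * z.i * κ - 2 * x.j ^ 2 * y.j * y.k * z.i ^ 3 * κ -
      x.j ^ 2 * y.j ^ 2 * z.i ^ 3 * κ - 4 * x.j ^ 3 * x.k * y.i ^ 2 * z.i * κ - 2 * x.j ^ 2 *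
      y.i ^ 2 * y.j ^ 2 * z.i ^ 2 * κ - 2 * x.j ^ 3 * y.i ^ 2 * y.j * z.i ^ 2 * κ + 2 * x.j ^ 3
      * y.i ^ 3 * y.j * z.i * κ + x.j ^ 4 * y.i ^ 3 * z.i * κ) * h8 + (y.i * z.i - y.j * z.i +
      y.k * z.i - 3 * y.i * y.j * z.i + y.i * z.i ^ 2 + x.j * y.i * z.i ^ 2 + x.j * y.i ^ 2 *
      z.i + 3 * y.i ^ 2 * y.j * z.i + y.j * z.i ^ 3 - 3 * x.j * y.i ^ 2 * z.i * κ + y.j ^ 2 *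
      z.i ^ 2 * κ + x.j * y.i ^ 2 * z.i ^ 2 * κ - x.j ^ 2 * y.i ^ 2 * z.i * κ - x.j ^ 2 * y.i ^
      2 * z.i ^ 2 * κ + y.j ^ 2 * z.i ^ 4 * κ) * par x.j + (-3 * x.j * y.j - x.k * y.j + x.j *
      y.i * y.j) * par z.i + (-y.i - 3 * y.j) * par2 x.j z.i

protected theorem inv_mul_cancel (x : Coord m l) : x⁻¹ * x = 1 := by
  have h8 := eight_kap_sq m l
  have par := four_kap_sq_mul m l
  have par2 := two_kap_sq_mul_mul m l
  ext
  · simp only [mul_i, Inv.inv, one_i]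
    generalize kap m l = κ at *
    linear_combination
      (-x.i * x.j * x.k - x.i ^ 2 * x.j + x.i ^ 2 * x.j * x.k + 2 * x.i ^ 2 * x.j * x.k * κ +
      x.i ^ 3 * x.j ^ 2 + 2 * x.i ^ 3 * x.j * x.k * κ) * h8
  · simp only [mul_j, Inv.inv, one_j]
    generalize kap m l = κ at *
    linear_combination
      (x.i * x.j + x.i * x.j * x.k - x.i * x.j ^ 3 + x.i ^ 2 * x.j ^ 2 - 2 * x.i * x.j ^ 2 * x.k
      * κ - 4 * x.i * x.j ^ 2 * x.k ^ 2 * κ - 6 * x.i ^ 2 * x.j ^ 2 * x.k * κ - x.i ^ 3 * x.j ^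
      2 * κ - 4 * x.i ^ 2 * x.j ^ 3 * x.k * κ - 2 * x.i ^ 3 * x.j ^ 3 * κ - x.i ^ 3 * x.j ^ 4 *
      κ) * h8 + (x.j - x.j ^ 3) * par x.i + (x.i) * par x.j
  · simp only [mul_k, Inv.inv, one_k]
    generalize kap m l = κ at *
    linear_combination
      (-2 * x.i * x.j * x.k ^ 2 - x.i * x.j ^ 2 * x.k - 2 * x.i ^ 2 * x.j * x.k - 2 * x.i ^ 2 *
      x.j ^ 2 - 2 * x.i ^ 2 * x.j ^ 2 * x.k + 2 * x.i * x.j ^ 2 * x.k ^ 2 * κ + 6 * x.i ^ 2 *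
      x.j ^ 2 * x.k * κ + 2 * x.i ^ 3 * x.j ^ 2 * κ - 2 * x.i ^ 2 * x.j ^ 2 * x.k ^ 2 * κ + 2 *
      x.i ^ 3 * x.j ^ 2 * x.k * κ + x.i ^ 3 * x.j ^ 3 * κ - 8 * x.i ^ 2 * x.j ^ 2 * x.k ^ 2 * κ
      ^ 2 - 4 * x.i ^ 3 * x.j ^ 2 * x.k * κ ^ 2 - 4 * x.i ^ 3 * x.j ^ 3 * x.k * κ - 2 * x.i ^ 3
      * x.j ^ 4 * κ - x.i ^ 4 * x.j ^ 3 * κ - 8 * x.i ^ 3 * x.j ^ 2 * x.k ^ 2 * κ ^ 2 - 4 * x.i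
      ^ 3 * x.j ^ 3 * x.k * κ ^ 2 - 4 * x.i ^ 4 * x.j ^ 2 * x.k * κ ^ 2 - 4 * x.i ^ 4 * x.j ^ 3
      * x.k * κ ^ 2) * h8 + (-3 * x.i * x.j + x.i ^ 2 * x.j ^ 2 * κ - 3 * x.i ^ 2 * x.j ^ 4 * κ)
      * par x.i + (-5 * x.i) * par2 x.i x.j

instance : Group (Coord m l) :=
  Group.ofLeftAxioms Coord.mul_assoc
    (fun x => by ext <;> simp [mul_i, mul_j, mul_k])
    Coord.inv_mul_cancel

end Coord

end Model

end MacdonaldAut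

namespace MacdonaldAut

/-! ### Powers with exponents modulo n -/

section ZModPow

variable {G : Type*} [Group G] {n : ℕ}

/-- The power `x ^ i` with exponent `i : ZMod n`, meaningful when `x ^ n = 1`. -/
def zpw (x : G) (i : ZMod n) : G := x ^ (i.cast : ℤ)

theorem zpw_intCast {x : G} (hx : x ^ n = 1) (a : ℤ) : zpw x (a : ZMod n) = x ^ a := by
  have h : (n : ℤ) ∣ a - ((a : ZMod n).cast : ℤ) := by
    rw [← ZMod.intCast_eq_intCast_iff_dvd_sub]
    simp
  obtain ⟨c, hc⟩ := h
  have : a = ((a : ZMod n).cast : ℤ) + n * c := by linarith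
  conv_rhs => rw [this]
  rw [zpow_add, zpow_mul, zpow_natCast, hx, one_zpow, mul_one, zpw]

theorem zpw_natCast {x : G} (hx : x ^ n = 1) (a : ℕ) : zpw x (a : ZMod n) = x ^ a := by
  have := zpw_intCast hx (a : ℤ)
  rwa [Int.cast_natCast, zpow_natCast] at this

theorem zpw_zero {x : G} (hx : x ^ n = 1) : zpw x (0 : ZMod n) = 1 := by
  simpa using zpw_natCast hx 0

theorem zpw_one {x : G} (hx : x ^ n = 1) : zpw x (1 : ZMod n) = x := by
  simpa using zpw_natCast hx 1

theorem zpw_add {x : G} (hx : x ^ n = 1) (i j : ZMod n) : zpw x (i + j) = zpw x i * zpw x j := by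
  obtain ⟨a, rfl⟩ := ZMod.intCast_surjective i
  obtain ⟨b, rfl⟩ := ZMod.intCast_surjective j
  rw [← Int.cast_add, zpw_intCast hx, zpw_intCast hx, zpw_intCast hx, zpow_add]

theorem zpw_neg {x : G} (hx : x ^ n = 1) (i : ZMod n) : zpw x (-i) = (zpw x i)⁻¹ := by
  rw [eq_inv_iff_mul_eq_one, ← zpw_add hx, neg_add_cancel, zpw_zero hx]

theorem zpw_inv {x : G} (hx : x ^ n = 1) (i : ZMod n) : zpw x⁻¹ i = zpw x (-i) := by
  rw [zpw_neg hx, zpw, zpw, inv_zpow]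

theorem map_zpw {G' : Type*} [Group G'] (f : G →* G') (x : G) (i : ZMod n) :
    f (zpw x i) = zpw (f x) i := map_zpow f x _

/-- The one-step recursion can be run backwards in a group, so it also settles negative exponents.
-/
theorem eq_zpow_of_succ {g : G} {f : ℤ → G} (h0 : f 0 = 1) (h1 : ∀ a, f (a + 1) = f a * g)
    (a : ℤ) : f a = g ^ a := by
  induction a using Int.induction_on with
  | zero => simpa using h0
  | succ a ih => rw [h1, ih, zpow_add_one]
  | pred a ih =>
    have := h1 (-a - 1)
    rw [sub_add_cancel, ih] at this
    rw [zpow_sub_one, this, mul_inv_cancel_right]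

end ZModPow

/-- The relations satisfied by `A`, `B` and `C = [A, B]` in `H`. -/
structure IsMacdonald {G : Type*} [Group G] (m : ℕ) (l : ℤ) (A B C : G) : Prop where
  pow_A : A ^ 2 ^ (2 * m - 1) = 1
  pow_B : B ^ 2 ^ (2 * m - 1) = 1
  conj_A : C⁻¹ * A * C = A ^ (1 + 2 ^ m * l : ℤ)
  conj_B : C * B * C⁻¹ = B ^ (1 + 2 ^ m * l : ℤ)
  comm_AB : B⁻¹ * A * B = A * C

theorem four_kap {m : ℕ} (hm : 1 < m) (l : ℤ) :
    4 * kap m l = ((2 ^ m * l : ℤ) : ZMod (2 ^ (2 * m - 1))) := by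
  obtain ⟨r, rfl⟩ := Nat.exists_eq_add_of_le (show 2 ≤ m from hm)
  rw [kap, Nat.add_sub_cancel_left, pow_add]
  push_cast
  ring

/-! ### Collection in a group satisfying the relations -/

namespace IsMacdonald

variable {G : Type*} [Group G] {m : ℕ} {l : ℤ} {A B C : G}

/-- Since [B, A] = [A, B]⁻¹, the relations are symmetric in A and B. This gives the interchange
automorphism and halves the later computations. -/
theorem symm (h : IsMacdonald m l A B C) : IsMacdonald m l B A C⁻¹ where
  pow_A := h.pow_B
  pow_B := h.pow_A
  conj_A := by rw [inv_inv]; exact h.conj_B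
  conj_B := by rw [inv_inv]; exact h.conj_A
  comm_AB := by
    have := h.comm_AB
    rw [eq_mul_inv_iff_mul_eq, ← mul_right_inj A]
    calc A * (A⁻¹ * B * A * C) = B * (A * C) := by group
      _ = A * B := by rw [← this]; group

theorem conj_zpw (hm : 1 < m) (h : IsMacdonald m l A B C) (i : ZMod (2 ^ (2 * m - 1))) :
    C⁻¹ * zpw A i * C = zpw A ((1 + 4 * kap m l) * i) := by
  obtain ⟨a, rfl⟩ := ZMod.intCast_surjective i
  have := conj_zpow (i := a) (a := C⁻¹) (b := A)
  rw [inv_inv, h.conj_A, ← zpow_mul] at this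
  rw [zpw_intCast h.pow_A, ← this, four_kap hm, ← zpw_intCast h.pow_A]
  push_cast
  rfl

/-- Moving the C's to the left turns the A's into A^α, A^(α²), …. As 16κ² = 0, α^r = 1 + 4κr, and
summing over r = 1, …, n gives n + 2κn(n + 1). -/
theorem mul_pow_eq (hm : 1 < m) (h : IsMacdonald m l A B C) (n : ℕ) :
    (A * C) ^ n =
      C ^ n * zpw A (n + 2 * kap m l * n * (n + 1) : ZMod (2 ^ (2 * m - 1))) := by
  induction n with
  | zero => simp [zpw_zero h.pow_A]
  | succ n ih =>
    have e : ((n + 1 : ℕ) + 2 * kap m l * (n + 1 : ℕ) * ((n + 1 : ℕ) + 1) :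
        ZMod (2 ^ (2 * m - 1))) =
        (1 + 4 * kap m l) * ((n + 2 * kap m l * n * (n + 1)) + 1) := by
      push_cast
      linear_combination (-n * (n + 1) : ZMod (2 ^ (2 * m - 1))) * eight_kap_sq m l
    rw [pow_succ, ih, e, ← conj_zpw hm h, zpw_add h.pow_A _ 1, zpw_one h.pow_A]
    group

/-- AC is conjugate to A, so its power of exponent 2^(2m-1) is trivial. For this exponent the A-part
of `mul_pow_eq` is trivial too. -/
theorem pow_C (hm : 1 < m) (h : IsMacdonald m l A B C) : C ^ 2 ^ (2 * m - 1) = 1 := by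
  have h1 := mul_pow_eq hm h (2 ^ (2 * m - 1))
  have h2 := conj_pow (i := 2 ^ (2 * m - 1)) (a := B⁻¹) (b := A)
  rw [inv_inv, h.comm_AB, h.pow_A, mul_one, inv_mul_cancel] at h2
  rw [h2, ZMod.natCast_self, mul_zero, zero_mul, add_zero, zpw_zero h.pow_A, mul_one] at h1
  exact h1.symm

theorem conj_B_zpw (hm : 1 < m) (h : IsMacdonald m l A B C) (i : ZMod (2 ^ (2 * m - 1))) :
    B⁻¹ * zpw A i * B = zpw C i * zpw A (i + 2 * kap m l * i * (i + 1)) := by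
  obtain ⟨a, rfl⟩ := ZMod.natCast_zmod_surjective i
  have h2 := conj_pow (i := a) (a := B⁻¹) (b := A)
  rw [inv_inv, h.comm_AB, mul_pow_eq hm h] at h2
  rw [zpw_natCast h.pow_A, zpw_natCast (h.pow_C hm), h2]

theorem conj_A_zpw (hm : 1 < m) (h : IsMacdonald m l A B C) (j : ZMod (2 ^ (2 * m - 1))) :
    A⁻¹ * zpw B j * A = zpw C (-j) * zpw B (j + 2 * kap m l * j * (j + 1)) := by
  rw [h.symm.conj_B_zpw hm, zpw_inv (h.pow_C hm)]

theorem zpw_A_mul_zpw_C (hm : 1 < m) (h : IsMacdonald m l A B C)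
    (i k : ZMod (2 ^ (2 * m - 1))) :
    zpw A i * zpw C k = zpw C k * zpw A (i * (1 + 4 * kap m l * k)) := by
  obtain ⟨a, rfl⟩ := ZMod.natCast_zmod_surjective k
  rw [zpw_natCast (h.pow_C hm)]
  induction a with
  | zero => simp
  | succ a ih =>
    have e : i * (1 + 4 * kap m l * (a + 1 : ℕ)) =
        (1 + 4 * kap m l) * (i * (1 + 4 * kap m l * a)) := by
      push_cast
      linear_combination (-2 * i * a) * eight_kap_sq m l
    rw [pow_succ, e, ← conj_zpw hm h, ← mul_assoc, ih]
    group

theorem zpw_C_mul_zpw_B (hm : 1 < m) (h : IsMacdonald m l A B C)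
    (j k : ZMod (2 ^ (2 * m - 1))) :
    zpw C k * zpw B j = zpw B (j * (1 + 4 * kap m l * k)) * zpw C k := by
  have := h.symm.zpw_A_mul_zpw_C hm (j * (1 + 4 * kap m l * k)) (-k)
  rw [zpw_inv (h.pow_C hm), neg_neg] at this
  rw [this]
  congr 2
  linear_combination (2 * j * k ^ 2) * eight_kap_sq m l

theorem commute_zpw_C_A (hm : 1 < m) (h : IsMacdonald m l A B C)
    {k : ZMod (2 ^ (2 * m - 1))} (hk : 4 * kap m l * k = 0) (i : ZMod (2 ^ (2 * m - 1))) :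
    zpw A i * zpw C k = zpw C k * zpw A i := by
  rw [h.zpw_A_mul_zpw_C hm, hk, add_zero, mul_one]

theorem commute_zpw_C_B (hm : 1 < m) (h : IsMacdonald m l A B C)
    {k : ZMod (2 ^ (2 * m - 1))} (hk : 4 * kap m l * k = 0) (j : ZMod (2 ^ (2 * m - 1))) :
    zpw C k * zpw B j = zpw B j * zpw C k := by
  rw [h.zpw_C_mul_zpw_B hm, hk, add_zero, mul_one]

/-- Powers of C with exponent divisible by 4κ commute with A and B because 16κ² = 0. Each passage of
A^(4κu) across a B therefore leaves one more factor C^(4κu), and these factors accumulate freely. -/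
theorem zpw_A_mul_zpw_B (hm : 1 < m) (h : IsMacdonald m l A B C)
    (u j : ZMod (2 ^ (2 * m - 1))) :
    zpw A (4 * kap m l * u) * zpw B j =
      zpw B j * zpw A (4 * kap m l * u) * zpw C (4 * kap m l * u * j) := by
  have hc : ∀ v, 4 * kap m l * (4 * kap m l * v) = 0 := fun v => by
    linear_combination (2 * v) * eight_kap_sq m l
  have h1 := h.conj_B_zpw hm (4 * kap m l * u)
  have e : 4 * kap m l * u + 2 * kap m l * (4 * kap m l * u) * (4 * kap m l * u + 1) =
      4 * kap m l * u := by
    linear_combination (u * (4 * kap m l * u + 1)) * eight_kap_sq m l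
  rw [e, ← h.commute_zpw_C_A hm (hc u)] at h1
  have h1' : zpw A (4 * kap m l * u) * B =
      B * (zpw A (4 * kap m l * u) * zpw C (4 * kap m l * u)) := by
    rw [← h1]; group
  obtain ⟨a, rfl⟩ := ZMod.natCast_zmod_surjective j
  rw [zpw_natCast h.pow_B]
  induction a with
  | zero => simp [zpw_zero (h.pow_C hm)]
  | succ a ih =>
    have e2 : 4 * kap m l * u * (a + 1 : ℕ) = 4 * kap m l * u + 4 * kap m l * u * a := by
      push_cast; ring
    have hcB : zpw C (4 * kap m l * u * (a : ZMod (2 ^ (2 * m - 1)))) * B =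
        B * zpw C (4 * kap m l * u * (a : ZMod (2 ^ (2 * m - 1)))) := by
      have := h.commute_zpw_C_B hm (k := 4 * kap m l * u * (a : ZMod (2 ^ (2 * m - 1))))
        (by rw [mul_assoc _ u]; exact hc _) 1
      rwa [zpw_one h.pow_B] at this
    rw [pow_succ, ← mul_assoc, ih, mul_assoc, hcB, ← mul_assoc, mul_assoc (B ^ a), h1', e2,
      zpw_add (h.pow_C hm)]
    simp only [mul_assoc]

/-- The element `A ^ i B ^ j C ^ k`. -/
def nf (A B C : G) (x : Coord m l) : G := zpw A x.i * zpw B x.j * zpw C x.k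

theorem nf_mul_B (hm : 1 < m) (h : IsMacdonald m l A B C) (x : Coord m l) :
    nf A B C (x * ⟨0, 1, 0⟩) = nf A B C x * B := by
  have h1 := h.zpw_C_mul_zpw_B hm 1 x.k
  rw [zpw_one h.pow_B] at h1
  rw [nf, nf, mul_assoc _ (zpw C x.k), h1, one_mul]
  simp only [Coord.mul_i, Coord.mul_j, Coord.mul_k]
  rw [show x.j + 1 - 2 * kap m l * 0 * x.j * (x.j - 1) + 4 * kap m l * 1 * (x.k - 0 * x.j) =
    x.j + (1 + 4 * kap m l * x.k) by ring, zpw_add h.pow_B]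
  ring_nf
  simp only [mul_assoc]

/-- Passing A leftwards over C^k leaves A^(-4κk), and passing it over B^j leaves C^(-j). The
remainder A^(-4κk) then commutes with C^(-j) and crosses the power of B at the cost of C^(4κkj). The
calculation reads this chain from the collected form back to the product. -/
theorem nf_mul_A (hm : 1 < m) (h : IsMacdonald m l A B C) (x : Coord m l) :
    nf A B C (x * ⟨1, 0, 0⟩) = nf A B C x * A := by
  obtain ⟨i, j, k⟩ := x
  have hA := h.pow_A
  have hB := h.pow_B
  have hC := h.pow_C hm
  -- move `A` past `C ^ k`
  have h1 : zpw C k * A = zpw A (1 + 4 * kap m l * -k) * zpw C k := by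
    rw [h.zpw_A_mul_zpw_C hm]
    nth_rw 1 [← zpw_one hA]
    congr 2
    linear_combination (2 * k ^ 2) * eight_kap_sq m l
  -- move `A` past `B ^ j`
  have h2 : zpw B j * A = A * (zpw B (j - 2 * kap m l * j * (j - 1)) * zpw C (-j)) := by
    have h3 := h.conj_A_zpw hm j
    rw [h.zpw_C_mul_zpw_B hm] at h3
    rw [show j - 2 * kap m l * j * (j - 1) =
      (j + 2 * kap m l * j * (j + 1)) * (1 + 4 * kap m l * -j) by
        linear_combination (j ^ 2 * (j + 1)) * eight_kap_sq m l, ← h3]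
    group
  have h4 : zpw C (-j) * zpw A (4 * kap m l * -k) = zpw A (4 * kap m l * -k) * zpw C (-j) := by
    rw [h.zpw_A_mul_zpw_C hm]
    congr 2
    linear_combination (-2 * k * j) * eight_kap_sq m l
  have h5 : zpw B (j - 2 * kap m l * j * (j - 1)) * zpw A (4 * kap m l * -k) =
      zpw A (4 * kap m l * -k) * zpw B (j - 2 * kap m l * j * (j - 1)) *
        zpw C (4 * kap m l * k * j) := by
    have h6 := h.zpw_A_mul_zpw_B hm (-k) (j - 2 * kap m l * j * (j - 1))
    rw [h6, mul_assoc _ (zpw C _), ← zpw_add hC]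
    have : 4 * kap m l * -k * (j - 2 * kap m l * j * (j - 1)) + 4 * kap m l * k * j = 0 := by
      linear_combination (k * j * (j - 1)) * eight_kap_sq m l
    rw [this, zpw_zero hC, mul_one]
  have hi : (((⟨i, j, k⟩ : Coord m l) * ⟨1, 0, 0⟩).i) = i + 1 + 4 * kap m l * -k := by
    simp only [Coord.mul_i]; ring
  have hj : (((⟨i, j, k⟩ : Coord m l) * ⟨1, 0, 0⟩).j) = j - 2 * kap m l * j * (j - 1) := by
    simp only [Coord.mul_j]; ring
  have hk : (((⟨i, j, k⟩ : Coord m l) * ⟨1, 0, 0⟩).k) = 4 * kap m l * k * j + (-j + k) := by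
    simp only [Coord.mul_k]; ring
  simp only [nf]
  rw [hi, hj, hk, zpw_add hA, zpw_add hA, zpw_one hA, zpw_add hC, zpw_add hC]
  calc _ = zpw A i * A * (zpw A (4 * kap m l * -k) * zpw B (j - 2 * kap m l * j * (j - 1)) *
        zpw C (4 * kap m l * k * j)) * zpw C (-j) * zpw C k := by simp only [mul_assoc]
    _ = zpw A i * (A * (zpw B (j - 2 * kap m l * j * (j - 1)) *
        (zpw A (4 * kap m l * -k) * zpw C (-j)))) * zpw C k := by
      rw [← h5]; simp only [mul_assoc]
    _ = zpw A i * (A * (zpw B (j - 2 * kap m l * j * (j - 1)) * zpw C (-j))) *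
        (zpw A (4 * kap m l * -k) * zpw C k) := by
      rw [← h4]; simp only [mul_assoc]
    _ = zpw A i * zpw B j * (A * zpw A (4 * kap m l * -k) * zpw C k) := by
      rw [← h2]; simp only [mul_assoc]
    _ = zpw A i * zpw B j * zpw C k * A := by
      rw [mul_assoc (zpw A i * zpw B j) (zpw C k) A, h1, zpw_add hA, zpw_one hA]

end IsMacdonald

end MacdonaldAut

namespace MacdonaldAut

/-! ### The isomorphism of H with its model -/

section Presentation

variable {m : ℕ} {l : ℤ}

theorem IsMacdonald.eq_comm {G : Type*} [Group G] {A B C : G} (h : IsMacdonald m l A B C) :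
    C = comm A B := by
  have := h.comm_AB
  rw [comm, mul_assoc, mul_assoc, ← mul_assoc B⁻¹, this, inv_mul_cancel_left]

theorem isMacdonald_of_comm {G : Type*} [Group G] {A B : G} (hA : A ^ 2 ^ (2 * m - 1) = 1)
    (hB : B ^ 2 ^ (2 * m - 1) = 1) (h1 : cnj A (comm A B) = A ^ (1 + 2 ^ m * l : ℤ))
    (h2 : cnj B (comm B A) = B ^ (1 + 2 ^ m * l : ℤ)) : IsMacdonald m l A B (comm A B) where
  pow_A := hA
  pow_B := hB
  conj_A := h1
  conj_B := by rw [← h2, cnj, comm, comm]; group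
  comm_AB := by rw [comm]; group

theorem isMacdonald_gen (m : ℕ) (l : ℤ) :
    IsMacdonald m l (genA m l) (genB m l) (comm (genA m l) (genB m l)) := by
  have key : ∀ r ∈ relsH m l, PresentedGroup.mk (relsH m l) r = 1 := fun r hr =>
    PresentedGroup.one_of_mem hr
  have h1 := key _ (Or.inl rfl)
  have h2 := key _ (Or.inr (Or.inl rfl))
  have h3 := key _ (Or.inr (Or.inr (Or.inl rfl)))
  have h4 := key _ (Or.inr (Or.inr (Or.inr rfl)))
  simp only [cnj, comm, map_mul, map_inv, map_pow, map_zpow, mul_inv_eq_one] at h1 h2 h3 h4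
  exact isMacdonald_of_comm h3 h4 h1 h2

/-- The homomorphism from `H` determined by a pair satisfying the defining relations. -/
def liftH {G : Type*} [Group G] {A B C : G} (h : IsMacdonald m l A B C) : H m l →* G :=
  PresentedGroup.toGroup (f := ![A, B]) (by
    obtain rfl := h.eq_comm
    have h2 := h.conj_B
    have e : comm B A = (comm A B)⁻¹ := by simp only [comm]; group
    rintro r (rfl | rfl | rfl | rfl)
    · simpa [cnj, comm, mul_inv_eq_one] using h.conj_A
    · rw [← inv_inv (comm A B), ← e] at h2
      simpa [cnj, comm, mul_inv_eq_one] using h2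
    · simpa using h.pow_A
    · simpa using h.pow_B)

@[simp]
theorem liftH_genA {G : Type*} [Group G] {A B C : G} (h : IsMacdonald m l A B C) :
    liftH h (genA m l) = A := PresentedGroup.toGroup.of _

@[simp]
theorem liftH_genB {G : Type*} [Group G] {A B C : G} (h : IsMacdonald m l A B C) :
    liftH h (genB m l) = B := PresentedGroup.toGroup.of _

theorem hom_ext_H {G : Type*} [Group G] {f g : H m l →* G} (hA : f (genA m l) = g (genA m l))
    (hB : f (genB m l) = g (genB m l)) : f = g := by
  apply PresentedGroup.ext
  intro x
  fin_cases x
  · exact hA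
  · exact hB

theorem closure_gen (m : ℕ) (l : ℤ) :
    Subgroup.closure {genA m l, genB m l} = (⊤ : Subgroup (H m l)) := by
  rw [eq_top_iff, ← PresentedGroup.closure_range_of, Subgroup.closure_le]
  rintro _ ⟨x, rfl⟩
  fin_cases x
  · exact Subgroup.subset_closure (Or.inl rfl)
  · exact Subgroup.subset_closure (Or.inr rfl)

namespace Coord

theorem mk_i_zpow (n : ℤ) : (⟨1, 0, 0⟩ : Coord m l) ^ n = ⟨n, 0, 0⟩ := by
  refine (eq_zpow_of_succ (f := fun n : ℤ => (⟨n, 0, 0⟩ : Coord m l)) ?_ ?_ n).symm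
  · ext <;> simp
  · intro a; ext <;> simp [mul_i, mul_j, mul_k]

theorem mk_j_zpow (n : ℤ) : (⟨0, 1, 0⟩ : Coord m l) ^ n = ⟨0, n, 0⟩ := by
  refine (eq_zpow_of_succ (f := fun n : ℤ => (⟨0, n, 0⟩ : Coord m l)) ?_ ?_ n).symm
  · ext <;> simp
  · intro a; ext <;> simp [mul_i, mul_j, mul_k]

theorem mk_k_zpow (n : ℤ) : (⟨0, 0, 1⟩ : Coord m l) ^ n = ⟨0, 0, n⟩ := by
  refine (eq_zpow_of_succ (f := fun n : ℤ => (⟨0, 0, n⟩ : Coord m l)) ?_ ?_ n).symm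
  · ext <;> simp
  · intro a; ext <;> simp [mul_i, mul_j, mul_k]

theorem isMacdonald (hm : 1 < m) :
    IsMacdonald m l (⟨1, 0, 0⟩ : Coord m l) ⟨0, 1, 0⟩ ⟨0, 0, 1⟩ where
  pow_A := by
    rw [← zpow_natCast, mk_i_zpow, Int.cast_natCast, ZMod.natCast_self]; rfl
  pow_B := by
    rw [← zpow_natCast, mk_j_zpow, Int.cast_natCast, ZMod.natCast_self]; rfl
  conj_A := by
    rw [mul_assoc, inv_mul_eq_iff_eq_mul, mk_i_zpow, Int.cast_add, ← four_kap hm]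
    ext
    · simp only [mul_i]; push_cast
      linear_combination (2 : ZMod (2 ^ (2 * m - 1))) * eight_kap_sq m l
    · simp [mul_j]
    · simp [mul_k]
  conj_B := by
    rw [mul_inv_eq_iff_eq_mul, mk_j_zpow, Int.cast_add, ← four_kap hm]
    ext <;> simp [mul_i, mul_j, mul_k]
  comm_AB := by
    rw [mul_assoc, inv_mul_eq_iff_eq_mul]
    ext <;> simp [mul_i, mul_j, mul_k]

end Coord

/-- The homomorphism from `H` to its model. -/
def toCoord (hm : 1 < m) : H m l →* Coord m l := liftH (Coord.isMacdonald hm)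

/-- Both sides respond alike to right multiplication by a generator or its inverse, so agreement at
1 spreads over the whole group. -/
theorem nf_toCoord (hm : 1 < m) (x : H m l) :
    IsMacdonald.nf (genA m l) (genB m l) (comm (genA m l) (genB m l)) (toCoord hm x) = x := by
  have h := isMacdonald_gen m l
  have hA : toCoord hm (genA m l) = ⟨1, 0, 0⟩ :=
  liftH_genA (Coord.isMacdonald hm)
  have hB : toCoord hm (genB m l) = ⟨0, 1, 0⟩ :=
  liftH_genB (Coord.isMacdonald hm)
  have hx : x ∈ Subgroup.closure {genA m l, genB m l} := by rw [closure_gen]; trivial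
  induction hx using Subgroup.closure_induction_right with
  | one =>
    rw [map_one]
    simp [IsMacdonald.nf, zpw_zero h.pow_A, zpw_zero h.pow_B, zpw_zero (h.pow_C hm)]
  | mul_right x hx y hy ih =>
    rcases hy with rfl | rfl
    · rw [map_mul, hA, h.nf_mul_A hm, ih]
    · rw [map_mul, hB, h.nf_mul_B hm, ih]
  | mul_inv_cancel x hx y hy ih =>
    rcases hy with rfl | rfl
    · rw [eq_mul_inv_iff_mul_eq, ← h.nf_mul_A hm, ← hA, ← map_mul, inv_mul_cancel_right, ih]
    · rw [eq_mul_inv_iff_mul_eq, ← h.nf_mul_B hm, ← hB, ← map_mul, inv_mul_cancel_right, ih]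

theorem toCoord_nf (hm : 1 < m) (x : Coord m l) :
    toCoord hm (IsMacdonald.nf (genA m l) (genB m l) (comm (genA m l) (genB m l)) x) = x := by
  have hC : toCoord hm (comm (genA m l) (genB m l)) = ⟨0, 0, 1⟩ := by
    rw [(Coord.isMacdonald hm).eq_comm]
    simp only [comm, map_mul, map_inv, toCoord, liftH_genA, liftH_genB]
  have hA : toCoord hm (genA m l) = ⟨1, 0, 0⟩ :=
  liftH_genA (Coord.isMacdonald hm)
  have hB : toCoord hm (genB m l) = ⟨0, 1, 0⟩ :=
  liftH_genB (Coord.isMacdonald hm)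
  have hM := Coord.isMacdonald (l := l) hm
  obtain ⟨i, j, k⟩ := x
  obtain ⟨i, rfl⟩ := ZMod.intCast_surjective i
  obtain ⟨j, rfl⟩ := ZMod.intCast_surjective j
  obtain ⟨k, rfl⟩ := ZMod.intCast_surjective k
  rw [IsMacdonald.nf, map_mul, map_mul, map_zpw, map_zpw, map_zpw, hA, hB, hC,
    zpw_intCast hM.pow_A, zpw_intCast hM.pow_B, zpw_intCast (hM.pow_C hm),
    Coord.mk_i_zpow, Coord.mk_j_zpow, Coord.mk_k_zpow]
  ext <;> simp [Coord.mul_i, Coord.mul_j, Coord.mul_k]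

/-- `H` is isomorphic to its model. -/
def coordEquiv (hm : 1 < m) : H m l ≃* Coord m l where
  toFun := toCoord hm
  invFun := IsMacdonald.nf (genA m l) (genB m l) (comm (genA m l) (genB m l))
  left_inv := nf_toCoord hm
  right_inv := toCoord_nf hm
  map_mul' := map_mul _

@[simp]
theorem coordEquiv_genA (hm : 1 < m) : coordEquiv hm (genA m l) = ⟨1, 0, 0⟩ :=
  liftH_genA (Coord.isMacdonald hm)

@[simp]
theorem coordEquiv_genB (hm : 1 < m) : coordEquiv hm (genB m l) = ⟨0, 1, 0⟩ :=
  liftH_genB (Coord.isMacdonald hm)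

end Presentation

end MacdonaldAut

namespace MacdonaldAut

/-! ### Annihilators of 2κ and 4κ -/

section Arithmetic

variable {m : ℕ} {l : ℤ}

/-- The scalar `2 ^ (m - 2)` modulo `2 ^ (2m - 1)`. -/
def sig (m : ℕ) : ZMod (2 ^ (2 * m - 1)) := 2 ^ (m - 2)

theorem kap_eq (m : ℕ) (l : ℤ) : kap m l = sig m * l := by
  rw [kap, sig]; push_cast; rfl

theorem eight_sig_sq (m : ℕ) : 8 * sig m ^ 2 = 0 := by
  have := eight_kap_sq m 1
  rwa [kap_eq, Int.cast_one, mul_one] at this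

theorem two_pow_pred {m : ℕ} (hm : 1 < m) : (2 : ZMod (2 ^ (2 * m - 1))) ^ (m - 1) = 2 * sig m := by
  rw [sig, ← pow_succ']; congr 1; omega

theorem two_pow_eq {m : ℕ} (hm : 1 < m) : (2 : ZMod (2 ^ (2 * m - 1))) ^ m = 4 * sig m := by
  rw [sig, show (4 : ZMod (2 ^ (2 * m - 1))) = 2 ^ 2 by norm_num, ← pow_add]; congr 1; omega

theorem intCast_zmod_two_pow_mul_eq_zero_iff {a b : ℕ} {c : ℤ} (hab : b ≤ a) (hc : Odd c) (n : ℤ) :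
    (2 ^ b * c * n : ZMod (2 ^ a)) = 0 ↔ (2 : ℤ) ^ (a - b) ∣ n := by
  have h2 : (2 ^ b * c * n : ZMod (2 ^ a)) = ((2 ^ b * c * n : ℤ) : ZMod (2 ^ a)) := by push_cast; rfl
  rw [h2, ZMod.intCast_zmod_eq_zero_iff_dvd]
  have h3 : ((2 ^ a : ℕ) : ℤ) = 2 ^ b * 2 ^ (a - b) := by
    rw [← pow_add, Nat.add_sub_cancel' hab]; push_cast; rfl
  rw [h3, mul_assoc, mul_dvd_mul_iff_left (by positivity)]
  refine ⟨fun h => ?_, fun h => h.mul_left c⟩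
  exact (IsCoprime.pow_left (Int.isCoprime_iff_gcd_eq_one.mpr
    (by simpa [Int.gcd] using hc.natAbs.coprime_two_left))).dvd_of_dvd_mul_left h

/-- As ℓ is odd, 4κ is a unit multiple of 2^m, and its annihilator modulo 2^(2m-1) is generated by
2^(m-1) = 2σ. This is the source of the coordinates 1 + 2σa, 2σb used for near pairs. -/
theorem four_kap_mul_eq_zero_iff (hm : 1 < m) (hl : Odd l) (x : ZMod (2 ^ (2 * m - 1))) :
    4 * kap m l * x = 0 ↔ ∃ y, x = 2 * sig m * y := by
  obtain ⟨n, rfl⟩ := ZMod.intCast_surjective x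
  have h : 4 * kap m l * (n : ZMod (2 ^ (2 * m - 1))) = 2 ^ m * l * n := by
    rw [kap_eq, two_pow_eq hm]; ring
  constructor
  · rw [h, intCast_zmod_two_pow_mul_eq_zero_iff (by omega) hl]
    rintro ⟨c, rfl⟩
    refine ⟨c, ?_⟩
    rw [← two_pow_pred hm]
    push_cast
    congr 2
    omega
  · rintro ⟨y, hy⟩
    rw [hy, kap_eq]
    linear_combination (l * y : ZMod (2 ^ (2 * m - 1))) * eight_sig_sq m

theorem two_kap_mul_eq_zero_iff (hm : 1 < m) (hl : Odd l) (x : ZMod (2 ^ (2 * m - 1))) :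
    2 * kap m l * x = 0 ↔ ∃ y, x = 4 * sig m * y := by
  obtain ⟨n, rfl⟩ := ZMod.intCast_surjective x
  have h : 2 * kap m l * (n : ZMod (2 ^ (2 * m - 1))) = 2 ^ (m - 1) * l * n := by
    rw [kap_eq, two_pow_pred hm]; ring
  constructor
  · rw [h, intCast_zmod_two_pow_mul_eq_zero_iff (by omega) hl]
    rintro ⟨c, rfl⟩
    refine ⟨c, ?_⟩
    rw [← two_pow_eq hm]
    push_cast
    congr 2
    omega
  · rintro ⟨y, hy⟩
    rw [hy, kap_eq]
    linear_combination (l * y : ZMod (2 ^ (2 * m - 1))) * eight_sig_sq m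

end Arithmetic

/-! ### The upper central series in coordinates -/

namespace Coord

variable {m : ℕ} {l : ℤ}

/-- The two corrections in the law acquire the coefficients 8κ² and 4κ²y(y - 1), both zero. The
additive map so obtained detects the displacements in the final argument. -/
theorem two_kap_mul_i (x y : Coord m l) :
    2 * kap m l * (x * y).i = 2 * kap m l * x.i + 2 * kap m l * y.i := by
  rw [mul_i]
  linear_combination (-y.i * x.k) * eight_kap_sq m l + x.j * four_kap_sq_mul m l y.i

theorem two_kap_mul_j (x y : Coord m l) :
    2 * kap m l * (x * y).j = 2 * kap m l * x.j + 2 * kap m l * y.j := by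
  rw [mul_j]
  linear_combination (y.j * (x.k - y.i * x.j)) * eight_kap_sq m l - y.i * four_kap_sq_mul m l x.j

theorem four_kap_mul_k (x y : Coord m l) :
    4 * kap m l * (x * y).k = 4 * kap m l * x.k + 4 * kap m l * y.k - 4 * kap m l * (y.i * x.j) := by
  rw [mul_k]
  linear_combination (2 * y.i * x.k * x.j - y.i * (y.i - 1) * x.j ^ 2) * eight_kap_sq m l
    + x.j * (x.j - 1) * four_kap_sq_mul m l y.i

theorem mem_center_iff (x : Coord m l) :
    x ∈ Subgroup.center (Coord m l) ↔ x.i = 0 ∧ x.j = 0 ∧ 4 * kap m l * x.k = 0 := by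
  rw [Subgroup.mem_center_iff]
  constructor
  · intro h
    have hA := h ⟨1, 0, 0⟩
    have hB := h ⟨0, 1, 0⟩
    have h1 := congrArg Coord.i hA
    have h2 := congrArg Coord.j hA
    have h3 := congrArg Coord.k hA
    have h4 := congrArg Coord.i hB
    have h5 := congrArg Coord.k hB
    simp only [mul_i, mul_j, mul_k] at h1 h2 h3 h4 h5
    have hk : 4 * kap m l * x.k = 0 := by linear_combination h1
    have hi : x.i = 0 := by linear_combination -h5 - h4
    refine ⟨hi, ?_, hk⟩
    linear_combination h3 + x.j * hk
  · rintro ⟨hi, hj, hk⟩ y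
    ext
    · simp only [mul_i, hi, hj]; linear_combination y.i * hk
    · simp only [mul_j, hi, hj]; linear_combination -y.j * hk
    · simp only [mul_k, hi, hj]; ring

/-- Congruence modulo the centre, in coordinates. -/
theorem mul_inv_mem_center_iff (x y : Coord m l) :
    x * y⁻¹ ∈ Subgroup.center (Coord m l) ↔
      x.i = y.i ∧ x.j = y.j ∧ 4 * kap m l * x.k = 4 * kap m l * y.k := by
  constructor
  · intro h
    obtain ⟨z, rfl⟩ : ∃ z, x = z * y := ⟨x * y⁻¹, by simp⟩
    rw [mul_inv_cancel_right, mem_center_iff] at h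
    obtain ⟨hi, hj, hk⟩ := h
    simp only [mul_i, mul_j, mul_k, hi, hj]
    refine ⟨?_, ?_, ?_⟩
    · linear_combination -y.i * hk
    · linear_combination y.j * hk
    · linear_combination hk
  · rintro ⟨hi, hj, hk⟩
    have hk' : 4 * kap m l * (x.k - y.k) = 0 := by linear_combination hk
    have : x = (⟨0, 0, x.k - y.k⟩ : Coord m l) * y := by
      ext
      · simp only [mul_i]; linear_combination hi + y.i * hk'
      · simp only [mul_j]; linear_combination hj - y.j * hk'
      · simp only [mul_k]; ring
    rw [this, mul_inv_cancel_right, mem_center_iff]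
    exact ⟨rfl, rfl, hk'⟩

/-- Comparing xy with yx turns membership into coordinate congruences and avoids the formula for
inverses. -/
theorem mem_succ_iff (n : ℕ) (x : Coord m l) :
    x ∈ Subgroup.upperCentralSeries (Coord m l) (n + 1) ↔
      ∀ y, (x * y) * (y * x)⁻¹ ∈ Subgroup.upperCentralSeries (Coord m l) n := by
  rw [Subgroup.mem_upperCentralSeries_succ_iff]
  refine forall_congr' fun y => ?_
  rw [commutatorElement_def, mul_inv_rev, mul_assoc (x * y)]

theorem mem_two_iff (hm : 1 < m) (hl : Odd l) (x : Coord m l) :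
    x ∈ Subgroup.upperCentralSeries (Coord m l) 2 ↔
      2 * kap m l * x.i = 0 ∧ 2 * kap m l * x.j = 0 ∧ 4 * kap m l * x.k = 0 := by
  have h8 := eight_kap_sq m l
  rw [mem_succ_iff, Subgroup.upperCentralSeries_one]
  simp only [mul_inv_mem_center_iff]
  constructor
  · intro h
    obtain ⟨h1, h2, h3⟩ := h ⟨1, 0, 0⟩
    obtain ⟨h4, h5, h6⟩ := h ⟨0, 1, 0⟩
    simp only [mul_i, mul_j, mul_k] at h1 h2 h3 h4 h5 h6
    -- The first condition gives y = 2σu, hence 2κy² = σu · 4κy = 0, so the second condition reduces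
    -- to -2κy = 0.
    have aux : ∀ y : ZMod (2 ^ (2 * m - 1)), 4 * kap m l * y = 0 →
        2 * kap m l * (y * (y - 1)) = 0 → 2 * kap m l * y = 0 := by
      intro y hy1 hy2
      obtain ⟨u, rfl⟩ := (four_kap_mul_eq_zero_iff hm hl y).mp hy1
      linear_combination -hy2 + sig m * u * hy1
    have hj : 4 * kap m l * x.j = 0 := by
      linear_combination -h3 + (2 * x.k * x.j) * h8
    have hi : 4 * kap m l * x.i = 0 := by
      linear_combination h6 - (x.i * (x.i - 1)) * h8
    refine ⟨aux _ hi (by linear_combination -h4), aux _ hj (by linear_combination -h2), ?_⟩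
    linear_combination -h1
  · rintro ⟨hi, hj, hk⟩ y
    simp only [mul_i, mul_j, mul_k]
    refine ⟨?_, ?_, ?_⟩
    · linear_combination -y.i * hk + y.i * (y.i - 1) * hj + 2 * y.k * hi - (x.i - 1) * y.j * hi
    · linear_combination -y.i * (x.j - 1) * hj + y.j * hk - 2 * y.i * y.j * hj
        + y.j * (y.j - 1) * hi - 2 * y.k * hj + 2 * x.i * y.j * hj
    · linear_combination (2 * y.j) * hi - 2 * y.i * hj + (2 * y.i * x.k * x.j) * h8
        + (2 * kap m l * y.i * (y.i - 1) * (x.j - 1)) * hj - (4 * kap m l * y.i * (y.i - 1) * x.j) * hj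
        - 8 * kap m l * y.k * y.j * hi - 2 * kap m l * (x.i - 1) * y.j * (y.j - 1) * hi
        + 4 * kap m l * (x.i - 1) * y.j ^ 2 * hi

theorem mul_inv_mem_two_iff (hm : 1 < m) (hl : Odd l) (x y : Coord m l) :
    x * y⁻¹ ∈ Subgroup.upperCentralSeries (Coord m l) 2 ↔
      2 * kap m l * x.i = 2 * kap m l * y.i ∧ 2 * kap m l * x.j = 2 * kap m l * y.j ∧
        4 * kap m l * x.k = 4 * kap m l * y.k := by
  obtain ⟨z, rfl⟩ : ∃ z, x = z * y := ⟨x * y⁻¹, by simp⟩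
  rw [mul_inv_cancel_right, mem_two_iff hm hl, two_kap_mul_i, two_kap_mul_j, four_kap_mul_k]
  constructor
  · rintro ⟨hi, hj, hk⟩
    exact ⟨by linear_combination hi, by linear_combination hj,
      by linear_combination hk - 2 * y.i * hj⟩
  · rintro ⟨hi, hj, hk⟩
    exact ⟨by linear_combination hi, by linear_combination hj,
      by linear_combination hk + 2 * y.i * hj⟩

/-- Modulo Z₂ only 2κi, 2κj and 4κk matter. The first two are additive, and the third differs
between xy and yx by 4κ(x.i y.j - y.i x.j). -/
theorem mem_three_iff (hm : 1 < m) (hl : Odd l) (x : Coord m l) :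
    x ∈ Subgroup.upperCentralSeries (Coord m l) 3 ↔
      4 * kap m l * x.i = 0 ∧ 4 * kap m l * x.j = 0 := by
  rw [mem_succ_iff]
  simp only [mul_inv_mem_two_iff hm hl, two_kap_mul_i, two_kap_mul_j, four_kap_mul_k]
  constructor
  · intro h
    have h1 := (h ⟨1, 0, 0⟩).2.2
    have h2 := (h ⟨0, 1, 0⟩).2.2
    simp only at h1 h2
    exact ⟨by linear_combination h2, by linear_combination -h1⟩
  · rintro ⟨hi, hj⟩ y
    exact ⟨add_comm _ _, add_comm _ _, by linear_combination y.j * hi - y.i * hj⟩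

/-- The homomorphisms 2κi and 2κj have abelian target and vanish on commutators, which therefore lie
in Z₃. -/
theorem upperCentralSeries_four (hm : 1 < m) (hl : Odd l) :
    Subgroup.upperCentralSeries (Coord m l) 4 = ⊤ := by
  rw [eq_top_iff]
  intro x _
  rw [mem_succ_iff]
  intro y
  obtain ⟨z, hz⟩ : ∃ z, x * y = z * (y * x) := ⟨x * y * (y * x)⁻¹, (inv_mul_cancel_right _ _).symm⟩
  have hi := congrArg (fun t => 2 * (2 * kap m l * t.i)) hz
  have hj := congrArg (fun t => 2 * (2 * kap m l * t.j)) hz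
  simp only [two_kap_mul_i, two_kap_mul_j] at hi hj
  rw [hz, mul_inv_cancel_right, mem_three_iff hm hl]
  exact ⟨by linear_combination -hi, by linear_combination -hj⟩

end Coord

end MacdonaldAut

namespace MacdonaldAut

/-! ### Commutators of pairs congruent to (A, B) modulo Z₃ -/

namespace Coord

variable {m : ℕ} {l : ℤ}

theorem comm_mk_mk (a b c d k n : ZMod (2 ^ (2 * m - 1))) :
    comm (⟨1 + 2 * sig m * a, 2 * sig m * b, k⟩ : Coord m l) ⟨2 * sig m * c, 1 + 2 * sig m * d, n⟩ =
      ⟨4 * sig m * n * l + 4 * sig m ^ 2 * a * l, 4 * sig m * k * l + 4 * sig m ^ 2 * d * l, 1 + 2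
      * sig m * a + 2 * sig m * d + 4 * sig m ^ 2 * a * d + 4 * sig m ^ 2 * b * c + 4 * sig m ^ 3
      * a * d * l + 4 * sig m ^ 3 * b * c * l⟩ := by
  have h8 := eight_sig_sq m
  have hxy : (⟨1 + 2 * sig m * a, 2 * sig m * b, k⟩ : Coord m l) *
      ⟨2 * sig m * c, 1 + 2 * sig m * d, n⟩ =
      ⟨1 + 2 * sig m * a + 2 * sig m * c, 1 + 2 * sig m * b + 2 * sig m * d + 4 * sig m * k * l, k
      + n + 4 * sig m ^ 2 * b * c + 4 * sig m ^ 3 * b * c * l⟩ := by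
    ext
    · simp only [mul_i, kap_eq]
      generalize sig m = S at *
      generalize (l : ZMod (2 ^ (2 * m - 1))) = w at *
      linear_combination (-c * k * w - S * b * c * w + 2 * S ^ 2 * b * c ^ 2 * w) * h8
    · simp only [mul_j, kap_eq]
      generalize sig m = S at *
      generalize (l : ZMod (2 ^ (2 * m - 1))) = w at *
      linear_combination (d * k * w - S * b * c * w - 4 * S ^ 2 * b * c * d * w - 2 * S ^ 2 * b ^ 2 * c * w) * h8
    · simp only [mul_k, kap_eq]
      generalize sig m = S at *
      generalize (l : ZMod (2 ^ (2 * m - 1))) = w at *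
      linear_combination (-b * c + 2 * S * b * c * k * w - S ^ 2 * b * c ^ 2 * w + S ^ 2 * b ^ 2 * c * w - 2 * S ^
        3 * b ^ 2 * c ^ 2 * w) * h8
  have hyx : (⟨2 * sig m * c, 1 + 2 * sig m * d, n⟩ : Coord m l) *
      ⟨1 + 2 * sig m * a, 2 * sig m * b, k⟩ =
      ⟨1 + 2 * sig m * a + 2 * sig m * c - 4 * sig m * n * l + 4 * sig m ^ 2 * a * l, 1 + 2 * sig
      m * b + 2 * sig m * d + 4 * sig m ^ 2 * d * l, -1 + k + n - 2 * sig m * a - 2 * sig m * d +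
      4 * sig m * n * l + 4 * sig m ^ 2 * a * d + 4 * sig m ^ 2 * a * l + 4 * sig m ^ 3 * a * d *
      l⟩ := by
    ext
    · simp only [mul_i, kap_eq]
      generalize sig m = S at *
      generalize (l : ZMod (2 ^ (2 * m - 1))) = w at *
      linear_combination (-a * n * w + S * a * d * w + S * a ^ 2 * w + 2 * S ^ 2 * a ^ 2 * d * w) * h8
    · simp only [mul_j, kap_eq]
      generalize sig m = S at *
      generalize (l : ZMod (2 ^ (2 * m - 1))) = w at *
      linear_combination (-b * w - d * w + b * n * w - 2 * S * a * b * w - S * a * d * w - 2 * S * b * d * w - S *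
        d ^ 2 * w - 4 * S ^ 2 * a * b * d * w - 2 * S ^ 2 * a * d ^ 2 * w) * h8
    · simp only [mul_k, kap_eq]
      generalize sig m = S at *
      generalize (l : ZMod (2 ^ (2 * m - 1))) = w at *
      linear_combination (-a * d - a * w + a * n * w + d * n * w - 2 * S * a * d * w - S * a ^ 2 * w + 2 * S * a *
        d * n * w - S ^ 2 * a * d ^ 2 * w - 3 * S ^ 2 * a ^ 2 * d * w - 2 * S ^ 3 * a ^ 2 * d ^ 2
        * w) * h8
  have hyxC : (⟨1 + 2 * sig m * a + 2 * sig m * c - 4 * sig m * n * l + 4 * sig m ^ 2 * a * l, 1 + 2 * sig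
      m * b + 2 * sig m * d + 4 * sig m ^ 2 * d * l, -1 + k + n - 2 * sig m * a - 2 * sig m * d +
      4 * sig m * n * l + 4 * sig m ^ 2 * a * d + 4 * sig m ^ 2 * a * l + 4 * sig m ^ 3 * a * d *
      l⟩ : Coord m l) *
      ⟨4 * sig m * n * l + 4 * sig m ^ 2 * a * l, 4 * sig m * k * l + 4 * sig m ^ 2 * d * l, 1 + 2
      * sig m * a + 2 * sig m * d + 4 * sig m ^ 2 * a * d + 4 * sig m ^ 2 * b * c + 4 * sig m ^ 3
      * a * d * l + 4 * sig m ^ 3 * b * c * l⟩ =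
      ⟨1 + 2 * sig m * a + 2 * sig m * c, 1 + 2 * sig m * b + 2 * sig m * d + 4 * sig m * k * l, k
      + n + 4 * sig m ^ 2 * b * c + 4 * sig m ^ 3 * b * c * l⟩ := by
    ext
    · simp only [mul_i, kap_eq]
      generalize sig m = S at *
      generalize (l : ZMod (2 ^ (2 * m - 1))) = w at *
      linear_combination (a * w + n * w ^ 2 + S * a * w ^ 2 - 2 * k * n * w ^ 2 - 2 * n ^ 2 * w ^ 2 - 2 * S * a * k
        * w ^ 2 + 2 * S * a * n * w ^ 2 - 2 * S * b * n * w ^ 2 + 2 * S * d * n * w ^ 2 - 4 * S *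
        n ^ 2 * w ^ 3 - 2 * S ^ 2 * a * b * w ^ 2 + 2 * S ^ 2 * a * d * w ^ 2 + 4 * S ^ 2 * a ^ 2
        * w ^ 2 - 8 * S ^ 2 * a * d * n * w ^ 2 - 8 * S ^ 2 * a * n * w ^ 3 - 4 * S ^ 2 * d * n *
        w ^ 3 + 8 * S ^ 2 * b * n ^ 2 * w ^ 3 + 8 * S ^ 2 * d * n ^ 2 * w ^ 3 - 4 * S ^ 3 * a * d
        * w ^ 3 - 8 * S ^ 3 * a ^ 2 * d * w ^ 2 - 4 * S ^ 3 * a ^ 2 * w ^ 3 + 16 * S ^ 3 * a * b *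
        n * w ^ 3 + 8 * S ^ 3 * a * d * n * w ^ 3 + 16 * S ^ 3 * d * n ^ 2 * w ^ 4 + 8 * S ^ 4 * a
        ^ 2 * b * w ^ 3 + 32 * S ^ 4 * a * d * n * w ^ 4 + 16 * S ^ 5 * a ^ 2 * d * w ^ 4) * h8
    · simp only [mul_j, kap_eq]
      generalize sig m = S at *
      generalize (l : ZMod (2 ^ (2 * m - 1))) = w at *
      linear_combination (d * w - 2 * k * w ^ 2 - 2 * S * d * w ^ 2 + 2 * k * n * w ^ 2 + 2 * k ^ 2 * w ^ 2 - 4 * S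
        * a * k * w ^ 2 - 2 * S * b * n * w ^ 2 - 2 * S * d * k * w ^ 2 - 2 * S ^ 2 * a * b * w ^
        2 - 6 * S ^ 2 * a * d * w ^ 2 - 4 * S ^ 2 * d ^ 2 * w ^ 2 + 8 * S ^ 2 * a * d * k * w ^ 2
        - 8 * S ^ 2 * b * d * n * w ^ 2 - 4 * S ^ 2 * b ^ 2 * n * w ^ 2 - 4 * S ^ 2 * d * n * w ^
        3 - 4 * S ^ 2 * d ^ 2 * n * w ^ 2 - 16 * S ^ 2 * b * k * n * w ^ 3 - 16 * S ^ 2 * d * k *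
        n * w ^ 3 - 8 * S ^ 3 * a * b * d * w ^ 2 - 4 * S ^ 3 * a * b ^ 2 * w ^ 2 - 4 * S ^ 3 * a
        * d * w ^ 3 + 4 * S ^ 3 * a * d ^ 2 * w ^ 2 - 16 * S ^ 3 * a * b * k * w ^ 3 - 8 * S ^ 3 *
        a * d * k * w ^ 3 - 32 * S ^ 3 * b * d * n * w ^ 3 - 32 * S ^ 3 * d ^ 2 * n * w ^ 3 - 32 *
        S ^ 3 * d * k * n * w ^ 4 - 32 * S ^ 4 * a * b * d * w ^ 3 - 24 * S ^ 4 * a * d ^ 2 * w ^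
        3 - 32 * S ^ 4 * a * d * k * w ^ 4 - 48 * S ^ 4 * d ^ 2 * n * w ^ 4 - 48 * S ^ 5 * a * d ^
        2 * w ^ 4) * h8
    · simp only [mul_k, kap_eq]
      generalize sig m = S at *
      generalize (l : ZMod (2 ^ (2 * m - 1))) = w at *
      linear_combination (a * d - b * n * w - d * n * w - n * w ^ 2 - S * a * b * w - S * a * w ^ 2 + 2 * k * n * w
        ^ 2 + 2 * n ^ 2 * w ^ 2 + 2 * S * a * k * w ^ 2 - 2 * S * a * n * w ^ 2 - S * b * n * w ^
        2 - 7 * S * d * n * w ^ 2 + 4 * S * b * k * n * w ^ 2 + 4 * S * b * n ^ 2 * w ^ 2 + 4 * S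
        * d * k * n * w ^ 2 + 4 * S * d * n ^ 2 * w ^ 2 + 4 * S * n ^ 2 * w ^ 3 - S ^ 2 * a * b *
        w ^ 2 - 7 * S ^ 2 * a * d * w ^ 2 - 4 * S ^ 2 * a ^ 2 * w ^ 2 + 4 * S ^ 2 * a * b * k * w
        ^ 2 - 4 * S ^ 2 * a * b * n * w ^ 2 + 4 * S ^ 2 * a * d * k * w ^ 2 + 4 * S ^ 2 * a * d *
        n * w ^ 2 + 8 * S ^ 2 * a * n * w ^ 3 - 4 * S ^ 2 * b * d * n * w ^ 2 + 2 * S ^ 2 * b ^ 2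
        * n * w ^ 2 - 2 * S ^ 2 * d * n * w ^ 3 - 6 * S ^ 2 * d ^ 2 * n * w ^ 2 + 4 * S ^ 2 * b *
        n ^ 2 * w ^ 3 + 8 * S ^ 2 * d * k * n * w ^ 3 + 12 * S ^ 2 * d * n ^ 2 * w ^ 3 - 4 * S ^ 3
        * a * b * d * w ^ 2 + 2 * S ^ 3 * a * b ^ 2 * w ^ 2 - 2 * S ^ 3 * a * d * w ^ 3 - 6 * S ^
        3 * a * d ^ 2 * w ^ 2 - 8 * S ^ 3 * a ^ 2 * b * w ^ 2 + 4 * S ^ 3 * a ^ 2 * w ^ 3 + 16 * S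
        ^ 3 * a * b * d * n * w ^ 2 + 8 * S ^ 3 * a * b * n * w ^ 3 + 8 * S ^ 3 * a * d * k * w ^
        3 + 8 * S ^ 3 * a * d * n * w ^ 3 + 16 * S ^ 3 * a * d ^ 2 * n * w ^ 2 + 8 * S ^ 3 * b * d
        * n * w ^ 3 - 8 * S ^ 3 * d ^ 2 * n * w ^ 3 - 16 * S ^ 3 * b * d * n ^ 2 * w ^ 3 - 8 * S ^
        3 * b ^ 2 * n ^ 2 * w ^ 3 + 8 * S ^ 3 * d * n ^ 2 * w ^ 4 - 8 * S ^ 3 * d ^ 2 * n ^ 2 * w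
        ^ 3 + 8 * S ^ 4 * a * b * d * w ^ 3 - 8 * S ^ 4 * a * d ^ 2 * w ^ 3 + 16 * S ^ 4 * a ^ 2 *
        b * d * w ^ 2 + 4 * S ^ 4 * a ^ 2 * b * w ^ 3 - 4 * S ^ 4 * a ^ 2 * d * w ^ 3 + 16 * S ^ 4
        * a ^ 2 * d ^ 2 * w ^ 2 - 16 * S ^ 4 * a * b * d * n * w ^ 3 - 16 * S ^ 4 * a * b ^ 2 * n
        * w ^ 3 + 16 * S ^ 4 * a * d * n * w ^ 4 + 32 * S ^ 4 * a * d ^ 2 * n * w ^ 3 + 8 * S ^ 4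
        * d ^ 2 * n * w ^ 4 - 32 * S ^ 4 * b * d * n ^ 2 * w ^ 4 - 32 * S ^ 4 * d ^ 2 * n ^ 2 * w
        ^ 4 + 8 * S ^ 5 * a * d ^ 2 * w ^ 4 - 8 * S ^ 5 * a ^ 2 * b ^ 2 * w ^ 3 + 8 * S ^ 5 * a ^
        2 * d * w ^ 4 + 40 * S ^ 5 * a ^ 2 * d ^ 2 * w ^ 3 - 64 * S ^ 5 * a * b * d * n * w ^ 4 -
        32 * S ^ 5 * a * d ^ 2 * n * w ^ 4 - 32 * S ^ 5 * d ^ 2 * n ^ 2 * w ^ 5 - 32 * S ^ 6 * a ^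
        2 * b * d * w ^ 4 - 64 * S ^ 6 * a * d ^ 2 * n * w ^ 5 - 32 * S ^ 7 * a ^ 2 * d ^ 2 * w ^
        5) * h8
  -- The value of the commutator is checked through the three products above, without forming an
  -- inverse.
  have e : ∀ g h t : Coord m l, h * g * t = g * h → comm g h = t := fun g h t e => by
    rw [comm, mul_assoc, ← e]; group
  apply e
  rw [hyx, hyxC, hxy]

/-- This is x[x, y] = [x, y] x^α up to a central factor: the second factor in the inner product is
x^(2^m ℓ) by `mk_zpow_two_pow_mul`. The last factor, of order at most two since 8σ² = 0, is the
obstruction to the first defining relation. -/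
theorem mk_mul_comm_mk (a b c d k n : ZMod (2 ^ (2 * m - 1))) :
    (⟨1 + 2 * sig m * a, 2 * sig m * b, k⟩ : Coord m l) *
      ⟨4 * sig m * n * l + 4 * sig m ^ 2 * a * l, 4 * sig m * k * l + 4 * sig m ^ 2 * d * l, 1 + 2
      * sig m * a + 2 * sig m * d + 4 * sig m ^ 2 * a * d + 4 * sig m ^ 2 * b * c + 4 * sig m ^ 3
      * a * d * l + 4 * sig m ^ 3 * b * c * l⟩ =
    ⟨4 * sig m * n * l + 4 * sig m ^ 2 * a * l, 4 * sig m * k * l + 4 * sig m ^ 2 * d * l, 1 + 2 *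
    sig m * a + 2 * sig m * d + 4 * sig m ^ 2 * a * d + 4 * sig m ^ 2 * b * c + 4 * sig m ^ 3 * a
    * d * l + 4 * sig m ^ 3 * b * c * l⟩ *
      ((⟨1 + 2 * sig m * a, 2 * sig m * b, k⟩ : Coord m l) *
        ⟨4 * sig m * l, 0, 4 * sig m * k * l + 4 * sig m ^ 2 * b * l⟩) *
      ⟨0, 0, 4 * sig m ^ 2 * b * l + 4 * sig m ^ 2 * d * l⟩ := by
  have h8 := eight_sig_sq m
  have hX : (⟨1 + 2 * sig m * a, 2 * sig m * b, k⟩ : Coord m l) *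
      ⟨4 * sig m * l, 0, 4 * sig m * k * l + 4 * sig m ^ 2 * b * l⟩ =
      ⟨1 + 2 * sig m * a + 4 * sig m * l, 2 * sig m * b, k + 4 * sig m * k * l + 4 * sig m ^ 2 * b
      * l⟩ := by
    ext
    · simp only [mul_i, kap_eq]
      generalize sig m = S at *
      generalize (l : ZMod (2 ^ (2 * m - 1))) = w at *
      linear_combination (-2 * k * w ^ 2 - 2 * S * b * w ^ 2 + 8 * S ^ 2 * b * w ^ 3) * h8
    · simp only [mul_j, kap_eq]
      generalize sig m = S at *
      generalize (l : ZMod (2 ^ (2 * m - 1))) = w at *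
      linear_combination (2 * S * b * w ^ 2 - 4 * S ^ 2 * b ^ 2 * w ^ 2) * h8
    · simp only [mul_k, kap_eq]
      generalize sig m = S at *
      generalize (l : ZMod (2 ^ (2 * m - 1))) = w at *
      linear_combination (-b * w + S * b * w ^ 2 + 4 * S * b * k * w ^ 2 - 4 * S ^ 2 * b * w ^ 3 + 2 * S ^ 2 * b ^
        2 * w ^ 2 - 8 * S ^ 3 * b ^ 2 * w ^ 3) * h8
  have hxC : (⟨1 + 2 * sig m * a, 2 * sig m * b, k⟩ : Coord m l) *
      ⟨4 * sig m * n * l + 4 * sig m ^ 2 * a * l, 4 * sig m * k * l + 4 * sig m ^ 2 * d * l, 1 + 2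
      * sig m * a + 2 * sig m * d + 4 * sig m ^ 2 * a * d + 4 * sig m ^ 2 * b * c + 4 * sig m ^ 3
      * a * d * l + 4 * sig m ^ 3 * b * c * l⟩ =
      ⟨1 + 2 * sig m * a + 4 * sig m * n * l + 4 * sig m ^ 2 * a * l, 2 * sig m * b + 4 * sig m *
      k * l + 4 * sig m ^ 2 * d * l, 1 + k + 2 * sig m * a + 2 * sig m * d + 4 * sig m ^ 2 * a * d
      + 4 * sig m ^ 2 * b * c + 4 * sig m ^ 3 * a * d * l + 4 * sig m ^ 3 * b * c * l⟩ := by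
    ext
    · simp only [mul_i, kap_eq]
      generalize sig m = S at *
      generalize (l : ZMod (2 ^ (2 * m - 1))) = w at *
      linear_combination (-2 * k * n * w ^ 2 - 2 * S * a * k * w ^ 2 - 2 * S * b * n * w ^ 2 - 2 * S ^ 2 * a * b *
        w ^ 2 + 8 * S ^ 2 * b * n ^ 2 * w ^ 3 + 16 * S ^ 3 * a * b * n * w ^ 3 + 8 * S ^ 4 * a ^ 2
        * b * w ^ 3) * h8
    · simp only [mul_j, kap_eq]
      generalize sig m = S at *
      generalize (l : ZMod (2 ^ (2 * m - 1))) = w at *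
      linear_combination (2 * k ^ 2 * w ^ 2 + 2 * S * b * n * w ^ 2 + 2 * S * d * k * w ^ 2 + 2 * S ^ 2 * a * b * w
        ^ 2 - 4 * S ^ 2 * b ^ 2 * n * w ^ 2 - 16 * S ^ 2 * b * k * n * w ^ 3 - 4 * S ^ 3 * a * b ^
        2 * w ^ 2 - 16 * S ^ 3 * a * b * k * w ^ 3 - 16 * S ^ 3 * b * d * n * w ^ 3 - 16 * S ^ 4 *
        a * b * d * w ^ 3) * h8
    · simp only [mul_k, kap_eq]
      generalize sig m = S at *
      generalize (l : ZMod (2 ^ (2 * m - 1))) = w at *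
      linear_combination (-b * n * w - S * a * b * w + S * b * n * w ^ 2 + 4 * S * b * k * n * w ^ 2 + S ^ 2 * a *
        b * w ^ 2 + 4 * S ^ 2 * a * b * k * w ^ 2 + 2 * S ^ 2 * b ^ 2 * n * w ^ 2 - 4 * S ^ 2 * b
        * n ^ 2 * w ^ 3 + 2 * S ^ 3 * a * b ^ 2 * w ^ 2 - 8 * S ^ 3 * a * b * n * w ^ 3 - 8 * S ^
        3 * b ^ 2 * n ^ 2 * w ^ 3 - 4 * S ^ 4 * a ^ 2 * b * w ^ 3 - 16 * S ^ 4 * a * b ^ 2 * n * w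
        ^ 3 - 8 * S ^ 5 * a ^ 2 * b ^ 2 * w ^ 3) * h8
  have hCX : (⟨4 * sig m * n * l + 4 * sig m ^ 2 * a * l, 4 * sig m * k * l + 4 * sig m ^ 2 * d * l, 1 + 2
      * sig m * a + 2 * sig m * d + 4 * sig m ^ 2 * a * d + 4 * sig m ^ 2 * b * c + 4 * sig m ^ 3
      * a * d * l + 4 * sig m ^ 3 * b * c * l⟩ : Coord m l) *
      ⟨1 + 2 * sig m * a + 4 * sig m * l, 2 * sig m * b, k + 4 * sig m * k * l + 4 * sig m ^ 2 * b
      * l⟩ =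
      ⟨1 + 2 * sig m * a + 4 * sig m * n * l + 4 * sig m ^ 2 * a * l, 2 * sig m * b + 4 * sig m *
      k * l + 4 * sig m ^ 2 * d * l, 1 + k + 2 * sig m * a + 2 * sig m * d + 4 * sig m ^ 2 * a * d
      + 4 * sig m ^ 2 * b * c + 4 * sig m ^ 2 * b * l + 4 * sig m ^ 2 * d * l + 4 * sig m ^ 3 * a
      * d * l + 4 * sig m ^ 3 * b * c * l⟩ := by
    ext
    · simp only [mul_i, kap_eq]
      generalize sig m = S at *
      generalize (l : ZMod (2 ^ (2 * m - 1))) = w at *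
      linear_combination (-2 * a * w - d * w - 2 * w ^ 2 - 4 * S * a * d * w - 4 * S * a * w ^ 2 - 2 * S * a ^ 2 *
        w - 2 * S * b * c * w - 4 * S * d * w ^ 2 + 2 * S * a * k * w ^ 2 + 4 * S * k * w ^ 3 - 4
        * S ^ 2 * a * b * c * w - 8 * S ^ 2 * a * d * w ^ 2 - 4 * S ^ 2 * a ^ 2 * d * w - 10 * S ^
        2 * b * c * w ^ 2 + 4 * S ^ 2 * d * w ^ 3 + 16 * S ^ 2 * a * k * w ^ 3 + 4 * S ^ 2 * a ^ 2
        * k * w ^ 2 + 16 * S ^ 2 * k * w ^ 4 - 4 * S ^ 3 * a * b * c * w ^ 2 + 8 * S ^ 3 * a * d *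
        w ^ 3 - 8 * S ^ 3 * b * c * w ^ 3 + 16 * S ^ 3 * d * w ^ 4) * h8
    · simp only [mul_j, kap_eq]
      generalize sig m = S at *
      generalize (l : ZMod (2 ^ (2 * m - 1))) = w at *
      linear_combination (b * w + k * w ^ 2 + 2 * S * a * b * w + 2 * S * b * d * w + S * d * w ^ 2 + 2 * S * a * k
        * w ^ 2 - 4 * S * b * k * w ^ 2 + 4 * S * k * w ^ 3 - 4 * S * k ^ 2 * w ^ 3 + 4 * S ^ 2 *
        a * b * d * w + 2 * S ^ 2 * a * d * w ^ 2 - 4 * S ^ 2 * b * d * w ^ 2 + 4 * S ^ 2 * b ^ 2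
        * c * w + 4 * S ^ 2 * d * w ^ 3 - 8 * S ^ 2 * a * b * k * w ^ 2 - 16 * S ^ 2 * b * k * w ^
        3 - 8 * S ^ 2 * d * k * w ^ 3 - 8 * S ^ 2 * a * k ^ 2 * w ^ 3 - 16 * S ^ 2 * k ^ 2 * w ^ 4
        - 4 * S ^ 3 * a * b * d * w ^ 2 - 16 * S ^ 3 * b * d * w ^ 3 + 4 * S ^ 3 * b ^ 2 * c * w ^
        2 - 4 * S ^ 3 * d ^ 2 * w ^ 3 - 16 * S ^ 3 * a * d * k * w ^ 3 - 32 * S ^ 3 * d * k * w ^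
        4 - 8 * S ^ 4 * a * d ^ 2 * w ^ 3 - 16 * S ^ 4 * d ^ 2 * w ^ 4) * h8
    · simp only [mul_k, kap_eq]
      generalize sig m = S at *
      generalize (l : ZMod (2 ^ (2 * m - 1))) = w at *
      linear_combination (-d * w - a * k * w - S * a * d * w + 7 * S * a * k * w ^ 2 + 4 * S * d * k * w ^ 2 + 6 *
        S * k * w ^ 3 + 7 * S ^ 2 * a * d * w ^ 2 + 6 * S ^ 2 * d * w ^ 3 + 4 * S ^ 2 * d ^ 2 * w
        ^ 2 + 16 * S ^ 2 * a * d * k * w ^ 2 + 8 * S ^ 2 * a * k * w ^ 3 + 6 * S ^ 2 * a ^ 2 * k *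
        w ^ 2 + 8 * S ^ 2 * b * c * k * w ^ 2 + 16 * S ^ 2 * d * k * w ^ 3 - 8 * S ^ 2 * k * w ^ 4
        - 4 * S ^ 2 * a * k ^ 2 * w ^ 3 - 8 * S ^ 2 * k ^ 2 * w ^ 4 + 8 * S ^ 3 * a * d * w ^ 3 +
        16 * S ^ 3 * a * d ^ 2 * w ^ 2 + 6 * S ^ 3 * a ^ 2 * d * w ^ 2 + 8 * S ^ 3 * b * c * d * w
        ^ 2 - 8 * S ^ 3 * d * w ^ 4 + 16 * S ^ 3 * d ^ 2 * w ^ 3 + 16 * S ^ 3 * a * b * c * k * w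
        ^ 2 + 32 * S ^ 3 * a * d * k * w ^ 3 + 16 * S ^ 3 * a ^ 2 * d * k * w ^ 2 + 40 * S ^ 3 * b
        * c * k * w ^ 3 - 16 * S ^ 3 * d * k * w ^ 4 - 32 * S ^ 3 * a * k ^ 2 * w ^ 4 - 8 * S ^ 3
        * a ^ 2 * k ^ 2 * w ^ 3 - 32 * S ^ 3 * k ^ 2 * w ^ 5 + 16 * S ^ 4 * a * b * c * d * w ^ 2
        + 36 * S ^ 4 * a * d ^ 2 * w ^ 3 + 16 * S ^ 4 * a ^ 2 * d ^ 2 * w ^ 2 + 40 * S ^ 4 * b * c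
        * d * w ^ 3 - 8 * S ^ 4 * d ^ 2 * w ^ 4 + 16 * S ^ 4 * a * b * c * k * w ^ 3 - 32 * S ^ 4
        * a * d * k * w ^ 4 + 32 * S ^ 4 * b * c * k * w ^ 4 - 64 * S ^ 4 * d * k * w ^ 5 + 16 * S
        ^ 5 * a * b * c * d * w ^ 3 + 8 * S ^ 5 * a ^ 2 * d ^ 2 * w ^ 3 + 32 * S ^ 5 * b * c * d *
        w ^ 4 - 32 * S ^ 5 * d ^ 2 * w ^ 5) * h8
  have hCXe : (⟨1 + 2 * sig m * a + 4 * sig m * n * l + 4 * sig m ^ 2 * a * l, 2 * sig m * b + 4 * sig m *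
      k * l + 4 * sig m ^ 2 * d * l, 1 + k + 2 * sig m * a + 2 * sig m * d + 4 * sig m ^ 2 * a * d
      + 4 * sig m ^ 2 * b * c + 4 * sig m ^ 2 * b * l + 4 * sig m ^ 2 * d * l + 4 * sig m ^ 3 * a
      * d * l + 4 * sig m ^ 3 * b * c * l⟩ : Coord m l) *
      ⟨0, 0, 4 * sig m ^ 2 * b * l + 4 * sig m ^ 2 * d * l⟩ =
      ⟨1 + 2 * sig m * a + 4 * sig m * n * l + 4 * sig m ^ 2 * a * l, 2 * sig m * b + 4 * sig m *
      k * l + 4 * sig m ^ 2 * d * l, 1 + k + 2 * sig m * a + 2 * sig m * d + 4 * sig m ^ 2 * a * d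
      + 4 * sig m ^ 2 * b * c + 4 * sig m ^ 3 * a * d * l + 4 * sig m ^ 3 * b * c * l⟩ := by
    ext
    · simp only [mul_i, kap_eq]
      generalize sig m = S at *
      generalize (l : ZMod (2 ^ (2 * m - 1))) = w at *
      linear_combination (0) * h8
    · simp only [mul_j, kap_eq]
      generalize sig m = S at *
      generalize (l : ZMod (2 ^ (2 * m - 1))) = w at *
      linear_combination (0) * h8
    · simp only [mul_k, kap_eq]
      generalize sig m = S at *
      generalize (l : ZMod (2 ^ (2 * m - 1))) = w at *
      linear_combination (b * w + d * w) * h8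
  rw [hX, hxC, hCX, hCXe]

/-- Squaring moves the exponent of B into the annihilator of 2κ, where the power formula
`zpow_eq_mk` becomes available. -/
theorem mk_mul_self (a b k : ZMod (2 ^ (2 * m - 1))) :
    (⟨1 + 2 * sig m * a, 2 * sig m * b, k⟩ : Coord m l) * ⟨1 + 2 * sig m * a, 2 * sig m * b, k⟩ =
      ⟨2 + 4 * sig m * a - 4 * sig m * k * l, 4 * sig m * b + 4 * sig m ^ 2 * b * l, 2 * k - 2 *
      sig m * b + 4 * sig m ^ 2 * a * b + 4 * sig m ^ 3 * a * b * l⟩ := by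
  have h8 := eight_sig_sq m
  have h : (⟨1 + 2 * sig m * a, 2 * sig m * b, k⟩ : Coord m l) *
      ⟨1 + 2 * sig m * a, 2 * sig m * b, k⟩ =
      ⟨2 + 4 * sig m * a - 4 * sig m * k * l, 4 * sig m * b + 4 * sig m ^ 2 * b * l, 2 * k - 2 *
      sig m * b + 4 * sig m ^ 2 * a * b + 4 * sig m ^ 3 * a * b * l⟩ := by
    ext
    · simp only [mul_i, kap_eq]
      generalize sig m = S at *
      generalize (l : ZMod (2 ^ (2 * m - 1))) = w at *
      linear_combination (-a * k * w + S * a * b * w + 2 * S ^ 2 * a ^ 2 * b * w) * h8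
    · simp only [mul_j, kap_eq]
      generalize sig m = S at *
      generalize (l : ZMod (2 ^ (2 * m - 1))) = w at *
      linear_combination (b * k * w + S * a * b * w - 3 * S * b ^ 2 * w - 6 * S ^ 2 * a * b ^ 2 * w) * h8
    · simp only [mul_k, kap_eq]
      generalize sig m = S at *
      generalize (l : ZMod (2 ^ (2 * m - 1))) = w at *
      linear_combination (-a * b + b * k * w - S * a * b * w + 2 * S * a * b * k * w - S ^ 2 * a * b ^ 2 * w - S ^
        2 * a ^ 2 * b * w - 2 * S ^ 3 * a ^ 2 * b ^ 2 * w) * h8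
  exact h

end Coord

end MacdonaldAut

namespace MacdonaldAut

/-! ### Powers and the first defining relation for near pairs -/

namespace Coord

variable {m : ℕ} {l : ℤ}

/-- The hypothesis on `g.j` kills the higher corrections in the group law, so the exponents of B add
and the other two coordinates are quadratic in n. The integer T stands for n(n - 1)/2, since halving
is not possible in R. -/
theorem zpow_eq_mk {g : Coord m l} (hg : 2 * kap m l * g.j = 0) {n T : ℤ}
    (hT : 2 * T = n * (n - 1)) :
    g ^ n = ⟨n * g.i - 4 * kap m l * g.i * g.k * T, n * g.j, n * g.k - g.i * g.j * T⟩ := by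
  have hTn : T = n * (n - 1) / 2 := by omega
  have h8 := eight_kap_sq m l
  obtain ⟨t, ht⟩ := exists_half_mul_pred g.i
  rw [hTn]
  refine (eq_zpow_of_succ (f := fun n : ℤ => (⟨n * g.i - 4 * kap m l * g.i * g.k *
    (n * (n - 1) / 2 : ℤ), n * g.j, n * g.k - g.i * g.j * (n * (n - 1) / 2 : ℤ)⟩ : Coord m l))
    ?_ ?_ n).symm
  · ext <;> simp
  · intro a
    have h1 : (a + 1) * (a + 1 - 1) / 2 = a * (a - 1) / 2 + a := by
      rw [show (a + 1) * (a + 1 - 1) = a * (a - 1) + a * 2 by ring,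
        Int.add_mul_ediv_right _ _ (by norm_num)]
    rw [h1]
    generalize a * (a - 1) / 2 = T'
    ext
    · simp only [mul_i]; push_cast
      linear_combination (-g.i * (g.i - 1) * a - 2 * g.i * g.i * T') * hg
    · simp only [mul_j]; push_cast
      linear_combination (g.i * a * (a * g.j - 1) - 2 * (a * g.k - g.i * g.j * T' - g.i * a * g.j)) * hg
    · simp only [mul_k]; push_cast
      linear_combination (-2 * g.i * a * (a * g.k - g.i * g.j * T') - t * a * (a * g.j - 1)
        + g.i * (g.i - 1) * a ^ 2 * g.j) * hg - kap m l * a * g.j * (a * g.j - 1) * ht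

theorem mk_zpow_four_mul (a b k : ZMod (2 ^ (2 * m - 1))) (t : ℤ) :
    (⟨1 + 2 * sig m * a, 2 * sig m * b, k⟩ : Coord m l) ^ (4 * t) =
      (⟨2 + 4 * sig m * a - 4 * sig m * k * l, 4 * sig m * b + 4 * sig m ^ 2 * b * l,
        2 * k - 2 * sig m * b + 4 * sig m ^ 2 * a * b + 4 * sig m ^ 3 * a * b * l⟩ :
          Coord m l) ^ (2 * t) := by
  rw [← mk_mul_self, ← pow_two, ← zpow_natCast, ← zpow_mul]
  congr 1
  push_cast
  ring

theorem two_kap_mul_mk_mul_self (b : ZMod (2 ^ (2 * m - 1))) :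
    2 * kap m l * (4 * sig m * b + 4 * sig m ^ 2 * b * l) = 0 := by
  rw [kap_eq]
  linear_combination (l * b + l ^ 2 * sig m * b) * eight_sig_sq m

theorem mk_zpow_two_pow_mul (hm : 1 < m) (a b k : ZMod (2 ^ (2 * m - 1))) :
    (⟨1 + 2 * sig m * a, 2 * sig m * b, k⟩ : Coord m l) ^ (2 ^ m * l : ℤ) =
      ⟨4 * sig m * l, 0, 4 * sig m * k * l + 4 * sig m ^ 2 * b * l⟩ := by
  have e : (2 ^ m * l : ℤ) = 4 * (2 ^ (m - 2) * l) := by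
    obtain ⟨r, rfl⟩ := Nat.exists_eq_add_of_le (show 2 ≤ m from hm)
    rw [Nat.add_sub_cancel_left, pow_add]
    ring
  have h8 := eight_sig_sq m
  have ht : (2 : ZMod (2 ^ (2 * m - 1))) ^ (m - 2) = sig m := rfl
  -- With t = 2^(m-2)ℓ the exponent is 4t, so the square of the element is raised to 2t, and T =
  -- 2t(2t - 1)/2 = t(2t - 1).
  rw [e, mk_zpow_four_mul, zpow_eq_mk (two_kap_mul_mk_mul_self b)
    (T := 2 ^ (m - 2) * l * (2 * (2 ^ (m - 2) * l) - 1)) (by ring)]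
  push_cast
  rw [ht]
  ext
  · simp only [kap_eq]
    generalize sig m = S at *
    generalize (l : ZMod (2 ^ (2 * m - 1))) = w at *
    linear_combination (a * w - k * w ^ 2 - (1 + 2 * S * a - 2 * S * k * w) *
      (2 * k - 2 * S * b + 4 * S ^ 2 * a * b + 4 * S ^ 3 * a * b * w) * w ^ 2 *
      (2 * S * w - 1)) * h8
  · generalize sig m = S at *
    generalize (l : ZMod (2 ^ (2 * m - 1))) = w at *
    linear_combination (w * b + S * w ^ 2 * b) * h8
  · generalize sig m = S at *
    generalize (l : ZMod (2 ^ (2 * m - 1))) = w at *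
    linear_combination (S * a * b * w + S ^ 2 * a * b * w ^ 2 - b * w - (1 + 2 * S * a - 2 * S * k * w) *
      (b + S * b * w) * w * (2 * S * w - 1)) * h8

theorem mk_pow_two_pow (hm : 1 < m) (a b k : ZMod (2 ^ (2 * m - 1))) :
    (⟨1 + 2 * sig m * a, 2 * sig m * b, k⟩ : Coord m l) ^ 2 ^ (2 * m - 1) = 1 := by
  have h8 := eight_sig_sq m
  -- The form 4t with t = 2σ² is chosen so that every coordinate of the resulting power is visibly a
  -- multiple of 8σ².
  have e : ((2 ^ (2 * m - 1) : ℕ) : ℤ) = 4 * (2 * (2 ^ (m - 2)) ^ 2) := by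
    obtain ⟨r, rfl⟩ := Nat.exists_eq_add_of_le (show 2 ≤ m from hm)
    rw [show 2 * (2 + r) - 1 = 3 + (2 + r - 2) * 2 by omega, pow_add, pow_mul]
    push_cast
    ring
  have ht : (2 : ZMod (2 ^ (2 * m - 1))) ^ (m - 2) = sig m := rfl
  rw [← zpow_natCast, e, mk_zpow_four_mul, zpow_eq_mk (two_kap_mul_mk_mul_self b)
    (T := 2 * (2 ^ (m - 2)) ^ 2 * (2 * (2 * (2 ^ (m - 2)) ^ 2) - 1)) (by ring)]
  push_cast
  rw [ht]
  ext
  · simp only [kap_eq, one_i]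
    generalize sig m = S at *
    generalize (l : ZMod (2 ^ (2 * m - 1))) = w at *
    linear_combination (1 + 2 * S * a - 2 * S * k * w - S * w * (2 + 4 * S * a - 4 * S * k * w) *
      (2 * k - 2 * S * b + 4 * S ^ 2 * a * b + 4 * S ^ 3 * a * b * w) *
      (4 * S ^ 2 - 1)) * h8
  · simp only [one_j]
    generalize sig m = S at *
    generalize (l : ZMod (2 ^ (2 * m - 1))) = w at *
    linear_combination (2 * S * b + 2 * S ^ 2 * b * w) * h8
  · simp only [one_k]
    generalize sig m = S at *
    generalize (l : ZMod (2 ^ (2 * m - 1))) = w at *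
    linear_combination (k - S * b + 2 * S ^ 2 * a * b + 2 * S ^ 3 * a * b * w -
      (2 + 4 * S * a - 4 * S * k * w) * (S * b + S ^ 2 * b * w) * (4 * S ^ 2 - 1)) * h8

/-- The first defining relation of `H`, for a pair congruent to `(A, B)` modulo `Z₃`, holds up to
an explicit central factor. -/
theorem cnj_comm_eq (hm : 1 < m) (hl : Odd l) {x y : Coord m l} (hx : 4 * kap m l * (x.i - 1) = 0)
    (hx' : 4 * kap m l * x.j = 0) (hy : 4 * kap m l * y.i = 0)
    (hy' : 4 * kap m l * (y.j - 1) = 0) :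
    cnj x (comm x y) = x ^ (1 + 2 ^ m * l : ℤ) * ⟨0, 0, 2 * kap m l * (x.j + y.j - 1)⟩ := by
  obtain ⟨xi, xj, xk⟩ := x
  obtain ⟨yi, yj, yk⟩ := y
  obtain ⟨a, ha⟩ := (four_kap_mul_eq_zero_iff hm hl _).mp hx
  obtain ⟨b, rfl⟩ := (four_kap_mul_eq_zero_iff hm hl _).mp hx'
  obtain ⟨c, rfl⟩ := (four_kap_mul_eq_zero_iff hm hl _).mp hy
  obtain ⟨d, hd⟩ := (four_kap_mul_eq_zero_iff hm hl _).mp hy'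
  obtain rfl := sub_eq_iff_eq_add'.mp ha
  obtain rfl := sub_eq_iff_eq_add'.mp hd
  rw [cnj, mul_assoc, inv_mul_eq_iff_eq_mul, zpow_add, zpow_one, mk_zpow_two_pow_mul hm,
    comm_mk_mk, mk_mul_comm_mk, mul_assoc]
  congr 4
  rw [kap_eq]
  ring

theorem pow_two_pow_eq_one (hm : 1 < m) (hl : Odd l) {x : Coord m l}
    (hx : 4 * kap m l * (x.i - 1) = 0) (hx' : 4 * kap m l * x.j = 0) :
    x ^ 2 ^ (2 * m - 1) = 1 := by
  obtain ⟨xi, xj, xk⟩ := x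
  obtain ⟨a, ha⟩ := (four_kap_mul_eq_zero_iff hm hl _).mp hx
  obtain ⟨b, rfl⟩ := (four_kap_mul_eq_zero_iff hm hl _).mp hx'
  obtain rfl := sub_eq_iff_eq_add'.mp ha
  exact mk_pow_two_pow hm a b _

end Coord

end MacdonaldAut

namespace MacdonaldAut

open scoped commutatorElement

/-! ### Nongenerators in nilpotent groups -/

section Nongenerators

variable {G : Type*} [Group G]

/-- In a nilpotent group the commutator subgroup consists of nongenerators. -/
theorem eq_top_of_sup_commutator_eq_top [hG : Group.IsNilpotent G] {S : Subgroup G}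
    (hS : S ⊔ commutator G = ⊤) : S = ⊤ := by
  obtain ⟨n, hn⟩ := hG.nilpotent
  -- Descend the upper central series. If S Z_(k+1) = G, then S Z_k is normal and contains all
  -- commutators, because elements of Z_(k+1) are central modulo Z_k. Hence S Z_k contains S[G, G] =
  -- G.
  have key : ∀ k, S ⊔ Subgroup.upperCentralSeries G k = ⊤ → S = ⊤ := by
    intro k
    induction k with
    | zero => intro h; simpa using h
    | succ k ih =>
      intro h
      apply ih
      have hdec : ∀ g : G, ∃ s ∈ S, ∃ z ∈ Subgroup.upperCentralSeries G (k + 1), s * z = g :=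
        fun g => Subgroup.mem_sup_of_normal_right.mp (h ▸ Subgroup.mem_top g)
      have hz : ∀ z ∈ Subgroup.upperCentralSeries G (k + 1), ∀ g : G,
          ⁅z, g⁆ ∈ S ⊔ Subgroup.upperCentralSeries G k := fun z hz g =>
        Subgroup.mem_sup_right (Subgroup.mem_upperCentralSeries_succ_iff.mp hz g)
      have hnorm : (S ⊔ Subgroup.upperCentralSeries G k).Normal := by
        refine ⟨fun t ht g => ?_⟩
        obtain ⟨s, hs, z, hz', rfl⟩ := hdec g
        have : s * z * t * (s * z)⁻¹ = s * (⁅z, t⁆ * t) * s⁻¹ := by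
          rw [commutatorElement_def]; group
        rw [this]
        have hs' := Subgroup.mem_sup_left (T := Subgroup.upperCentralSeries G k) hs
        exact mul_mem (mul_mem hs' (mul_mem (hz z hz' t) ht)) (inv_mem hs')
      have hcomm : commutator G ≤ S ⊔ Subgroup.upperCentralSeries G k := by
        rw [commutator_def, Subgroup.commutator_le]
        intro g _ h _
        obtain ⟨s, hs, z, hz', rfl⟩ := hdec g
        have hs' := Subgroup.mem_sup_left (T := Subgroup.upperCentralSeries G k) hs
        have : ⁅s * z, h⁆ = s * ⁅z, h⁆ * s⁻¹ * ((s * h) * s⁻¹ * h⁻¹) := by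
          simp only [commutatorElement_def]; group
        rw [this]
        refine mul_mem (hnorm.conj_mem _ (hz z hz' h) s) ?_
        rw [mul_assoc s, mul_assoc s]
        exact mul_mem hs' (hnorm.conj_mem _ (inv_mem hs') h)
      exact eq_top_iff.mpr (hS ▸ sup_le le_sup_left hcomm)
  exact key n (by rw [hn, sup_top_eq])

end Nongenerators

/-! ### Near pairs generate H -/

section Generation

variable {m : ℕ} {l : ℤ}

theorem isUnit_one_add_two_mul {k : ℕ} (x : ZMod (2 ^ k)) : IsUnit (1 + 2 * x) := by
  refine IsNilpotent.isUnit_one_add ((Commute.all 2 x).isNilpotent_mul_right ⟨k, ?_⟩)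
  exact_mod_cast ZMod.natCast_self (2 ^ k)

theorem zpw_zpow {G : Type*} [Group G] {n : ℕ} {x : G} (hx : x ^ n = 1) (i : ZMod n) (a : ℤ) :
    zpw x i ^ a = zpw x (i * (a : ZMod n)) := by
  obtain ⟨b, rfl⟩ := ZMod.intCast_surjective i
  rw [← Int.cast_mul, zpw_intCast hx, zpw_intCast hx, zpow_mul]

/-- Cramer's rule for commuting elements: eliminating b leaves a raised to the determinant, which is
invertible modulo 2^k. -/
theorem eq_one_of_zpw_mul_zpw {G : Type*} [Group G] {k : ℕ} {a b : G} (hab : Commute a b)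
    (ha : a ^ 2 ^ k = 1) (hb : b ^ 2 ^ k = 1) {p q r s : ZMod (2 ^ k)}
    (h1 : zpw a p * zpw b q = 1) (h2 : zpw a r * zpw b s = 1) (hu : IsUnit (p * s - q * r)) :
    a = 1 := by
  obtain ⟨q', rfl⟩ := ZMod.intCast_surjective q
  obtain ⟨s', rfl⟩ := ZMod.intCast_surjective s
  have hc : ∀ i j : ZMod (2 ^ k), Commute (zpw a i) (zpw b j) := fun i j =>
    (hab.zpow_left _).zpow_right _
  have h1' := congrArg (· ^ s') h1
  have h2' := congrArg (· ^ q') h2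
  simp only [(hc _ _).mul_zpow, one_zpow, zpw_zpow ha, zpw_zpow hb] at h1' h2'
  have h3 : zpw a (p * (s' : ZMod (2 ^ k)) - (q' : ZMod (2 ^ k)) * r) = 1 := by
    rw [sub_eq_add_neg, zpw_add ha, zpw_neg ha, mul_inv_eq_one]
    rw [mul_comm (q' : ZMod (2 ^ k)) s'] at h1'
    rw [mul_comm (q' : ZMod (2 ^ k)) r]
    exact mul_right_cancel (h1'.trans h2'.symm)
  obtain ⟨v, hv⟩ := hu.exists_right_inv
  obtain ⟨v, rfl⟩ := ZMod.intCast_surjective v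
  have h4 := zpw_zpow ha (p * (s' : ZMod (2 ^ k)) - (q' : ZMod (2 ^ k)) * r) v
  rwa [hv, h3, one_zpow, zpw_one ha, eq_comm] at h4

instance : Finite (Coord m l) := by
  refine Finite.of_injective (fun x : Coord m l => (x.i, x.j, x.k)) fun x y h => ?_
  simp only [Prod.mk.injEq] at h
  exact Coord.ext h.1 h.2.1 h.2.2

theorem finite_H (hm : 1 < m) : Finite (H m l) := Finite.of_equiv _ (coordEquiv hm).toEquiv.symm

theorem mem_upperCentralSeries_H (hm : 1 < m) (n : ℕ) (x : H m l) :
    x ∈ Subgroup.upperCentralSeries (H m l) n ↔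
      coordEquiv hm x ∈ Subgroup.upperCentralSeries (Coord m l) n := by
  rw [← Subgroup.comap_upperCentralSeries (coordEquiv hm) n]
  rfl

theorem isNilpotent_H (hm : 1 < m) (hl : Odd l) : Group.IsNilpotent (H m l) := by
  refine ⟨4, eq_top_iff.mpr fun x _ => ?_⟩
  rw [mem_upperCentralSeries_H hm, Coord.upperCentralSeries_four hm hl]
  trivial

/-- The pair `(x, y)` is congruent to `(A, B)` modulo `Z₃(H)`. -/
structure Near (hm : 1 < m) (x y : H m l) : Prop where
  i_fst : 4 * kap m l * ((coordEquiv hm x).i - 1) = 0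
  j_fst : 4 * kap m l * (coordEquiv hm x).j = 0
  i_snd : 4 * kap m l * (coordEquiv hm y).i = 0
  j_snd : 4 * kap m l * ((coordEquiv hm y).j - 1) = 0

theorem Near.closure_eq_top {hm : 1 < m} (hl : Odd l) {x y : H m l} (h : Near hm x y) :
    Subgroup.closure {x, y} = ⊤ := by
  have := isNilpotent_H (l := l) hm hl
  apply eq_top_of_sup_commutator_eq_top
  set Q := Subgroup.closure {x, y} ⊔ commutator (H m l) with hQ
  have hQc : commutator (H m l) ≤ Q := le_sup_right
  have hn : Q.Normal := Subgroup.Normal.of_commutator_le (H m l) hQc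
  have hM := isMacdonald_gen m l
  set f := QuotientGroup.mk' Q with hf
  have hab : Commute (f (genA m l)) (f (genB m l)) := by
    rw [← commutatorElement_eq_one_iff_commute, ← map_commutatorElement]
    exact (QuotientGroup.eq_one_iff _).mpr
      (hQc (Subgroup.commutator_mem_commutator trivial trivial))
  have hC : f (comm (genA m l) (genB m l)) = 1 := by
    simp only [comm, map_mul, map_inv]
    rw [mul_assoc, hab.eq]
    group
  have hA : f (genA m l) ^ 2 ^ (2 * m - 1) = 1 := by rw [← map_pow, hM.pow_A, map_one]
  have hB : f (genB m l) ^ 2 ^ (2 * m - 1) = 1 := by rw [← map_pow, hM.pow_B, map_one]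
  have hval : ∀ z ∈ Q, zpw (f (genA m l)) (coordEquiv hm z).i *
      zpw (f (genB m l)) (coordEquiv hm z).j = 1 := by
    intro z hz
    have h1 : f z = 1 := (QuotientGroup.eq_one_iff _).mpr hz
    have h2 := nf_toCoord hm z
    rw [← h2, IsMacdonald.nf, map_mul, map_mul, map_zpw, map_zpw, map_zpw, hC] at h1
    have h3 : zpw (1 : H m l ⧸ Q) (toCoord hm z).k = 1 := one_zpow _
    rwa [h3, mul_one] at h1
  have hx := hval x (Subgroup.mem_sup_left (Subgroup.subset_closure (Or.inl rfl)))
  have hy := hval y (Subgroup.mem_sup_left (Subgroup.subset_closure (Or.inr rfl)))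
  obtain ⟨a, ha⟩ := (four_kap_mul_eq_zero_iff hm hl _).mp h.i_fst
  obtain ⟨b, hb⟩ := (four_kap_mul_eq_zero_iff hm hl _).mp h.j_fst
  obtain ⟨c, hc⟩ := (four_kap_mul_eq_zero_iff hm hl _).mp h.i_snd
  obtain ⟨d, hd⟩ := (four_kap_mul_eq_zero_iff hm hl _).mp h.j_snd
  rw [sub_eq_iff_eq_add'.mp ha, hb] at hx
  rw [sub_eq_iff_eq_add'.mp hd, hc] at hy
  have hfA : f (genA m l) = 1 := by
    refine eq_one_of_zpw_mul_zpw hab hA hB hx hy ?_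
    -- The determinant (1 + 2σa)(1 + 2σd) - 4σ²bc is 1 plus an even element, hence a unit.
    convert isUnit_one_add_two_mul (sig m * a + sig m * d + 2 * sig m ^ 2 * (a * d - b * c)) using 1
    ring
  have hfB : f (genB m l) = 1 := by
    have hcomm : ∀ i j : ZMod (2 ^ (2 * m - 1)), Commute (zpw (f (genA m l)) i)
        (zpw (f (genB m l)) j) := fun i j => (hab.zpow_left _).zpow_right _
    rw [(hcomm _ _).eq] at hx hy
    refine eq_one_of_zpw_mul_zpw hab.symm hB hA hy hx ?_
    convert isUnit_one_add_two_mul (sig m * a + sig m * d + 2 * sig m ^ 2 * (a * d - b * c)) using 1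
    ring
  rw [eq_top_iff, ← closure_gen, Subgroup.closure_le]
  rintro z (rfl | rfl)
  · exact (QuotientGroup.eq_one_iff _).mp hfA
  · exact (QuotientGroup.eq_one_iff _).mp hfB

end Generation

end MacdonaldAut

namespace MacdonaldAut

/-! ### Automorphisms of H from near pairs -/

section Automorphisms

variable {m : ℕ} {l : ℤ}

/-- The homomorphism `A ^ i B ^ j C ^ k ↦ 2κ i`. -/
def chiI (hm : 1 < m) : H m l →* Multiplicative (ZMod (2 ^ (2 * m - 1))) where
  toFun x := Multiplicative.ofAdd (2 * kap m l * (coordEquiv hm x).i)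
  map_one' := by simp
  map_mul' x y := by rw [map_mul (coordEquiv hm), Coord.two_kap_mul_i, ofAdd_add]

/-- The homomorphism `A ^ i B ^ j C ^ k ↦ 2κ j`. -/
def chiJ (hm : 1 < m) : H m l →* Multiplicative (ZMod (2 ^ (2 * m - 1))) where
  toFun x := Multiplicative.ofAdd (2 * kap m l * (coordEquiv hm x).j)
  map_one' := by simp
  map_mul' x y := by rw [map_mul (coordEquiv hm), Coord.two_kap_mul_j, ofAdd_add]

theorem toAdd_chiI (hm : 1 < m) (x : H m l) :
    (chiI hm x).toAdd = 2 * kap m l * (coordEquiv hm x).i := rfl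

theorem toAdd_chiJ (hm : 1 < m) (x : H m l) :
    (chiJ hm x).toAdd = 2 * kap m l * (coordEquiv hm x).j := rfl

/-- The automorphism of `H` that interchanges `A` and `B`. -/
def swapAut (m : ℕ) (l : ℤ) : MulAut (H m l) :=
  MonoidHom.toMulEquiv (liftH (isMacdonald_gen m l).symm) (liftH (isMacdonald_gen m l).symm)
    (hom_ext_H (by simp) (by simp)) (hom_ext_H (by simp) (by simp))

@[simp]
theorem swapAut_genA : swapAut m l (genA m l) = genB m l :=
  liftH_genA (isMacdonald_gen m l).symm

@[simp]
theorem swapAut_genB : swapAut m l (genB m l) = genA m l :=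
  liftH_genB (isMacdonald_gen m l).symm

theorem swapAut_swapAut (x : H m l) : swapAut m l (swapAut m l x) = x :=
  DFunLike.congr_fun (hom_ext_H (f := ((swapAut m l).toMonoidHom.comp (swapAut m l).toMonoidHom))
    (g := MonoidHom.id _) (by simp) (by simp)) x

theorem chiI_swapAut (hm : 1 < m) (x : H m l) : chiI hm (swapAut m l x) = chiJ hm x :=
  DFunLike.congr_fun (hom_ext_H (f := (chiI hm).comp (swapAut m l).toMonoidHom) (g := chiJ hm)
    (by simp [chiI, chiJ]) (by simp [chiI, chiJ])) x

theorem chiJ_swapAut (hm : 1 < m) (x : H m l) : chiJ hm (swapAut m l x) = chiI hm x := by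
  rw [← chiI_swapAut hm, swapAut_swapAut]

theorem map_cnj {G G' : Type*} [Group G] [Group G'] (f : G →* G') (x y : G) :
    f (cnj x y) = cnj (f x) (f y) := by simp [cnj]

theorem map_comm {G G' : Type*} [Group G] [Group G'] (f : G →* G') (x y : G) :
    f (comm x y) = comm (f x) (f y) := by simp [comm]

theorem mem_center_H_iff (hm : 1 < m) (x : H m l) : x ∈ Subgroup.center (H m l) ↔
    (coordEquiv hm x).i = 0 ∧ (coordEquiv hm x).j = 0 ∧ 4 * kap m l * (coordEquiv hm x).k = 0 := by
  rw [← Coord.mem_center_iff, ← Subgroup.upperCentralSeries_one, mem_upperCentralSeries_H hm,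
    Subgroup.upperCentralSeries_one]

/-- The central element `C ^ k`. -/
def cen (hm : 1 < m) (k : ZMod (2 ^ (2 * m - 1))) : H m l := (coordEquiv hm).symm ⟨0, 0, k⟩

theorem cen_mem_center (hm : 1 < m) {k : ZMod (2 ^ (2 * m - 1))} (hk : 4 * kap m l * k = 0) :
    (cen hm k : H m l) ∈ Subgroup.center (H m l) := by
  rw [mem_center_H_iff hm, cen, MulEquiv.apply_symm_apply]
  exact ⟨rfl, rfl, hk⟩

theorem cen_eq_one_iff (hm : 1 < m) (k : ZMod (2 ^ (2 * m - 1))) :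
    (cen hm k : H m l) = 1 ↔ k = 0 := by
  rw [cen, MulEquiv.map_eq_one_iff, Coord.ext_iff]
  simp

namespace Near

variable {hm : 1 < m} {x y : H m l}

/-- The interchange acts simply only on the homomorphisms 2κi and 2κj, which it exchanges. Twice
these homomorphisms suffices for the conditions modulo Z₃. -/
theorem swap (h : Near hm x y) : Near hm (swapAut m l y) (swapAut m l x) := by
  have hi : ∀ z : H m l, 2 * kap m l * (coordEquiv hm (swapAut m l z)).i =
    2 * kap m l * (coordEquiv hm z).j := fun z => congrArg Multiplicative.toAdd (chiI_swapAut hm z)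
  have hj : ∀ z : H m l, 2 * kap m l * (coordEquiv hm (swapAut m l z)).j =
    2 * kap m l * (coordEquiv hm z).i := fun z => congrArg Multiplicative.toAdd (chiJ_swapAut hm z)
  exact ⟨by linear_combination 2 * hi y + h.j_snd, by linear_combination 2 * hj y + h.i_snd,
    by linear_combination 2 * hi x + h.j_fst, by linear_combination 2 * hj x + h.i_fst⟩

theorem cnj_comm (h : Near hm x y) (hl : Odd l) : cnj x (comm x y) = x ^ (1 + 2 ^ m * l : ℤ) *
    cen hm (2 * kap m l * ((coordEquiv hm x).j + (coordEquiv hm y).j - 1)) := by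
  apply (coordEquiv hm).injective
  have := Coord.cnj_comm_eq hm hl h.i_fst h.j_fst h.i_snd h.j_snd
  rw [map_mul, map_zpow, cen, MulEquiv.apply_symm_apply, ← this]
  simp [cnj, comm]

theorem cnj_comm' (h : Near hm x y) (hl : Odd l) : cnj y (comm y x) = y ^ (1 + 2 ^ m * l : ℤ) *
    swapAut m l
      (cen hm (2 * kap m l * ((coordEquiv hm x).i + (coordEquiv hm y).i - 1))) := by
  have h1 := h.swap.cnj_comm hl
  have hj : ∀ z : H m l, 2 * kap m l * (coordEquiv hm (swapAut m l z)).j =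
    2 * kap m l * (coordEquiv hm z).i := fun z => congrArg Multiplicative.toAdd (chiJ_swapAut hm z)
  rw [show 2 * kap m l * ((coordEquiv hm (swapAut m l y)).j + (coordEquiv hm (swapAut m l x)).j - 1)
    = 2 * kap m l * ((coordEquiv hm x).i + (coordEquiv hm y).i - 1) by
      linear_combination hj y + hj x] at h1
  have h2 := congrArg (swapAut m l) h1
  rw [map_mul, map_zpow, swapAut_swapAut] at h2
  rw [← h2]
  simp [cnj, comm, swapAut_swapAut]

theorem pow_fst (h : Near hm x y) (hl : Odd l) : x ^ 2 ^ (2 * m - 1) = 1 := by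
  apply (coordEquiv hm).injective
  rw [map_pow, map_one, Coord.pow_two_pow_eq_one hm hl h.i_fst h.j_fst]

theorem pow_snd (h : Near hm x y) (hl : Odd l) : y ^ 2 ^ (2 * m - 1) = 1 := by
  apply (swapAut m l).injective
  rw [map_pow, map_one, h.swap.pow_fst hl]

/-- The power relations hold for every near pair, and each conjugation relation holds up to C^t or
its image under the interchange, so only the vanishing of the two exponents remains. -/
theorem isMacdonald_iff (h : Near hm x y) (hl : Odd l) : IsMacdonald m l x y (comm x y) ↔
    2 * kap m l * ((coordEquiv hm x).i + (coordEquiv hm y).i - 1) = 0 ∧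
    2 * kap m l * ((coordEquiv hm x).j + (coordEquiv hm y).j - 1) = 0 := by
  have h1 := h.cnj_comm hl
  have h2 := h.cnj_comm' hl
  constructor
  · intro hM
    have e1 : cnj x (comm x y) = x ^ (1 + 2 ^ m * l : ℤ) := hM.conj_A
    have e2 : cnj y (comm y x) = y ^ (1 + 2 ^ m * l : ℤ) := by
      rw [← hM.conj_B]; simp only [cnj, comm]; group
    rw [e1, left_eq_mul, cen_eq_one_iff] at h1
    rw [e2, left_eq_mul, MulEquiv.map_eq_one_iff, cen_eq_one_iff] at h2
    exact ⟨h2, h1⟩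
  · rintro ⟨hi, hj⟩
    rw [hj, (cen_eq_one_iff hm 0).mpr rfl, mul_one] at h1
    rw [hi, (cen_eq_one_iff hm 0).mpr rfl, map_one, mul_one] at h2
    exact isMacdonald_of_comm (h.pow_fst hl) (h.pow_snd hl) h1 h2

/-- The error exponents are multiples of 2κ, so 4κ annihilates them and the errors are central.
Nothing obstructs the relations in K. -/
theorem isMacdonald_mk (h : Near hm x y) (hl : Odd l) :
    IsMacdonald m l (x : K m l) (y : K m l) (comm (x : K m l) (y : K m l)) := by
  have hcen : ∀ t, (cen hm (2 * kap m l * t) : H m l) ∈ Subgroup.center (H m l) := fun t =>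
    cen_mem_center hm (by linear_combination t * eight_kap_sq m l)
  have key : ∀ u z c : H m l, cnj u (comm u z) = u ^ (1 + 2 ^ m * l : ℤ) * c →
      c ∈ Subgroup.center (H m l) →
      cnj (u : K m l) (comm (u : K m l) (z : K m l)) = (u : K m l) ^ (1 + 2 ^ m * l : ℤ) := by
    intro u z c hu hc
    have := congrArg (QuotientGroup.mk' (Subgroup.center (H m l))) hu
    rw [map_cnj, map_comm, map_mul, map_zpow] at this
    have hc1 : QuotientGroup.mk' (Subgroup.center (H m l)) c = 1 :=
      (QuotientGroup.eq_one_iff _).mpr hc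
    rw [hc1, mul_one] at this
    exact this
  refine isMacdonald_of_comm ?_ ?_ (key _ _ _ (h.cnj_comm hl) (hcen _))
    (key _ _ _ (h.cnj_comm' hl) ?_)
  · rw [← QuotientGroup.mk_pow, h.pow_fst hl]; rfl
  · rw [← QuotientGroup.mk_pow, h.pow_snd hl]; rfl
  · have := (Subgroup.characteristic_iff_map_eq (H := Subgroup.center (H m l))).mp
      inferInstance (swapAut m l)
    rw [← this]
    exact ⟨_, hcen _, rfl⟩

/-- A pair congruent to `(A, B)` modulo `Z₃(H)` that satisfies the defining relations is the image
of `(A, B)` under an automorphism of `H`. -/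
theorem exists_mulAut (h : Near hm x y) (hl : Odd l) (hM : IsMacdonald m l x y (comm x y)) :
    ∃ φ : MulAut (H m l), φ (genA m l) = x ∧ φ (genB m l) = y := by
  have := finite_H (l := l) hm
  have hs : Function.Surjective (liftH hM) := by
    rw [← MonoidHom.range_eq_top, eq_top_iff, ← h.closure_eq_top hl, Subgroup.closure_le]
    rintro z (rfl | rfl)
    · exact ⟨genA m l, liftH_genA hM⟩
    · exact ⟨genB m l, liftH_genB hM⟩
  exact ⟨MulEquiv.ofBijective (liftH hM)
    (Finite.injective_iff_surjective.mpr hs |>.bijective_of_finite),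
    liftH_genA hM, liftH_genB hM⟩

end Near

theorem mem_autI_H_iff (n : ℕ) (φ : MulAut (H m l)) : φ ∈ autI (H m l) n ↔
    (genA m l)⁻¹ * φ (genA m l) ∈ Subgroup.upperCentralSeries (H m l) n ∧
    (genB m l)⁻¹ * φ (genB m l) ∈ Subgroup.upperCentralSeries (H m l) n := by
  rw [mem_autI_iff]
  refine ⟨fun h => ⟨h _, h _⟩, fun ⟨hA, hB⟩ x => ?_⟩
  have := DFunLike.congr_fun (hom_ext_H
    (f := (QuotientGroup.mk' (Subgroup.upperCentralSeries (H m l) n)))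
    (g := (QuotientGroup.mk' (Subgroup.upperCentralSeries (H m l) n)).comp φ.toMonoidHom)
    (QuotientGroup.eq.mpr hA) (QuotientGroup.eq.mpr hB)) x
  exact QuotientGroup.eq.mp this

theorem mem_autI_K_iff (n : ℕ) (φ : MulAut (K m l)) : φ ∈ autI (K m l) n ↔
    (genA m l : K m l)⁻¹ * φ (genA m l : K m l) ∈ Subgroup.upperCentralSeries (K m l) n ∧
    (genB m l : K m l)⁻¹ * φ (genB m l : K m l) ∈ Subgroup.upperCentralSeries (K m l) n := by
  rw [mem_autI_iff]
  refine ⟨fun h => ⟨h _, h _⟩, fun ⟨hA, hB⟩ x => ?_⟩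
  induction x using QuotientGroup.induction_on with
  | H x =>
  have := DFunLike.congr_fun (hom_ext_H
    (f := (QuotientGroup.mk' (Subgroup.upperCentralSeries (K m l) n)).comp
      (QuotientGroup.mk' (Subgroup.center (H m l))))
    (g := ((QuotientGroup.mk' (Subgroup.upperCentralSeries (K m l) n)).comp φ.toMonoidHom).comp
      (QuotientGroup.mk' (Subgroup.center (H m l))))
    (QuotientGroup.eq.mpr hA) (QuotientGroup.eq.mpr hB)) x
  exact QuotientGroup.eq.mp this

theorem two_kap_i_inv_mul (hm : 1 < m) (u x : H m l) : 2 * kap m l * (coordEquiv hm (u⁻¹ * x)).i =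
    2 * kap m l * (coordEquiv hm x).i - 2 * kap m l * (coordEquiv hm u).i := by
  have h := Coord.two_kap_mul_i (coordEquiv hm u) (coordEquiv hm (u⁻¹ * x))
  rw [← map_mul, mul_inv_cancel_left] at h
  linear_combination -h

theorem two_kap_j_inv_mul (hm : 1 < m) (u x : H m l) : 2 * kap m l * (coordEquiv hm (u⁻¹ * x)).j =
    2 * kap m l * (coordEquiv hm x).j - 2 * kap m l * (coordEquiv hm u).j := by
  have h := Coord.two_kap_mul_j (coordEquiv hm u) (coordEquiv hm (u⁻¹ * x))
  rw [← map_mul, mul_inv_cancel_left] at h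
  linear_combination -h

theorem near_iff (hm : 1 < m) (hl : Odd l) (x y : H m l) : Near hm x y ↔
    (genA m l)⁻¹ * x ∈ Subgroup.upperCentralSeries (H m l) 3 ∧
    (genB m l)⁻¹ * y ∈ Subgroup.upperCentralSeries (H m l) 3 := by
  simp only [mem_upperCentralSeries_H hm, Coord.mem_three_iff hm hl]
  have h1 := two_kap_i_inv_mul hm (genA m l) x
  have h2 := two_kap_j_inv_mul hm (genA m l) x
  have h3 := two_kap_i_inv_mul hm (genB m l) y
  have h4 := two_kap_j_inv_mul hm (genB m l) y
  simp only [coordEquiv_genA, coordEquiv_genB] at h1 h2 h3 h4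
  constructor
  · rintro ⟨a, b, c, d⟩
    exact ⟨⟨by linear_combination 2 * h1 + a, by linear_combination 2 * h2 + b⟩,
      by linear_combination 2 * h3 + c, by linear_combination 2 * h4 + d⟩
  · rintro ⟨⟨a, b⟩, c, d⟩
    exact ⟨by linear_combination a - 2 * h1, by linear_combination b - 2 * h2,
      by linear_combination c - 2 * h3, by linear_combination d - 2 * h4⟩

end Automorphisms

end MacdonaldAut

namespace MacdonaldAut

/-! ### Injectivity of the map induced by Λ -/

section General

variable (T : Type*) [Group T]

theorem Lam_mem_autI_iff (i : ℕ) (φ : MulAut T) :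
    Lam T φ ∈ autI (T ⧸ Subgroup.center T) i ↔ φ ∈ autI T (i + 1) := by
  refine ⟨fun h => ?_, Lam_mem_autI T⟩
  rw [mem_autI_iff] at h ⊢
  intro x
  rw [← Subgroup.comap_upperCentralSeries_quotient_center]
  exact h x

theorem Lam_conj (t : T) : Lam T (MulAut.conj t) = MulAut.conj (t : T ⧸ Subgroup.center T) := by
  ext y
  induction y using QuotientGroup.induction_on with
  | H x => rfl

/-- Inner automorphisms of T/Z(T) lift to inner automorphisms of T. After removing the lift,
Z_i(T/Z(T)) pulls back to Z_(i+1)(T). The injectivity of `LamHat` is exactly this equivalence. -/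
theorem Lam_mem_innAutI_iff (i : ℕ) (φ : MulAut T) :
    Lam T φ ∈ innAutI (T ⧸ Subgroup.center T) i ↔ φ ∈ innAutI T (i + 1) := by
  refine ⟨fun h => ?_, Lam_mem_innAutI T⟩
  obtain ⟨_, ⟨t, rfl⟩, τ, hτ, h⟩ := (mem_innAutI_iff _ _ _).mp h
  induction t using QuotientGroup.induction_on with
  | H t =>
  rw [← Lam_conj, ← eq_inv_mul_iff_mul_eq, ← map_inv, ← map_mul] at h
  rw [h, Lam_mem_autI_iff] at hτ
  exact (mem_innAutI_iff _ _ _).mpr ⟨_, ⟨t, rfl⟩, _, hτ, mul_inv_cancel_left _ _⟩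

theorem LamHat_injective (i : ℕ) : Function.Injective (LamHat T i) := by
  rw [injective_iff_map_eq_one]
  intro q hq
  induction q using QuotientGroup.induction_on with
  | H φ =>
  refine (QuotientGroup.eq_one_iff _).mpr ?_
  exact (Lam_mem_innAutI_iff T i φ).mp
    ((QuotientGroup.eq_one_iff (N := (innAutI _ i).subgroupOf _) _).mp hq)

theorem autI_mono {i j : ℕ} (h : i ≤ j) : autI T i ≤ autI T j := by
  intro φ hφ
  rw [mem_autI_iff] at hφ ⊢
  exact fun x => Subgroup.upperCentralSeries_mono T h (hφ x)

/-- If `[T, T]` is contained in the `i`-th centre, every inner automorphism lies in `Aut_i(T)`. -/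
theorem inn_le_autI {i : ℕ} (h : Subgroup.upperCentralSeries T (i + 1) = ⊤) :
    inn T ≤ autI T i := by
  rintro _ ⟨t, rfl⟩
  rw [mem_autI_iff]
  intro x
  have := Subgroup.mem_upperCentralSeries_succ_iff.mp
    (h ▸ Subgroup.mem_top x⁻¹ : x⁻¹ ∈ Subgroup.upperCentralSeries T (i + 1)) t
  simpa [commutatorElement_def, mul_assoc] using this

end General

/-! ### The central series of K and conjugation into Z₂ -/

section Quotient

variable {m : ℕ} {l : ℤ}

theorem upperCentralSeries_H_four (hm : 1 < m) (hl : Odd l) :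
    Subgroup.upperCentralSeries (H m l) 4 = ⊤ := by
  refine eq_top_iff.mpr fun x _ => ?_
  rw [mem_upperCentralSeries_H hm, Coord.upperCentralSeries_four hm hl]
  trivial

theorem mk_mem_upperCentralSeries_K (n : ℕ) (x : H m l) :
    (x : K m l) ∈ Subgroup.upperCentralSeries (K m l) n ↔
      x ∈ Subgroup.upperCentralSeries (H m l) (n + 1) := by
  rw [← Subgroup.comap_upperCentralSeries_quotient_center]
  rfl

theorem upperCentralSeries_K_three (hm : 1 < m) (hl : Odd l) :
    Subgroup.upperCentralSeries (K m l) 3 = ⊤ := by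
  refine eq_top_iff.mpr fun x _ => ?_
  induction x using QuotientGroup.induction_on with
  | H x =>
  rw [mk_mem_upperCentralSeries_K, upperCentralSeries_H_four hm hl]
  trivial

theorem innAutI_H_le (hm : 1 < m) (hl : Odd l) : innAutI (H m l) 2 ≤ autI (H m l) 3 :=
  sup_le (inn_le_autI _ (upperCentralSeries_H_four hm hl)) (autI_mono _ (by norm_num))

theorem innAutI_K_le (hm : 1 < m) (hl : Odd l) : innAutI (K m l) 1 ≤ autI (K m l) 2 :=
  sup_le (inn_le_autI _ (upperCentralSeries_K_three hm hl)) (autI_mono _ (by norm_num))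

theorem mem_autI_three_H_iff (hm : 1 < m) (hl : Odd l) (φ : MulAut (H m l)) :
    φ ∈ autI (H m l) 3 ↔ Near hm (φ (genA m l)) (φ (genB m l)) := by
  rw [mem_autI_H_iff, near_iff hm hl]

theorem mem_autI_two_K_iff (hm : 1 < m) (hl : Odd l) {φ : MulAut (K m l)} {x y : H m l}
    (hx : φ (genA m l : K m l) = x) (hy : φ (genB m l : K m l) = y) :
    φ ∈ autI (K m l) 2 ↔ Near hm x y := by
  rw [mem_autI_K_iff, near_iff hm hl, hx, hy, ← QuotientGroup.mk_inv, ← QuotientGroup.mk_inv,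
    ← QuotientGroup.mk_mul, ← QuotientGroup.mk_mul, mk_mem_upperCentralSeries_K,
    mk_mem_upperCentralSeries_K]

/-- A homomorphism from `H` to the additive group of `ℤ / 2 ^ (2m - 1)`, in coordinates. -/
theorem toAdd_hom_apply (hm : 1 < m) (f : H m l →* Multiplicative (ZMod (2 ^ (2 * m - 1))))
    (x : H m l) : (f x).toAdd = (coordEquiv hm x).i * (f (genA m l)).toAdd +
      (coordEquiv hm x).j * (f (genB m l)).toAdd := by
  have hz : ∀ (u : Multiplicative (ZMod (2 ^ (2 * m - 1)))) (i : ZMod (2 ^ (2 * m - 1))),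
      (zpw u i).toAdd = i * u.toAdd := by
    intro u i
    obtain ⟨a, rfl⟩ := ZMod.intCast_surjective i
    rw [zpw_intCast, toAdd_zpow, zsmul_eq_mul]
    rw [← toAdd_eq_zero, toAdd_pow, nsmul_eq_mul, ZMod.natCast_self, zero_mul]
  have hC : f (comm (genA m l) (genB m l)) = 1 := by
    rw [map_comm, comm, mul_right_comm _ _ (f (genA m l)), inv_mul_cancel, one_mul, inv_mul_cancel]
  conv_lhs => rw [← nf_toCoord hm x, IsMacdonald.nf, map_mul f, map_mul f, map_zpw, map_zpw,
    map_zpw, hC]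
  rw [toAdd_mul, toAdd_mul, hz, hz, hz, toAdd_one, mul_zero, add_zero]
  rfl

/-- Conjugating by a suitable element brings a pair that agrees with `(A, B)` modulo the kernels
of `2κ i` and `2κ j` into the classes of `A` and `B` modulo `Z₂(H)`. -/
theorem exists_conj_mem_two (hm : 1 < m) (hl : Odd l) {x y : H m l}
    (h1 : 2 * kap m l * (coordEquiv hm x).i = 2 * kap m l)
    (h2 : 2 * kap m l * (coordEquiv hm x).j = 0) (h3 : 2 * kap m l * (coordEquiv hm y).i = 0)
    (h4 : 2 * kap m l * (coordEquiv hm y).j = 2 * kap m l) :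
    ∃ t : H m l, (genA m l)⁻¹ * (t⁻¹ * x * t) ∈ Subgroup.upperCentralSeries (H m l) 2 ∧
      (genB m l)⁻¹ * (t⁻¹ * y * t) ∈ Subgroup.upperCentralSeries (H m l) 2 := by
  have key : ∀ t u g : H m l, (u * t) * (t * g)⁻¹ ∈ Subgroup.upperCentralSeries (H m l) 2 →
      g⁻¹ * (t⁻¹ * u * t) ∈ Subgroup.upperCentralSeries (H m l) 2 := by
    intro t u g h
    have hn : (Subgroup.upperCentralSeries (H m l) 2).Normal := inferInstance
    have := hn.conj_mem _ h (t * g)⁻¹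
    convert this using 1
    group
  -- Comparing 4κk in xt and tA forces 4κ t.j = -4κ k_x, and comparing it in yt and tB forces 4κ t.i
  -- = 4κ k_y. The other coordinates are unaffected by conjugation modulo Z₂.
  set t := (coordEquiv (l := l) hm).symm ⟨(coordEquiv hm y).k, -(coordEquiv hm x).k, 0⟩ with ht
  refine ⟨t, key _ _ _ ?_, key _ _ _ ?_⟩
  all_goals
    rw [mem_upperCentralSeries_H hm, map_mul, map_inv, Coord.mul_inv_mem_two_iff hm hl, map_mul,
      map_mul, ht, MulEquiv.apply_symm_apply]
    simp only [Coord.two_kap_mul_i, Coord.two_kap_mul_j, Coord.four_kap_mul_k, coordEquiv_genA,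
      coordEquiv_genB]
  · exact ⟨by linear_combination h1, by linear_combination h2,
      by linear_combination (-2 * (coordEquiv hm y).k) * h2⟩
  · exact ⟨by linear_combination h3, by linear_combination h4,
      by linear_combination (-2 * (coordEquiv hm y).k) * h4⟩

end Quotient

end MacdonaldAut

namespace MacdonaldAut

/-! ### Automorphisms of K from near pairs -/

section AutK

variable {m : ℕ} {l : ℤ}

/-- The A- and B-exponents of [x, y] are multiples of 4σ, and 4κn = 0 forces 4σn = 0 because ℓ is
odd. So the n-th power retains only a C-part annihilated by 4κ. -/
theorem Coord.comm_zpow_mem_center (hm : 1 < m) (hl : Odd l) {x y : Coord m l}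
    (hx : 4 * kap m l * (x.i - 1) = 0) (hx' : 4 * kap m l * x.j = 0) (hy : 4 * kap m l * y.i = 0)
    (hy' : 4 * kap m l * (y.j - 1) = 0) {n : ℤ} (hn : 4 * kap m l * n = 0) :
    comm x y ^ n ∈ Subgroup.center (Coord m l) := by
  obtain ⟨xi, xj, xk⟩ := x
  obtain ⟨yi, yj, yk⟩ := y
  obtain ⟨a, ha⟩ := (four_kap_mul_eq_zero_iff hm hl _).mp hx
  obtain ⟨b, rfl⟩ := (four_kap_mul_eq_zero_iff hm hl _).mp hx'
  obtain ⟨c, rfl⟩ := (four_kap_mul_eq_zero_iff hm hl _).mp hy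
  obtain ⟨d, hd⟩ := (four_kap_mul_eq_zero_iff hm hl _).mp hy'
  obtain rfl := sub_eq_iff_eq_add'.mp ha
  obtain rfl := sub_eq_iff_eq_add'.mp hd
  obtain ⟨T, hT⟩ : ∃ T, n * (n - 1) = 2 * T := (Int.even_mul_pred_self n).two_dvd
  have hσ : 4 * sig m * n = 0 := by
    obtain ⟨u, hu⟩ := (four_kap_mul_eq_zero_iff hm hl _).mp hn
    rw [hu]
    linear_combination u * eight_sig_sq m
  rw [comm_mk_mk, zpow_eq_mk _ hT.symm, mem_center_iff]
  · refine ⟨?_, ?_, ?_⟩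
    · simp only [kap_eq]
      linear_combination (yk * l + sig m * a * l) * hσ - (2 * l * T * (yk * l + sig m * a * l) *
        (1 + 2 * sig m * a + 2 * sig m * d + 4 * sig m ^ 2 * a * d + 4 * sig m ^ 2 * b * c +
        4 * sig m ^ 3 * a * d * l + 4 * sig m ^ 3 * b * c * l)) * eight_sig_sq m
    · linear_combination (xk * l + sig m * d * l) * hσ
    · simp only [kap_eq]
      linear_combination l * (1 + 2 * sig m * a + 2 * sig m * d + 4 * sig m ^ 2 * a * d +
        4 * sig m ^ 2 * b * c + 4 * sig m ^ 3 * a * d * l + 4 * sig m ^ 3 * b * c * l) * hσ -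
        (8 * sig m * l * T * (yk * l + sig m * a * l) * (xk * l + sig m * d * l)) * eight_sig_sq m
  · rw [two_kap_mul_eq_zero_iff hm hl]
    exact ⟨xk * l + sig m * d * l, by ring⟩

/-- Every pair congruent to `(A, B)` modulo `Z₃(H)` is, modulo the centre, the image of `(A, B)`
under an automorphism of `K`. -/
theorem Near.exists_mulAut_K {hm : 1 < m} {x y : H m l} (h : Near hm x y) (hl : Odd l) :
    ∃ φ : MulAut (K m l), φ (genA m l : K m l) = x ∧ φ (genB m l : K m l) = y := by
  have := finite_H (l := l) hm
  have hM := h.isMacdonald_mk hl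
  -- Central elements of H are the C^n with 4κn = 0. They map to the class of [x, y]^n, which is
  -- central in H and so trivial in K; hence the map descends to K.
  have hker : Subgroup.center (H m l) ≤ (liftH hM).ker := by
    intro z hz
    obtain ⟨hi, hj, hk⟩ := (mem_center_H_iff hm z).mp hz
    obtain ⟨n, hn⟩ := ZMod.intCast_surjective (coordEquiv hm z).k
    have hzn : z = comm (genA m l) (genB m l) ^ n := by
      conv_lhs => rw [← nf_toCoord hm z, IsMacdonald.nf]
      have hi' : (toCoord hm z).i = 0 := hi
      have hj' : (toCoord hm z).j = 0 := hj
      have hk' : (toCoord hm z).k = n := hn.symm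
      rw [hi', hj', hk', zpw_zero, zpw_zero, zpw_intCast ((isMacdonald_gen m l).pow_C hm), one_mul,
        one_mul]
      exacts [(isMacdonald_gen m l).pow_B, (isMacdonald_gen m l).pow_A]
    rw [← hn] at hk
    have hc : comm x y ^ n ∈ Subgroup.center (H m l) := by
      rw [← Subgroup.upperCentralSeries_one, mem_upperCentralSeries_H hm,
        Subgroup.upperCentralSeries_one, map_zpow]
      have := Coord.comm_zpow_mem_center hm hl h.i_fst h.j_fst h.i_snd h.j_snd hk
      rwa [← MulEquiv.coe_toMonoidHom, map_comm]
    rw [MonoidHom.mem_ker, hzn, map_zpow, map_comm, liftH_genA, liftH_genB]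
    exact (QuotientGroup.eq_one_iff _).mpr hc
  have hs : Function.Surjective (QuotientGroup.lift _ (liftH hM) hker) := by
    have ht : (liftH hM).range = ⊤ := by
      have h1 := congrArg (Subgroup.map (QuotientGroup.mk' (Subgroup.center (H m l))))
        (h.closure_eq_top hl)
      rw [← MonoidHom.range_eq_map, QuotientGroup.range_mk', MonoidHom.map_closure] at h1
      rw [eq_top_iff, ← h1, Subgroup.closure_le]
      rintro _ ⟨z, rfl | rfl, rfl⟩
      · exact ⟨genA m l, liftH_genA hM⟩
      · exact ⟨genB m l, liftH_genB hM⟩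
    intro z
    obtain ⟨w, hw⟩ := MonoidHom.range_eq_top.mp ht z
    exact ⟨w, hw⟩
  exact ⟨MulEquiv.ofBijective _ (Finite.injective_iff_surjective.mpr hs |>.bijective_of_finite),
    liftH_genA hM, liftH_genB hM⟩

end AutK

/-! ### Displacement homomorphisms on Aut₂(K) -/

section Displacement

variable {m : ℕ} {l : ℤ}

/-- The homomorphism of `K` induced by `chiI`. -/
def kchiI (hm : 1 < m) : K m l →* Multiplicative (ZMod (2 ^ (2 * m - 1))) :=
  QuotientGroup.lift _ (chiI hm) fun x hx => by
    rw [MonoidHom.mem_ker, ← toAdd_eq_zero, toAdd_chiI, ((mem_center_H_iff hm x).mp hx).1, mul_zero]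

/-- The homomorphism of `K` induced by `chiJ`. -/
def kchiJ (hm : 1 < m) : K m l →* Multiplicative (ZMod (2 ^ (2 * m - 1))) :=
  QuotientGroup.lift _ (chiJ hm) fun x hx => by
    rw [MonoidHom.mem_ker, ← toAdd_eq_zero, toAdd_chiJ, ((mem_center_H_iff hm x).mp hx).2.1,
      mul_zero]

theorem kchiI_sq (hm : 1 < m) (hl : Odd l) {z : K m l}
    (hz : z ∈ Subgroup.upperCentralSeries (K m l) 2) : kchiI hm z ^ 2 = 1 := by
  induction z using QuotientGroup.induction_on with
  | H z =>
  rw [mk_mem_upperCentralSeries_K, mem_upperCentralSeries_H hm, Coord.mem_three_iff hm hl] at hz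
  change chiI hm z ^ 2 = 1
  rw [← toAdd_eq_zero, toAdd_pow, toAdd_chiI, nsmul_eq_mul]
  linear_combination hz.1

theorem kchiJ_sq (hm : 1 < m) (hl : Odd l) {z : K m l}
    (hz : z ∈ Subgroup.upperCentralSeries (K m l) 2) : kchiJ hm z ^ 2 = 1 := by
  induction z using QuotientGroup.induction_on with
  | H z =>
  rw [mk_mem_upperCentralSeries_K, mem_upperCentralSeries_H hm, Coord.mem_three_iff hm hl] at hz
  change chiJ hm z ^ 2 = 1
  rw [← toAdd_eq_zero, toAdd_pow, toAdd_chiJ, nsmul_eq_mul]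
  linear_combination hz.2

variable {χ : K m l →* Multiplicative (ZMod (2 ^ (2 * m - 1)))}

/-- On the generators χ∘φ and χ differ by 2-torsion, while an element of Z₂(K) has A- and
B-exponents divisible by 2. The difference therefore disappears on Z₂(K), and this turns the
displacement from a crossed map into a homomorphism. -/
theorem chi_apply_eq (hm : 1 < m) (hl : Odd l)
    (hχ : ∀ z ∈ Subgroup.upperCentralSeries (K m l) 2, χ z ^ 2 = 1) {φ : MulAut (K m l)}
    (hφ : φ ∈ autI (K m l) 2) {z : K m l} (hz : z ∈ Subgroup.upperCentralSeries (K m l) 2) :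
    χ (φ z) = χ z := by
  induction z using QuotientGroup.induction_on with
  | H z =>
  rw [mk_mem_upperCentralSeries_K, mem_upperCentralSeries_H hm, Coord.mem_three_iff hm hl] at hz
  obtain ⟨a, ha⟩ := (four_kap_mul_eq_zero_iff hm hl _).mp hz.1
  obtain ⟨b, hb⟩ := (four_kap_mul_eq_zero_iff hm hl _).mp hz.2
  have hd : ∀ w : K m l, 2 * (χ (φ w)).toAdd = 2 * (χ w).toAdd := by
    intro w
    have := hχ _ ((mem_autI_iff _ _ _).mp hφ w)
    rw [map_mul, map_inv, ← toAdd_eq_zero, toAdd_pow, toAdd_mul, toAdd_inv, nsmul_eq_mul] at this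
    linear_combination this
  have h1 := toAdd_hom_apply hm (χ.comp (φ.toMonoidHom.comp (QuotientGroup.mk' _))) z
  have h2 := toAdd_hom_apply hm (χ.comp (QuotientGroup.mk' _)) z
  apply Multiplicative.toAdd.injective
  refine h1.trans (Eq.trans ?_ h2.symm)
  have hA : 2 * (χ (φ (genA m l : K m l))).toAdd = 2 * (χ (genA m l : K m l)).toAdd := hd _
  have hB : 2 * (χ (φ (genB m l : K m l))).toAdd = 2 * (χ (genB m l : K m l)).toAdd := hd _
  change _ * (χ (φ (genA m l : K m l))).toAdd + _ * (χ (φ (genB m l : K m l))).toAdd =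
    _ * (χ (genA m l : K m l)).toAdd + _ * (χ (genB m l : K m l)).toAdd
  rw [ha, hb]
  linear_combination sig m * a * hA + sig m * b * hB

/-- The homomorphism `φ ↦ χ(a⁻¹ φ(a))` on `Aut₂(K)`. -/
def displacement (hm : 1 < m) (hl : Odd l)
    (hχ : ∀ z ∈ Subgroup.upperCentralSeries (K m l) 2, χ z ^ 2 = 1) (a : K m l) :
    autI (K m l) 2 →* Multiplicative (ZMod (2 ^ (2 * m - 1))) where
  toFun φ := χ (a⁻¹ * (φ : MulAut (K m l)) a)
  map_one' := by simp
  map_mul' φ ψ := by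
    have h := chi_apply_eq hm hl hχ φ.2 ((mem_autI_iff _ _ _).mp ψ.2 a)
    rw [map_mul, map_inv, map_mul χ, map_inv, inv_mul_eq_iff_eq_mul] at h
    rw [Subgroup.coe_mul, MulAut.mul_apply, map_mul χ, h, ← mul_assoc, ← map_mul χ]

/-- The four displacements that detect `Aut₂(K) / Inn(K) Aut₁(K)`. -/
def disp (hm : 1 < m) (hl : Odd l) :
    autI (K m l) 2 →* (Fin 4 → Multiplicative (ZMod (2 ^ (2 * m - 1)))) :=
  MonoidHom.pi ![displacement hm hl (fun _ => kchiI_sq hm hl) (genA m l : K m l),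
    displacement hm hl (fun _ => kchiJ_sq hm hl) (genA m l : K m l),
    displacement hm hl (fun _ => kchiI_sq hm hl) (genB m l : K m l),
    displacement hm hl (fun _ => kchiJ_sq hm hl) (genB m l : K m l)]

/-- The displacements in terms of lifts of the images of the generators. -/
theorem disp_eq (hm : 1 < m) (hl : Odd l) (φ : autI (K m l) 2) {x y : H m l}
    (hx : (φ : MulAut (K m l)) (genA m l : K m l) = x)
    (hy : (φ : MulAut (K m l)) (genB m l : K m l) = y) :
    disp hm hl φ = fun i => Multiplicative.ofAdd
      (![2 * kap m l * ((coordEquiv hm x).i - 1), 2 * kap m l * (coordEquiv hm x).j,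
        2 * kap m l * (coordEquiv hm y).i, 2 * kap m l * ((coordEquiv hm y).j - 1)] i) := by
  have h1 := two_kap_i_inv_mul hm (genA m l) x
  have h2 := two_kap_j_inv_mul hm (genA m l) x
  have h3 := two_kap_i_inv_mul hm (genB m l) y
  have h4 := two_kap_j_inv_mul hm (genB m l) y
  simp only [coordEquiv_genA, coordEquiv_genB] at h1 h2 h3 h4
  funext i
  apply Multiplicative.toAdd.injective
  fin_cases i
  · change (kchiI hm ((genA m l : K m l)⁻¹ * (φ : MulAut (K m l)) (genA m l : K m l))).toAdd = _
    rw [hx]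
    refine h1.trans ?_
    simp; ring
  · change (kchiJ hm ((genA m l : K m l)⁻¹ * (φ : MulAut (K m l)) (genA m l : K m l))).toAdd = _
    rw [hx]
    refine h2.trans ?_
    simp
  · change (kchiI hm ((genB m l : K m l)⁻¹ * (φ : MulAut (K m l)) (genB m l : K m l))).toAdd = _
    rw [hy]
    refine h3.trans ?_
    simp
  · change (kchiJ hm ((genB m l : K m l)⁻¹ * (φ : MulAut (K m l)) (genB m l : K m l))).toAdd = _
    rw [hy]
    refine h4.trans ?_
    simp; ring

end Displacement

end MacdonaldAut

namespace MacdonaldAut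

/-! ### The 2-torsion of ℤ/2^(2m-1) -/

section TwoTorsion

variable {m : ℕ}

theorem four_sig_sq (hm : 1 < m) : 4 * sig m ^ 2 = 2 ^ (2 * m - 2) := by
  rw [show 2 * m - 2 = (m - 1) * 2 by omega, pow_mul, two_pow_pred hm]; ring

theorem two_mul_eq_zero_iff (hm : 1 < m) (u : ZMod (2 ^ (2 * m - 1))) :
    2 * u = 0 ↔ ∃ n : ℤ, u = 4 * sig m ^ 2 * n := by
  constructor
  · obtain ⟨a, rfl⟩ := ZMod.intCast_surjective u
    intro h
    have h1 := (intCast_zmod_two_pow_mul_eq_zero_iff (a := 2 * m - 1) (b := 1) (by omega) odd_one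
      a).mp (by rw [pow_one, Int.cast_one, mul_one, h])
    obtain ⟨n, rfl⟩ := h1
    refine ⟨n, ?_⟩
    rw [four_sig_sq hm, show 2 * m - 1 - 1 = 2 * m - 2 by omega]
    push_cast
    rfl
  · rintro ⟨n, rfl⟩
    linear_combination n * eight_sig_sq m

theorem four_sig_sq_mul_eq_zero_iff (hm : 1 < m) (n : ℤ) :
    4 * sig m ^ 2 * (n : ZMod (2 ^ (2 * m - 1))) = 0 ↔ (2 : ℤ) ∣ n := by
  have h := intCast_zmod_two_pow_mul_eq_zero_iff (a := 2 * m - 1) (b := 2 * m - 2) (by omega)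
    odd_one n
  rw [Int.cast_one, mul_one, ← four_sig_sq hm, show 2 * m - 1 - (2 * m - 2) = 1 by omega,
    pow_one] at h
  exact h

theorem exists_two_kap_mul_eq (hm : 1 < m) {l : ℤ} (hl : Odd l) {u : ZMod (2 ^ (2 * m - 1))}
    (hu : 2 * u = 0) : ∃ w, 2 * kap m l * w = u := by
  obtain ⟨n, rfl⟩ := (two_mul_eq_zero_iff hm u).mp hu
  obtain ⟨r, rfl⟩ := hl
  -- The witness is 2σℓn: multiplying by 2κ = 2σℓ gives 4σ²ℓ²n, and ℓ² may be replaced by 1 since ℓ²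
  -- is odd and 8σ² = 0.
  refine ⟨2 * sig m * (2 * r + 1) * n, ?_⟩
  rw [kap_eq]
  push_cast
  linear_combination (2 * r ^ 2 + 2 * r : ZMod (2 ^ (2 * m - 1))) * n * eight_sig_sq m

/-- The embedding of `ℤ / 2` as the elements of order dividing two. -/
def twoTorsion (m : ℕ) : Multiplicative (ZMod 2) →* Multiplicative (ZMod (2 ^ (2 * m - 1))) :=
  AddMonoidHom.toMultiplicative (ZMod.lift 2 ⟨zmultiplesHom _ (4 * sig m ^ 2), by
    rw [zmultiplesHom_apply, zsmul_eq_mul]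
    push_cast
    linear_combination eight_sig_sq m⟩)

theorem twoTorsion_apply (n : ℤ) : twoTorsion m (Multiplicative.ofAdd (n : ZMod 2)) =
    Multiplicative.ofAdd (4 * sig m ^ 2 * (n : ZMod (2 ^ (2 * m - 1)))) := by
  rw [twoTorsion, AddMonoidHom.toMultiplicative_apply_apply, toAdd_ofAdd, ZMod.lift_coe]
  simp [mul_comm]

theorem twoTorsion_injective (hm : 1 < m) : Function.Injective (twoTorsion m) := by
  rw [injective_iff_map_eq_one]
  intro a ha
  obtain ⟨a, rfl⟩ := Multiplicative.ofAdd.surjective a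
  obtain ⟨n, rfl⟩ := ZMod.intCast_surjective a
  rw [twoTorsion_apply, ofAdd_eq_one, four_sig_sq_mul_eq_zero_iff hm] at ha
  rw [ofAdd_eq_one]
  exact (ZMod.intCast_zmod_eq_zero_iff_dvd n 2).mpr ha

theorem exists_twoTorsion_eq_iff (hm : 1 < m) (u : Multiplicative (ZMod (2 ^ (2 * m - 1)))) :
    (∃ a, twoTorsion m a = u) ↔ u ^ 2 = 1 := by
  constructor
  · rintro ⟨a, rfl⟩
    rw [← map_pow, show a ^ 2 = 1 by revert a; decide, map_one]
  · intro h
    rw [← toAdd_eq_zero, toAdd_pow, nsmul_eq_mul] at h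
    obtain ⟨n, hn⟩ := (two_mul_eq_zero_iff hm u.toAdd).mp h
    exact ⟨_, (twoTorsion_apply n).trans (congrArg Multiplicative.ofAdd hn.symm)⟩

/-- The embedding of `(ℤ / 2)⁴` as the quadruples of elements of order dividing two. -/
def twoTorsionPi (m : ℕ) : (Fin 4 → Multiplicative (ZMod 2)) →*
    (Fin 4 → Multiplicative (ZMod (2 ^ (2 * m - 1)))) := (twoTorsion m).compLeft (Fin 4)

theorem twoTorsionPi_injective (hm : 1 < m) : Function.Injective (twoTorsionPi m) :=
  (twoTorsion_injective hm).comp_left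

theorem mem_range_twoTorsionPi_iff (hm : 1 < m)
    (v : Fin 4 → Multiplicative (ZMod (2 ^ (2 * m - 1)))) :
    v ∈ (twoTorsionPi m).range ↔ ∀ i, v i ^ 2 = 1 := by
  simp only [← exists_twoTorsion_eq_iff hm]
  constructor
  · rintro ⟨w, rfl⟩ i
    exact ⟨w i, rfl⟩
  · intro h
    choose w hw using h
    exact ⟨w, funext hw⟩

end TwoTorsion

/-! ### The structure of Aut₂(K)/Inn(K)Aut₁(K) -/

section OutK

variable {m : ℕ} {l : ℤ}

theorem exists_lifts (φ : MulAut (K m l)) : ∃ x y : H m l,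
    φ (genA m l : K m l) = x ∧ φ (genB m l : K m l) = y := by
  obtain ⟨x, hx⟩ := QuotientGroup.mk_surjective (φ (genA m l : K m l))
  obtain ⟨y, hy⟩ := QuotientGroup.mk_surjective (φ (genB m l : K m l))
  exact ⟨x, y, hx.symm, hy.symm⟩

theorem disp_eq_one_iff (hm : 1 < m) (hl : Odd l) (φ : autI (K m l) 2) {x y : H m l}
    (hx : (φ : MulAut (K m l)) (genA m l : K m l) = x)
    (hy : (φ : MulAut (K m l)) (genB m l : K m l) = y) : disp hm hl φ = 1 ↔
      2 * kap m l * ((coordEquiv hm x).i - 1) = 0 ∧ 2 * kap m l * (coordEquiv hm x).j = 0 ∧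
      2 * kap m l * (coordEquiv hm y).i = 0 ∧ 2 * kap m l * ((coordEquiv hm y).j - 1) = 0 := by
  rw [disp_eq hm hl φ hx hy, funext_iff, Fin.forall_fin_succ, Fin.forall_fin_succ,
    Fin.forall_fin_succ, Fin.forall_fin_one]
  rfl

/-- If the displacements vanish, a suitable conjugation brings the images of A and B into their
classes modulo Z₂(H), that is, modulo Z₁(K). Conversely, inner automorphisms are invisible to
homomorphisms into abelian groups, and 2κi, 2κj vanish on Z₂(H). -/
theorem ker_disp (hm : 1 < m) (hl : Odd l) :
    (disp hm hl).ker = (innAutI (K m l) 1).subgroupOf (autI (K m l) 2) := by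
  ext φ
  obtain ⟨x, y, hx, hy⟩ := exists_lifts (φ : MulAut (K m l))
  rw [MonoidHom.mem_ker, Subgroup.mem_subgroupOf, disp_eq_one_iff hm hl φ hx hy]
  constructor
  · rintro ⟨h1, h2, h3, h4⟩
    obtain ⟨t, hA, hB⟩ := exists_conj_mem_two hm hl (x := x) (y := y)
      (by linear_combination h1) h2 h3 (by linear_combination h4)
    refine (mem_innAutI_iff _ _ _).mpr ⟨MulAut.conj (t : K m l), ⟨t, rfl⟩,
      (MulAut.conj (t : K m l))⁻¹ * φ, ?_, mul_inv_cancel_left _ _⟩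
    rw [mem_autI_K_iff, MulAut.mul_apply, MulAut.mul_apply, hx, hy, MulAut.conj_inv_apply,
      MulAut.conj_inv_apply]
    exact ⟨(mk_mem_upperCentralSeries_K 1 _).mpr hA, (mk_mem_upperCentralSeries_K 1 _).mpr hB⟩
  · intro h
    obtain ⟨_, ⟨t, rfl⟩, τ, hτ, he⟩ := (mem_innAutI_iff _ _ _).mp h
    have key : ∀ z w : H m l, (φ : MulAut (K m l)) (z : K m l) = w →
        2 * kap m l * (coordEquiv hm (z⁻¹ * w)).i = 0 ∧
        2 * kap m l * (coordEquiv hm (z⁻¹ * w)).j = 0 := by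
      intro z w hzw
      obtain ⟨t, rfl⟩ := QuotientGroup.mk_surjective t
      obtain ⟨u, hu⟩ := QuotientGroup.mk_surjective (τ (z : K m l))
      have h1 := (mem_autI_iff _ _ _).mp hτ (z : K m l)
      rw [← hu] at h1
      have h2 := (mk_mem_upperCentralSeries_K 1 (z⁻¹ * u)).mp h1
      rw [mem_upperCentralSeries_H hm, Coord.mem_two_iff hm hl] at h2
      rw [← he, MulAut.mul_apply, ← hu, MulAut.conj_apply] at hzw
      have h3 : ∀ χ : K m l →* Multiplicative (ZMod (2 ^ (2 * m - 1))),
          χ ((z⁻¹ * w : H m l) : K m l) = χ ((z⁻¹ * u : H m l) : K m l) := by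
        intro χ
        rw [QuotientGroup.mk_mul, QuotientGroup.mk_mul, map_mul, map_mul, ← hzw, map_mul, map_mul,
          map_inv χ (t : K m l), mul_right_comm, mul_inv_cancel, one_mul]
      exact ⟨(congrArg Multiplicative.toAdd (h3 (kchiI hm))).trans h2.1,
        (congrArg Multiplicative.toAdd (h3 (kchiJ hm))).trans h2.2.1⟩
    obtain ⟨a, b⟩ := key _ _ hx
    obtain ⟨c, d⟩ := key _ _ hy
    rw [two_kap_i_inv_mul] at a c
    rw [two_kap_j_inv_mul] at b d
    simp only [coordEquiv_genA, coordEquiv_genB] at a b c d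
    exact ⟨by linear_combination a, by linear_combination b, by linear_combination c,
      by linear_combination d⟩

/-- Nearness says precisely that the displacements are 2-torsion. All such quadruples occur, because
every near pair gives an automorphism of K. -/
theorem range_disp (hm : 1 < m) (hl : Odd l) :
    (disp (l := l) hm hl).range = (twoTorsionPi m).range := by
  ext v
  rw [mem_range_twoTorsionPi_iff hm]
  constructor
  · rintro ⟨φ, rfl⟩ i
    obtain ⟨x, y, hx, hy⟩ := exists_lifts (φ : MulAut (K m l))
    have hN := (mem_autI_two_K_iff hm hl hx hy).mp φ.2
    rw [disp_eq hm hl φ hx hy, ← toAdd_eq_zero, toAdd_pow, toAdd_ofAdd, nsmul_eq_mul]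
    fin_cases i
    · exact (by linear_combination hN.i_fst : 2 * (2 * kap m l * ((coordEquiv hm x).i - 1)) = 0)
    · exact (by linear_combination hN.j_fst : 2 * (2 * kap m l * (coordEquiv hm x).j) = 0)
    · exact (by linear_combination hN.i_snd : 2 * (2 * kap m l * (coordEquiv hm y).i) = 0)
    · exact (by linear_combination hN.j_snd : 2 * (2 * kap m l * ((coordEquiv hm y).j - 1)) = 0)
  · intro h
    have h2 : ∀ i, 2 * (v i).toAdd = 0 := fun i => by
      have := congrArg Multiplicative.toAdd (h i)
      rwa [toAdd_pow, nsmul_eq_mul, toAdd_one] at this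
    choose w hw using fun i => exists_two_kap_mul_eq (l := l) hm hl (h2 i)
    have hw' : ∀ i, 4 * kap m l * w i = 0 := fun i => by linear_combination 2 * hw i + h2 i
    set x := (coordEquiv (l := l) hm).symm ⟨1 + w 0, w 1, 0⟩ with hx
    set y := (coordEquiv (l := l) hm).symm ⟨w 2, 1 + w 3, 0⟩ with hy
    have ex : coordEquiv hm x = ⟨1 + w 0, w 1, 0⟩ := by rw [hx, MulEquiv.apply_symm_apply]
    have ey : coordEquiv hm y = ⟨w 2, 1 + w 3, 0⟩ := by rw [hy, MulEquiv.apply_symm_apply]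
    have hN : Near hm x y := by
      refine ⟨?_, ?_, ?_, ?_⟩ <;> simp only [ex, ey, add_sub_cancel_left, hw']
    obtain ⟨φ, hA, hB⟩ := hN.exists_mulAut_K hl
    refine ⟨⟨φ, (mem_autI_two_K_iff hm hl hA hB).mpr hN⟩, ?_⟩
    rw [disp_eq hm hl _ hA hB]
    funext i
    apply Multiplicative.toAdd.injective
    simp only [ex, ey, add_sub_cancel_left, hw]
    fin_cases i <;> rfl

/-- `Aut₂(K) / Inn(K) Aut₁(K)` is elementary abelian of order `16`. -/
noncomputable def outKEquiv (hm : 1 < m) (hl : Odd l) : OutI (K m l) 1 ≃* (Fin 4 → Multiplicative (ZMod 2)) :=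
  (QuotientGroup.quotientMulEquivOfEq (ker_disp hm hl).symm).trans <|
    (QuotientGroup.quotientKerEquivRange (disp hm hl)).trans <|
    (MulEquiv.subgroupCongr (range_disp hm hl)).trans
    (MonoidHom.ofInjective (twoTorsionPi_injective hm)).symm

theorem twoTorsionPi_outKEquiv (hm : 1 < m) (hl : Odd l) (φ : autI (K m l) 2) :
    twoTorsionPi m (outKEquiv hm hl (QuotientGroup.mk φ)) = disp hm hl φ := by
  have h : outKEquiv hm hl (QuotientGroup.mk φ) =
    (MonoidHom.ofInjective (twoTorsionPi_injective hm)).symm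
      ⟨disp hm hl φ, range_disp hm hl ▸ ⟨φ, rfl⟩⟩ := rfl
  rw [h]
  exact congrArg Subtype.val (MulEquiv.apply_symm_apply
    (MonoidHom.ofInjective (twoTorsionPi_injective hm)) _)

end OutK

end MacdonaldAut

namespace MacdonaldAut

/-! ### The image of Aut₃(H) and the automorphism Γ -/

section OutH

variable {m : ℕ} {l : ℤ}

/-- The images of the generators under an automorphism satisfy the defining relations. -/
theorem isMacdonald_map (φ : MulAut (H m l)) : IsMacdonald m l (φ (genA m l)) (φ (genB m l))
    (comm (φ (genA m l)) (φ (genB m l))) := by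
  have h := isMacdonald_gen m l
  have hC : comm (φ (genA m l)) (φ (genB m l)) = φ (comm (genA m l) (genB m l)) :=
    (map_comm φ.toMonoidHom _ _).symm
  rw [hC]
  refine ⟨?_, ?_, ?_, ?_, ?_⟩
  · rw [← map_pow, h.pow_A, map_one]
  · rw [← map_pow, h.pow_B, map_one]
  · rw [← map_zpow, ← h.conj_A]; simp
  · rw [← map_zpow, ← h.conj_B]; simp
  · rw [← map_mul, ← h.comm_AB]; simp

/-- The isomorphism type of `Aut₃(H) / Inn(H) Aut₂(H)` is read off from two coordinates of the
image in `Aut₂(K) / Inn(K) Aut₁(K)`. -/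
noncomputable def outHHom (hm : 1 < m) (hl : Odd l) :
    OutI (H m l) 2 →* Multiplicative (ZMod 2) × Multiplicative (ZMod 2) :=
  ((Pi.evalMonoidHom _ 0).prod (Pi.evalMonoidHom _ 1)).comp
    ((outKEquiv hm hl).toMonoidHom.comp (LamHat (H m l) 1))

theorem twoTorsion_outKEquiv_LamHat (hm : 1 < m) (hl : Odd l) (φ : autI (H m l) 3) (i : Fin 4) :
    twoTorsion m (outKEquiv hm hl (LamHat (H m l) 1 (QuotientGroup.mk φ)) i) =
      Multiplicative.ofAdd
      (![2 * kap m l * ((coordEquiv hm ((φ : MulAut (H m l)) (genA m l))).i - 1),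
        2 * kap m l * (coordEquiv hm ((φ : MulAut (H m l)) (genA m l))).j,
        2 * kap m l * (coordEquiv hm ((φ : MulAut (H m l)) (genB m l))).i,
        2 * kap m l * ((coordEquiv hm ((φ : MulAut (H m l)) (genB m l))).j - 1)] i) :=
  (congrFun (twoTorsionPi_outKEquiv hm hl ⟨Lam (H m l) φ, Lam_mem_autI _ φ.2⟩) i).trans
    (congrFun (disp_eq hm hl ⟨Lam (H m l) φ, Lam_mem_autI _ φ.2⟩ rfl rfl) i)

theorem outHHom_fst_eq_one_iff (hm : 1 < m) (hl : Odd l) (φ : autI (H m l) 3) :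
    (outHHom hm hl (QuotientGroup.mk φ)).1 = 1 ↔
      2 * kap m l * ((coordEquiv hm ((φ : MulAut (H m l)) (genA m l))).i - 1) = 0 := by
  have h := twoTorsion_outKEquiv_LamHat hm hl φ 0
  rw [← (twoTorsion_injective hm).eq_iff, map_one, ← ofAdd_eq_one]
  exact Eq.congr_left h

theorem outHHom_snd_eq_one_iff (hm : 1 < m) (hl : Odd l) (φ : autI (H m l) 3) :
    (outHHom hm hl (QuotientGroup.mk φ)).2 = 1 ↔
      2 * kap m l * (coordEquiv hm ((φ : MulAut (H m l)) (genA m l))).j = 0 := by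
  have h := twoTorsion_outKEquiv_LamHat hm hl φ 1
  rw [← (twoTorsion_injective hm).eq_iff, map_one, ← ofAdd_eq_one]
  exact Eq.congr_left h

/-- The images of A and B under an automorphism of H satisfy the defining relations. By
`Near.isMacdonald_iff` the first and third displacements sum to zero, and so do the second and
fourth, so the first two determine the class. -/
theorem outHHom_injective (hm : 1 < m) (hl : Odd l) :
    Function.Injective (outHHom (l := l) hm hl) := by
  rw [injective_iff_map_eq_one]
  intro q hq
  induction q using QuotientGroup.induction_on with
  | H φ =>
  have hN := (mem_autI_three_H_iff hm hl _).mp φ.2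
  obtain ⟨h1, h2⟩ := (hN.isMacdonald_iff hl).mp (isMacdonald_map (φ : MulAut (H m l)))
  have h3 := (outHHom_fst_eq_one_iff hm hl φ).mp (congrArg Prod.fst hq)
  have h4 := (outHHom_snd_eq_one_iff hm hl φ).mp (congrArg Prod.snd hq)
  refine LamHat_injective (H m l) 1 ((outKEquiv hm hl).injective ?_)
  rw [map_one, map_one]
  funext i
  apply twoTorsion_injective hm
  rw [twoTorsion_outKEquiv_LamHat, Pi.one_apply, map_one, ofAdd_eq_one]
  fin_cases i
  · exact h3
  · exact h4
  · exact (by linear_combination h1 - h3 :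
      2 * kap m l * (coordEquiv hm ((φ : MulAut (H m l)) (genB m l))).i = 0)
  · exact (by linear_combination h2 - h4 :
      2 * kap m l * ((coordEquiv hm ((φ : MulAut (H m l)) (genB m l))).j - 1) = 0)

theorem two_kap_mul_pow (hm : 1 < m) :
    2 * kap m l * (2 : ZMod (2 ^ (2 * m - 1))) ^ (m - 1) = 4 * sig m ^ 2 * l := by
  rw [two_pow_pred hm, kap_eq]; ring

theorem two_kap_mul_pow_ne_zero (hm : 1 < m) (hl : Odd l) :
    2 * kap m l * (2 : ZMod (2 ^ (2 * m - 1))) ^ (m - 1) ≠ 0 := by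
  rw [two_kap_mul_pow hm, Ne, four_sig_sq_mul_eq_zero_iff hm, ← even_iff_two_dvd,
    Int.not_even_iff_odd]
  exact hl

theorem two_mul_two_kap_mul_pow (hm : 1 < m) :
    2 * (2 * kap m l * (2 : ZMod (2 ^ (2 * m - 1))) ^ (m - 1)) = 0 := by
  rw [two_kap_mul_pow hm]
  linear_combination l * eight_sig_sq m

theorem two_kap_i_mul (hm : 1 < m) (x y : H m l) : 2 * kap m l * (coordEquiv hm (x * y)).i =
    2 * kap m l * (coordEquiv hm x).i + 2 * kap m l * (coordEquiv hm y).i := by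
  rw [map_mul, Coord.two_kap_mul_i]

theorem two_kap_j_mul (hm : 1 < m) (x y : H m l) : 2 * kap m l * (coordEquiv hm (x * y)).j =
    2 * kap m l * (coordEquiv hm x).j + 2 * kap m l * (coordEquiv hm y).j := by
  rw [map_mul, Coord.two_kap_mul_j]

theorem two_kap_i_pow (hm : 1 < m) (x : H m l) (n : ℕ) : 2 * kap m l * (coordEquiv hm (x ^ n)).i =
    n * (2 * kap m l * (coordEquiv hm x).i) := by
  rw [← toAdd_chiI, map_pow, toAdd_pow, nsmul_eq_mul, toAdd_chiI]

theorem two_kap_j_pow (hm : 1 < m) (x : H m l) (n : ℕ) : 2 * kap m l * (coordEquiv hm (x ^ n)).j =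
    n * (2 * kap m l * (coordEquiv hm x).j) := by
  rw [← toAdd_chiJ, map_pow, toAdd_pow, nsmul_eq_mul, toAdd_chiJ]

/-- The displacements of the proposed pair are (2κs, 0, 2κs, 0) with s = 2^(m-1). As 4κs = 0, the
pair is near and both errors vanish. -/
theorem exists_gamma (hm : 1 < m) (hl : Odd l) : ∃ Γ : MulAut (H m l), Γ ∈ autI (H m l) 3 ∧
    Γ (genA m l) = genA m l ^ (1 + 2 ^ (m - 1)) ∧
    Γ (genB m l) = genB m l * genA m l ^ (2 ^ (m - 1)) := by
  have h2 := two_mul_two_kap_mul_pow (l := l) hm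
  have e1 := two_kap_i_pow hm (genA m l) (1 + 2 ^ (m - 1))
  have e2 := two_kap_j_pow hm (genA m l) (1 + 2 ^ (m - 1))
  have e3 := two_kap_i_mul hm (genB m l) (genA m l ^ (2 ^ (m - 1)))
  have e4 := two_kap_j_mul hm (genB m l) (genA m l ^ (2 ^ (m - 1)))
  rw [two_kap_i_pow] at e3
  rw [two_kap_j_pow] at e4
  simp only [coordEquiv_genA, coordEquiv_genB] at e1 e2 e3 e4
  push_cast at e1 e2 e3 e4
  have hN : Near hm (genA m l ^ (1 + 2 ^ (m - 1))) (genB m l * genA m l ^ (2 ^ (m - 1))) :=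
    ⟨by linear_combination 2 * e1 + h2, by linear_combination 2 * e2,
      by linear_combination 2 * e3 + h2, by linear_combination 2 * e4⟩
  obtain ⟨Γ, hA, hB⟩ := hN.exists_mulAut hl ((hN.isMacdonald_iff hl).mpr
    ⟨by linear_combination e1 + e3 + h2, by linear_combination e2 + e4⟩)
  refine ⟨Γ, (mem_autI_three_H_iff hm hl _).mpr ?_, hA, hB⟩
  rwa [hA, hB]

theorem outHHom_gamma (hm : 1 < m) (hl : Odd l) {Γ : autI (H m l) 3}
    (hA : (Γ : MulAut (H m l)) (genA m l) = genA m l ^ (1 + 2 ^ (m - 1))) :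
    (outHHom hm hl (QuotientGroup.mk Γ)).1 ≠ 1 ∧ (outHHom hm hl (QuotientGroup.mk Γ)).2 = 1 := by
  have e1 := two_kap_i_pow hm (genA m l) (1 + 2 ^ (m - 1))
  have e2 := two_kap_j_pow hm (genA m l) (1 + 2 ^ (m - 1))
  simp only [coordEquiv_genA] at e1 e2
  push_cast at e1 e2
  rw [Ne, outHHom_fst_eq_one_iff, outHHom_snd_eq_one_iff, hA]
  refine ⟨fun h => two_kap_mul_pow_ne_zero hm hl ?_, by linear_combination e2⟩
  linear_combination h - e1

theorem outHHom_gamma_swap (hm : 1 < m) (hl : Odd l) {Γ : autI (H m l) 3}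
    (hA : (Γ : MulAut (H m l)) (genA m l) = genA m l * genB m l ^ (2 ^ (m - 1))) :
    (outHHom hm hl (QuotientGroup.mk Γ)).1 = 1 ∧ (outHHom hm hl (QuotientGroup.mk Γ)).2 ≠ 1 := by
  have e3 := two_kap_i_mul hm (genA m l) (genB m l ^ (2 ^ (m - 1)))
  have e4 := two_kap_j_mul hm (genA m l) (genB m l ^ (2 ^ (m - 1)))
  rw [two_kap_i_pow] at e3
  rw [two_kap_j_pow] at e4
  simp only [coordEquiv_genA, coordEquiv_genB] at e3 e4
  push_cast at e3 e4
  rw [Ne, outHHom_fst_eq_one_iff, outHHom_snd_eq_one_iff, hA]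
  refine ⟨by linear_combination e3, fun h => two_kap_mul_pow_ne_zero hm hl ?_⟩
  linear_combination h - e4

theorem eq_one_or_eq_or_eq_or_eq_mul : ∀ a b c : Multiplicative (ZMod 2) × Multiplicative (ZMod 2),
    a.1 ≠ 1 ∧ a.2 = 1 → b.1 = 1 ∧ b.2 ≠ 1 → c = 1 ∨ c = a ∨ c = b ∨ c = a * b := by
  rintro ⟨a, a'⟩ ⟨b, b'⟩ ⟨c, c'⟩
  revert a a' b b' c c'
  decide

/-- Two classes of `Aut₃(H) / Inn(H) Aut₂(H)` with independent images exhaust it. -/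
theorem exists_eq_mul (hm : 1 < m) (hl : Odd l) {p q : OutI (H m l) 2}
    (hp : (outHHom hm hl p).1 ≠ 1 ∧ (outHHom hm hl p).2 = 1)
    (hq : (outHHom hm hl q).1 = 1 ∧ (outHHom hm hl q).2 ≠ 1) (r : OutI (H m l) 2) :
    r = 1 ∨ r = p ∨ r = q ∨ r = p * q := by
  have := eq_one_or_eq_or_eq_or_eq_mul _ _ (outHHom hm hl r) hp hq
  rw [← map_mul, ← map_one (outHHom hm hl)] at this
  simpa only [(outHHom_injective hm hl).eq_iff] using this

theorem isKleinFour_range_LamHat (hm : 1 < m) (hl : Odd l) {p q : OutI (H m l) 2}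
    (hp : (outHHom hm hl p).1 ≠ 1 ∧ (outHHom hm hl p).2 = 1)
    (hq : (outHHom hm hl q).1 = 1 ∧ (outHHom hm hl q).2 ≠ 1) :
    IsKleinFour (LamHat (H m l) 1).range := by
  have hs : Function.Surjective (outHHom (l := l) hm hl) := by
    intro c
    rcases eq_one_or_eq_or_eq_or_eq_mul _ _ c hp hq with h | h | h | h
    · exact ⟨1, h ▸ map_one _⟩
    · exact ⟨p, h.symm⟩
    · exact ⟨q, h.symm⟩
    · exact ⟨p * q, h ▸ map_mul _ _ _⟩
  let e := (MonoidHom.ofInjective (LamHat_injective (H m l) 1)).symm.trans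
    (MulEquiv.ofBijective _ ⟨outHHom_injective hm hl, hs⟩)
  refine ⟨?_, ?_⟩
  · rw [Nat.card_congr e.toEquiv, Nat.card_prod]
    simp
  · rw [Monoid.exponent_eq_of_mulEquiv e]
    refine Nat.dvd_prime Nat.prime_two |>.mp (Monoid.exponent_dvd_of_forall_pow_eq_one ?_)
      |>.resolve_left fun h => ?_
    · rintro ⟨a, b⟩
      revert a b
      decide
    · have := Monoid.exp_eq_one_iff.mp h
      exact hp.1 (congrArg Prod.fst (Subsingleton.elim _ (1 : Multiplicative (ZMod 2) × _)))

end OutH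

/-! ### The order of Aut₃(H) -/

section Card

/-- The odd factor does not change the kernel, and multiplication by 2^b on a cyclic group of order
2^a has kernel of order gcd(2^a, 2^b). -/
theorem card_two_pow_mul_eq_zero {a b : ℕ} (hab : b ≤ a) {c : ℤ} (hc : Odd c) :
    Nat.card {x : ZMod (2 ^ a) // 2 ^ b * c * x = 0} = 2 ^ b := by
  have h := IsAddCyclic.card_nsmulAddMonoidHom_ker (G := ZMod (2 ^ a)) (2 ^ b)
  rw [Nat.card_zmod, Nat.gcd_eq_right (pow_dvd_pow 2 hab)] at h
  rw [← h]
  refine Nat.card_congr (Equiv.subtypeEquivRight fun x => ?_)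
  obtain ⟨n, rfl⟩ := ZMod.intCast_surjective x
  rw [intCast_zmod_two_pow_mul_eq_zero_iff hab hc, ← intCast_zmod_two_pow_mul_eq_zero_iff hab
    odd_one, AddMonoidHom.mem_ker, nsmulAddMonoidHom_apply, nsmul_eq_mul]
  push_cast
  rw [mul_one]

variable {m : ℕ} {l : ℤ}

theorem card_four_kap_ker (hm : 1 < m) (hl : Odd l) :
    Nat.card {x : ZMod (2 ^ (2 * m - 1)) // 4 * kap m l * x = 0} = 2 ^ m := by
  rw [← card_two_pow_mul_eq_zero (show m ≤ 2 * m - 1 by omega) hl, two_pow_eq hm, kap_eq, mul_assoc]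

theorem card_two_kap_ker (hm : 1 < m) (hl : Odd l) :
    Nat.card {x : ZMod (2 ^ (2 * m - 1)) // 2 * kap m l * x = 0} = 2 ^ (m - 1) := by
  rw [← card_two_pow_mul_eq_zero (show m - 1 ≤ 2 * m - 1 by omega) hl, two_pow_pred hm, kap_eq,
    mul_assoc]

theorem card_autI_three (hm : 1 < m) (hl : Odd l) :
    Nat.card (autI (H m l) 3) = 2 ^ (8 * m - 4) := by
  let R := ZMod (2 ^ (2 * m - 1))
  let V := {x : R // 4 * kap m l * x = 0}
  let W := {x : R // 2 * kap m l * x = 0}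
  have hN : ∀ φ : autI (H m l) 3, Near hm ((φ : MulAut (H m l)) (genA m l))
    ((φ : MulAut (H m l)) (genB m l)) := fun φ => (mem_autI_three_H_iff hm hl _).mp φ.2
  have hM := fun φ : autI (H m l) 3 => ((hN φ).isMacdonald_iff hl).mp (isMacdonald_map _)
  -- The parameters are j_x, i_y, the two error sums i_x + i_y - 1 and j_x + j_y - 1, and the free
  -- exponents k_x, k_y. The nearness conditions on i_x and j_y follow from these, so the parameters
  -- are independent and the exponents add up to 2m + 2(m - 1) + 2(2m - 1) = 8m - 4.
  let F : autI (H m l) 3 → V × V × W × W × R × R := fun φ =>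
    (⟨_, (hN φ).j_fst⟩, ⟨_, (hN φ).i_snd⟩, ⟨_, (hM φ).1⟩, ⟨_, (hM φ).2⟩,
      (coordEquiv hm ((φ : MulAut (H m l)) (genA m l))).k,
      (coordEquiv hm ((φ : MulAut (H m l)) (genB m l))).k)
  have hF : Function.Bijective F := by
    constructor
    · intro φ ψ h
      simp only [F, Prod.mk.injEq] at h
      obtain ⟨h1, h2, h3, h4, h5, h6⟩ := h
      replace h1 := congrArg Subtype.val h1
      replace h2 := congrArg Subtype.val h2
      replace h3 := congrArg Subtype.val h3
      replace h4 := congrArg Subtype.val h4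
      dsimp only at h1 h2 h3 h4
      have hA : (φ : MulAut (H m l)) (genA m l) = (ψ : MulAut (H m l)) (genA m l) := by
        refine (coordEquiv hm).injective (Coord.ext ?_ h1 h5)
        linear_combination h3 - h2
      have hB : (φ : MulAut (H m l)) (genB m l) = (ψ : MulAut (H m l)) (genB m l) := by
        refine (coordEquiv hm).injective (Coord.ext h2 ?_ h6)
        linear_combination h4 - h1
      apply Subtype.ext
      ext x
      exact DFunLike.congr_fun (hom_ext_H (f := (φ : MulAut (H m l)).toMonoidHom)
        (g := (ψ : MulAut (H m l)).toMonoidHom) hA hB) x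
    · rintro ⟨⟨a, ha⟩, ⟨b, hb⟩, ⟨c, hc⟩, ⟨d, hd⟩, k, n⟩
      -- The exponents i_x and j_y are recovered by solving the two error sums for them.
      set x := (coordEquiv (l := l) hm).symm ⟨1 + c - b, a, k⟩ with hx
      set y := (coordEquiv (l := l) hm).symm ⟨b, 1 + d - a, n⟩ with hy
      have ex : coordEquiv hm x = ⟨1 + c - b, a, k⟩ := by rw [hx, MulEquiv.apply_symm_apply]
      have ey : coordEquiv hm y = ⟨b, 1 + d - a, n⟩ := by rw [hy, MulEquiv.apply_symm_apply]
      have hxy : Near hm x y := by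
        refine ⟨?_, ?_, ?_, ?_⟩ <;> simp only [ex, ey]
        · linear_combination 2 * hc - hb
        · exact ha
        · exact hb
        · linear_combination 2 * hd - ha
      obtain ⟨φ, hA, hB⟩ := hxy.exists_mulAut hl ((hxy.isMacdonald_iff hl).mpr (by
        simp only [ex, ey]
        exact ⟨by linear_combination hc, by linear_combination hd⟩))
      refine ⟨⟨φ, (mem_autI_three_H_iff hm hl _).mpr (by rwa [hA, hB])⟩, ?_⟩
      rw [← hA] at ex
      rw [← hB] at ey
      refine Prod.ext (Subtype.ext ?_) (Prod.ext (Subtype.ext ?_) (Prod.ext (Subtype.ext ?_)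
        (Prod.ext (Subtype.ext ?_) (Prod.ext ?_ ?_)))) <;> simp only [F, ex, ey] <;> ring
  rw [Nat.card_congr (Equiv.ofBijective F hF)]
  simp only [Nat.card_prod, V, W, R, card_four_kap_ker hm hl, card_two_kap_ker hm hl, Nat.card_zmod]
  simp only [← pow_add]
  congr 1
  omega

end Card

end MacdonaldAut

theorem mainTheorem9 (m : ℕ) (hm : 1 < m) (l : ℤ) (hl : Odd l) :
    -- the two quotients are quotients by honest subgroups
    MacdonaldAut.innAutI (MacdonaldAut.H m l) 2 ≤ MacdonaldAut.autI (MacdonaldAut.H m l) 3 ∧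
    MacdonaldAut.innAutI (MacdonaldAut.K m l) 1 ≤ MacdonaldAut.autI (MacdonaldAut.K m l) 2 ∧
    -- `Aut₂(K) / Inn(K) Aut₁(K) ≅ (ℤ/2)⁴`
    Nonempty (MacdonaldAut.OutI (MacdonaldAut.K m l) 1 ≃* Multiplicative (Fin 4 → ZMod 2)) ∧
    -- the map induced by `Λ` is an embedding
    Function.Injective (MacdonaldAut.LamHat (MacdonaldAut.H m l) 1) ∧
    -- the automorphisms `ν : A ↔ B`, `Γ : A ↦ A^(1+s), B ↦ B A^s`, `s = 2^(m-1)`, and `Γ^ν`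
    ∃ (ν : MulAut (MacdonaldAut.H m l)) (Γ Γν : MacdonaldAut.autI (MacdonaldAut.H m l) 3),
      ν (MacdonaldAut.genA m l) = MacdonaldAut.genB m l ∧
      ν (MacdonaldAut.genB m l) = MacdonaldAut.genA m l ∧
      (Γ : MulAut (MacdonaldAut.H m l)) (MacdonaldAut.genA m l) =
        MacdonaldAut.genA m l ^ (1 + 2 ^ (m - 1)) ∧
      (Γ : MulAut (MacdonaldAut.H m l)) (MacdonaldAut.genB m l) =
        MacdonaldAut.genB m l * MacdonaldAut.genA m l ^ (2 ^ (m - 1)) ∧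
      (Γν : MulAut (MacdonaldAut.H m l)) = ν⁻¹ * (Γ : MulAut (MacdonaldAut.H m l)) * ν ∧
      -- the image of the embedding
      (MacdonaldAut.LamHat (MacdonaldAut.H m l) 1).range =
        Subgroup.closure {MacdonaldAut.LamHat (MacdonaldAut.H m l) 1 (QuotientGroup.mk Γ),
          MacdonaldAut.LamHat (MacdonaldAut.H m l) 1 (QuotientGroup.mk Γν)} ∧
      IsKleinFour (MacdonaldAut.LamHat (MacdonaldAut.H m l) 1).range ∧
      -- `Aut₃(H) = Inn(H) Aut₂(H) ⟨Γ, Γ^ν⟩`, as a product of subgroups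
      (MacdonaldAut.autI (MacdonaldAut.H m l) 3 : Set (MulAut (MacdonaldAut.H m l))) =
        (MacdonaldAut.inn (MacdonaldAut.H m l) : Set (MulAut (MacdonaldAut.H m l))) *
        (MacdonaldAut.autI (MacdonaldAut.H m l) 2 : Set (MulAut (MacdonaldAut.H m l))) *
        (Subgroup.closure {(Γ : MulAut (MacdonaldAut.H m l)),
          (Γν : MulAut (MacdonaldAut.H m l))} : Set (MulAut (MacdonaldAut.H m l))) ∧
      Nat.card (MacdonaldAut.autI (MacdonaldAut.H m l) 3) = 2 ^ (8 * m - 4) := by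
  open MacdonaldAut in
  obtain ⟨Γ, hΓ, hA, hB⟩ := exists_gamma (l := l) hm hl
  have hΓ' : (swapAut m l)⁻¹ * Γ * swapAut m l ∈ autI (H m l) 3 := by
    simpa using (autI_normal (H m l) 3).conj_mem Γ hΓ (swapAut m l)⁻¹
  have hinv : (swapAut m l)⁻¹ = swapAut m l :=
    inv_eq_of_mul_eq_one_left (MulEquiv.ext swapAut_swapAut)
  -- The conjugate moves A by B^s, so its first two displacements are (0, 2κs), complementary to
  -- those of Γ.
  have hA' : ((swapAut m l)⁻¹ * Γ * swapAut m l) (genA m l) =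
      genA m l * genB m l ^ (2 ^ (m - 1)) := by
    rw [hinv, MulAut.mul_apply, MulAut.mul_apply, swapAut_genA, hB, map_mul, map_pow, swapAut_genA,
      swapAut_genB]
  have hp := outHHom_gamma hm hl (Γ := ⟨Γ, hΓ⟩) hA
  have hq := outHHom_gamma_swap hm hl (Γ := ⟨_, hΓ'⟩) hA'
  refine ⟨innAutI_H_le hm hl, innAutI_K_le hm hl,
    ⟨(outKEquiv hm hl).trans (MulEquiv.piMultiplicative _).symm⟩, LamHat_injective _ 1,
    swapAut m l, ⟨Γ, hΓ⟩, ⟨_, hΓ'⟩, swapAut_genA, swapAut_genB, hA, hB, rfl, ?_,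
    isKleinFour_range_LamHat hm hl hp hq, ?_, card_autI_three hm hl⟩
  · apply le_antisymm
    · rintro _ ⟨r, rfl⟩
      rcases exists_eq_mul hm hl hp hq r with rfl | rfl | rfl | rfl
      · exact map_one (LamHat (H m l) 1) ▸ one_mem _
      · exact Subgroup.subset_closure (Or.inl rfl)
      · exact Subgroup.subset_closure (Or.inr rfl)
      · rw [map_mul]
        exact mul_mem (Subgroup.subset_closure (Or.inl rfl))
          (Subgroup.subset_closure (Or.inr rfl))
    · rw [Subgroup.closure_le]
      rintro _ (rfl | rfl) <;> exact ⟨_, rfl⟩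
  · set D := Subgroup.closure {Γ, (swapAut m l)⁻¹ * Γ * swapAut m l} with hD
    have hD1 : Γ ∈ D := Subgroup.subset_closure (Or.inl rfl)
    have hD2 : (swapAut m l)⁻¹ * Γ * swapAut m l ∈ D := Subgroup.subset_closure (Or.inr rfl)
    have hDle : D ≤ autI (H m l) 3 := by
      rw [hD, Subgroup.closure_le]
      rintro _ (rfl | rfl)
      exacts [hΓ, hΓ']
    ext φ
    constructor
    · intro hφ
      -- All four classes modulo Inn(H)Aut₂(H) are represented in D. For a representative δ of the
      -- class of φ, the element φδ⁻¹ factors as an inner automorphism times one in Aut₂(H).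
      obtain ⟨δ, hδ, h⟩ : ∃ δ : autI (H m l) 3, (δ : MulAut (H m l)) ∈ D ∧
          (QuotientGroup.mk ⟨φ, hφ⟩ : OutI (H m l) 2) = QuotientGroup.mk δ := by
        rcases exists_eq_mul hm hl hp hq (QuotientGroup.mk ⟨φ, hφ⟩) with h | h | h | h
        · exact ⟨1, one_mem _, h⟩
        · exact ⟨_, hD1, h⟩
        · exact ⟨_, hD2, h⟩
        · exact ⟨_, mul_mem hD1 hD2, h⟩
      have h1 : (⟨φ, hφ⟩ : autI (H m l) 3) * δ⁻¹ ∈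
          (innAutI (H m l) 2).subgroupOf (autI (H m l) 3) := by
        rw [← QuotientGroup.eq_one_iff, QuotientGroup.mk_mul, QuotientGroup.mk_inv, h,
          mul_inv_cancel]
      obtain ⟨σ, hσ, τ, hτ, he⟩ := (mem_innAutI_iff _ _ _).mp (Subgroup.mem_subgroupOf.mp h1)
      refine ⟨σ * τ, ⟨σ, hσ, τ, hτ, rfl⟩, δ, hδ, ?_⟩
      change σ * τ * δ = φ
      rw [he]
      exact inv_mul_cancel_right φ (δ : MulAut (H m l))
    · rintro ⟨_, ⟨σ, hσ, τ, hτ, rfl⟩, δ, hδ, rfl⟩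
      exact mul_mem (innAutI_H_le hm hl (Subgroup.mul_mem_sup hσ hτ)) (hDle hδ)
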